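/- Consider $n \ge 1$ parties on a synchronous network whose topology is any connected undirected (simple) graph $G=(V,E)$ with $|V|=n$; each edge is a link on which the two adjacent parties can send qubits and classical bits to each other. Each party of degree $d$ has ports numbered $1,\dots,d$, one for each of its links, and the numbering of each party is arbitrary. The network is anonymous: all parties run the same program with the same initial data, and the program depends only on $n$ and on the party's own number $d$ of ports. Let $D$ be the maximum degree of $G$. Algorithm I. Each party has a classical variable $\mathrm{status}$, initially "eligible", and one-qubit registers $\mathbf R_0,\mathbf R_1,\mathbf S$. For $k=n,n-1,\dots,2$ every party does the following. (1) Prepare $(|0\rangle+|1\rangle)/\sqrt2$ in $\mathbf R_0$ if eligible, $|0\rangle$ otherwise, and $|\text{consistent}\rangle$ in $\mathbf S$. (2) (Subroutine A.) Prepare two-qubit registers $\mathbf X_i^{(t)}$ with values in $\{0,1,*,\times\}$ for $0\le i\le d$, $1\le t\le n-1$, and $\mathbf X_0^{(n)}$; copy $\mathbf R_0$ to $\mathbf X_0^{(1)}$ if eligible, and set $\mathbf X_0^{(1)}$ to $*$ otherwise. For $t=1,\dots,n-1$: copy $\mathbf X_0^{(t)}$ to $\mathbf X_1^{(t)},\dots,\mathbf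 X_d^{(t)}$, exchange $\mathbf X_i^{(t)}$ with the neighbour at port $i$ for all $i\ge1$, and set $\mathbf X_0^{(t+1)}$ to $x_0\circ x_1\circ\cdots\circ x_d$, where $x_i$ is the content of $\mathbf X_i^{(t)}$ and $\circ$ is the commutative, associative and idempotent operation with $0\circ1=\times$, $x\circ *=x$, $x\circ\times=\times$. If $\mathbf X_0^{(n)}$ contains $\times$, flip $\mathbf S$ between "consistent" and "inconsistent". Then invert all computation and communication of this step other than the flip. (3) Measure $\mathbf S$. If the result is "consistent" and the party is eligible, prepare $|0\rangle$ in $\mathbf R_1$ and: if $k$ is even, apply $U_k$ to $\mathbf R_0$; if $k$ is odd, copy $\mathbf R_0$ to $\mathbf R_1$ in the computational basis and apply $V_k$ to $(\mathbf R_0,\mathbf R_1)$. If the result is "inconsistent", just prepare $|0\rangle$ in $\mathbf R_1$. Here $$U_k=\frac1{\sqrt2}\begin{pmatrix}1&e^{-i\pi/k}\\-e^{i\pi/k}&1\end{pmatrix},\qquad V_k=\frac1{\sqrt{R_k+1}}\begin{pmatrix}\frac1{\sqrt2}&0&\sqrt{R_k}&\frac{e^{i\pi/k}}{\sqrt2}\\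 \frac1{\sqrt2}&0&-\sqrt{R_k}e^{-i\pi/k}&\frac{e^{-i\pi/k}}{\sqrt2}\\ \sqrt{R_k}&0&\frac{e^{-i\pi/(2k)}I_k}{i\sqrt2R_{2k}}&-\sqrt{R_k}\\0&\sqrt{R_k+1}&0&0\end{pmatrix},$$ where $R_k$ and $I_k$ are the real and imaginary parts of $e^{i\pi/k}$. (4) If eligible, measure $\mathbf R_0,\mathbf R_1$ in the computational basis and let $z\in\{0,1,2,3\}$ be the two-bit result; otherwise let $z=-1$. (5) (Subroutine C.) Let $z_{\max}=z$; then, $n-1$ times, send $z_{\max}$ via every port and replace $z_{\max}$ by the maximum of itself and of the values received. If $z\ne z_{\max}$, set $\mathrm{status}$ to "ineligible". Theorem. Algorithm I elects a unique leader exactly: with probability $1$, and within the following bounds on every execution, it ends with exactly one party having $\mathrm{status}$ "eligible" and all the others having $\mathrm{status}$ "ineligible". It uses $O(n^2)$ rounds (simultaneous message passings) and, for $n\ge2$, $O(Dn^2)$ time (the maximum over the parties of the number of elementary steps, including those of the local computation). Each party of degree $d$ sends and receives $O(dn^2)$ qubits, and the total communication of all parties (qubits and classical bits) is $O(|E|n^2)$.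 All implied constants are absolute. -/

import Mathlib

/-!
# Exact quantum leader election in anonymous synchronous networks

First the network model: every party holds classical variables and qubits and runs the same
program, which may depend only on the number `n` of parties and on its own number `d` of ports.
Then Algorithm I, written as such a program.
-/

namespace QNet

/-! ## Local computation -/

/-- Elementary instructions of one party with classical variables `C` over the alphabet `A`
and qubits `Q`. -/
inductive Instr (A C Q : Type) : Type
  /-- `x := f (y, z)` -/
  | assign (x : C) (f : A → A → A) (y z : C) : Instr A C Q
  /-- a one-qubit gate -/
  | gate1 (U : Matrix.unitaryGroup (Fin 2) ℂ) (q : Q) : Instr A C Q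
  /-- a two-qubit gate; the basis `00, 01, 10, 11` of the qubits `q`, `r` is numbered `0, 1, 2, 3` -/
  | gate2 (U : Matrix.unitaryGroup (Fin 4) ℂ) (q r : Q) (h : q ≠ r) : Instr A C Q
  /-- the reversible classical gate that adds the bit `f (q, r)` to the target qubit `t`
  (for a single control take `q = r`) -/
  | toggle (f : Fin 2 → Fin 2 → Fin 2) (q r t : Q) (hq : q ≠ t) (hr : r ≠ t) : Instr A C Q
  /-- discard the content of `q` and prepare `|0⟩` in it -/
  | prepare (q : Q) : Instr A C Q
  /-- measure `q` in the computational basis and store the encoded result in `x` -/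
  | measure (q : Q) (x : C) (g : Fin 2 → A) : Instr A C Q
  /-- perform `body` if the variable `x` has the value `a`, otherwise do nothing -/
  | guard (x : C) (a : A) (body : Instr A C Q) : Instr A C Q

namespace Instr

variable {A C Q : Type}

/-- Number of elementary steps: one per operation and one per test. -/
def cost : Instr A C Q → ℕ
  | guard _ _ body => body.cost + 1
  | _ => 1

/-- The effect of an instruction. Every instruction is a quantum instrument with two outcomes `o`;
the result is the new classical memory together with the Kraus operator of the outcome `o`
(row index: new basis state, column index: old basis state).
Instructions without randomness have the outcome `0` only: their Kraus operator for `1` is `0`.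
The outcome of `prepare` is the discarded content, and it is not stored anywhere. -/
noncomputable def act [DecidableEq A] [DecidableEq C] [DecidableEq Q] [Fintype Q] (o : Fin 2) :
    Instr A C Q → (C → A) → (C → A) × Matrix (Q → Fin 2) (Q → Fin 2) ℂ
  | assign x f y z, m => (Function.update m x (f (m y) (m z)), if o = 0 then 1 else 0)
  | gate1 U q, m =>
      (m, if o = 0 then
        Matrix.of fun x y =>
          if ∀ p, p ≠ q → x p = y p then (U : Matrix (Fin 2) (Fin 2) ℂ) (x q) (y q) else 0
        else 0)
  | gate2 U q r _, m =>
      (m, if o = 0 then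
        Matrix.of fun x y =>
          if ∀ p, p ≠ q → p ≠ r → x p = y p then
            (U : Matrix (Fin 4) (Fin 4) ℂ)
              (finProdFinEquiv (x q, x r)) (finProdFinEquiv (y q, y r))
          else 0
        else 0)
  | toggle f q r t _ _, m =>
      (m, if o = 0 then
        Matrix.of fun x y => if x = Function.update y t (y t + f (y q) (y r)) then 1 else 0
        else 0)
  | prepare q, m =>
      (m, Matrix.of fun x y => if y q = o ∧ x = Function.update y q 0 then 1 else 0)
  | measure q x g, m =>
      (Function.update m x (g o), Matrix.of fun x y => if y q = o ∧ x = y then 1 else 0)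
  | guard x a body, m => if m x = a then body.act o m else (m, if o = 0 then 1 else 0)

/-- The effect of a list of instructions when the instructions have the outcomes `o`. -/
noncomputable def run [DecidableEq A] [DecidableEq C] [DecidableEq Q] [Fintype Q] :
    (L : List (Instr A C Q)) → (Fin L.length → Fin 2) → (C → A) →
      (C → A) × Matrix (Q → Fin 2) (Q → Fin 2) ℂ
  | [], _, m => (m, 1)
  | a :: L, o, m =>
      let first := a.act (o (0 : Fin (L.length + 1))) m
      let rest := run L (fun i => o i.succ) first.1
      (rest.1, rest.2 * first.2)

end Instr

/-! ## Programs -/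

/-- Names of the registers of a party with `d` ports: local registers, whose names `L d` may depend
on `d`, and for each port one register for every name in `P`. -/
abbrev Reg (L : ℕ → Type) (P : Type) (d : ℕ) : Type := L d ⊕ (Fin d × P)

/-- One step of the program that all parties run in common: either a local computation, in which a
party with `d` ports runs the instructions `prog d`, or a round of message passing. In a round every
party sends, via every port, the qubits in the port registers `S` and the symbols in the port
variables `T` of that port, and the received ones take their place. -/
inductive Step (A : Type) (CL : ℕ → Type) (CP : Type) (QL : ℕ → Type) (QP : Type) : Type
  | compute (prog : (d : ℕ) → List (Instr A (Reg CL CP d) (Reg QL QP d))) : Step A CL CP QL QP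
  | exchange (S : Finset QP) (T : Finset CP) : Step A CL CP QL QP

/-- A program, executed by every party. -/
abbrev Program (A : Type) (CL : ℕ → Type) (CP : Type) (QL : ℕ → Type) (QP : Type) : Type :=
  List (Step A CL CP QL QP)

namespace Program

variable {A : Type} {CL : ℕ → Type} {CP : Type} {QL : ℕ → Type} {QP : Type}

/-- Number of rounds, i.e. of simultaneous message passings. -/
def rounds (P : Program A CL CP QL QP) : ℕ :=
  (P.map fun
    | .compute _ => 0
    | .exchange _ _ => 1).sum

/-- Number of bits that represent one symbol of the alphabet. -/
def symbolBits (A : Type) [Fintype A] : ℕ := Nat.clog 2 (Fintype.card A)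

/-- Number of steps, including those of the local computation, that a party with `d` ports
executes: all instructions (with their tests), and one step for every qubit and every bit that the
party sends or receives; each step of the program costs one further unit for the control. -/
def time [Fintype A] (P : Program A CL CP QL QP) (d : ℕ) : ℕ :=
  (P.map fun
    | .compute prog => 1 + ((prog d).map Instr.cost).sum
    | .exchange S T => 1 + 2 * (d * (S.card + symbolBits A * T.card))).sum

/-- Number of qubits that a party with `d` ports sends or receives. -/
def qubitCommunication (P : Program A CL CP QL QP) (d : ℕ) : ℕ :=
  (P.map fun
    | .compute _ => 0
    | .exchange S _ => 2 * (d * S.card)).sum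

/-- Number of qubits and classical bits that a party with `d` ports sends. -/
def sent [Fintype A] (P : Program A CL CP QL QP) (d : ℕ) : ℕ :=
  (P.map fun
    | .compute _ => 0
    | .exchange S T => d * (S.card + symbolBits A * T.card)).sum

end Program

/-! ## Networks and executions -/

section Network

variable {V : Type*} [Fintype V] (G : SimpleGraph V) [DecidableRel G.Adj]

/-- A port numbering: each party numbers the links to its neighbours, independently of the others.
-/
abbrev PortNumbering : Type _ := (v : V) → G.neighborSet v ≃ Fin (G.degree v)

variable {G}

/-- The party and the port at the other end of the link at port `i` of `v`. -/
def PortNumbering.far (σ : PortNumbering G) (v : V) (i : Fin (G.degree v)) :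
    (u : V) × Fin (G.degree u) :=
  ⟨((σ v).symm i).1, σ ((σ v).symm i).1 ⟨v, G.adj_symm ((σ v).symm i).2⟩⟩

/-- Exchange, over every link, the contents of the port registers with names in `S`. -/
def PortNumbering.swap {α : Type} {L : ℕ → Type} {P : Type} [DecidableEq P] (σ : PortNumbering G)
    (S : Finset P) (x : (v : V) → Reg L P (G.degree v) → α) : (v : V) → Reg L P (G.degree v) → α
  | v, .inl l => x v (.inl l)
  | v, .inr (i, p) =>
      if p ∈ S then x (σ.far v i).1 (.inr ((σ.far v i).2, p)) else x v (.inr (i, p))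

/-- A configuration of the network (in one branch of an execution): the classical memories of all
parties, and the amplitudes of the joint pure state of the qubits of all parties. The state is not
normalized: its squared norm is the probability of the branch. -/
structure Config (G : SimpleGraph V) [DecidableRel G.Adj] (A : Type) (CL : ℕ → Type) (CP : Type)
    (QL : ℕ → Type) (QP : Type) where
  mem : (v : V) → Reg CL CP (G.degree v) → A
  amp : ((v : V) → Reg QL QP (G.degree v) → Fin 2) → ℂ

variable {A : Type} {CL : ℕ → Type} {CP : Type} {QL : ℕ → Type} {QP : Type}
  [DecidableEq V] [DecidableEq A] [∀ d, DecidableEq (CL d)] [DecidableEq CP]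
  [∀ d, DecidableEq (QL d)] [DecidableEq QP] [∀ d, Fintype (QL d)] [Fintype QP]

/-- The branches after one step of the program. In a local computation there is one branch for each
family of outcomes, and the tensor product of the local Kraus operators acts on the joint state. -/
noncomputable def Step.next (σ : PortNumbering G) (c : Config G A CL CP QL QP) :
    Step A CL CP QL QP → Multiset (Config G A CL CP QL QP)
  | .compute prog =>
      (Finset.univ : Finset ((v : V) → Fin (prog (G.degree v)).length → Fin 2)).val.map fun o =>
        { mem := fun v => (Instr.run (prog (G.degree v)) (o v) (c.mem v)).1
          amp := fun x =>
            ∑ y, (∏ v, (Instr.run (prog (G.degree v)) (o v) (c.mem v)).2 (x v) (y v)) * c.amp y }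
  | .exchange S T => {{ mem := σ.swap T c.mem, amp := fun x => c.amp (σ.swap S x) }}

/-- The final configurations, one for each branch of the execution. -/
noncomputable def Program.branches (σ : PortNumbering G) :
    Program A CL CP QL QP → Config G A CL CP QL QP → Multiset (Config G A CL CP QL QP)
  | [], c => {c}
  | s :: P, c => (s.next σ c).bind (Program.branches σ P)

open Classical in
/-- The probability that an execution of `P` that starts in `c` ends with classical memories that
satisfy `event`. -/
noncomputable def Program.prob (σ : PortNumbering G) (P : Program A CL CP QL QP)
    (c : Config G A CL CP QL QP)
    (event : ((v : V) → Reg CL CP (G.degree v) → A) → Prop) : ℝ :=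
  ((Program.branches σ P c).map fun c' => if event c'.mem then ∑ x, ‖c'.amp x‖ ^ 2 else 0).sum

end Network

/-! ## Algorithm I -/

namespace AlgorithmI

open Complex

/-- `R_k`, the real part of `exp (i π / k)` -/
noncomputable def R (k : ℕ) : ℝ := (exp (I * (Real.pi / k))).re

/-- `I_k`, the imaginary part of `exp (i π / k)` -/
noncomputable def J (k : ℕ) : ℝ := (exp (I * (Real.pi / k))).im

/-- The Hadamard matrix -/
noncomputable def matH : Matrix (Fin 2) (Fin 2) ℂ :=
  ((1 / √2 : ℝ) : ℂ) • !![1, 1; 1, -1]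

/-- The matrix `U_k` -/
noncomputable def matU (k : ℕ) : Matrix (Fin 2) (Fin 2) ℂ :=
  ((1 / √2 : ℝ) : ℂ) • !![1, exp (-I * (Real.pi / k)); -exp (I * (Real.pi / k)), 1]

/-- The matrix `V_k` -/
noncomputable def matV (k : ℕ) : Matrix (Fin 4) (Fin 4) ℂ :=
  ((1 / √(R k + 1) : ℝ) : ℂ) •
    !![1 / ((√2 : ℝ) : ℂ), 0, ((√(R k) : ℝ) : ℂ), exp (I * (Real.pi / k)) / ((√2 : ℝ) : ℂ);
       1 / ((√2 : ℝ) : ℂ), 0, -((√(R k) : ℝ) : ℂ) * exp (-I * (Real.pi / k)),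
         exp (-I * (Real.pi / k)) / ((√2 : ℝ) : ℂ);
       ((√(R k) : ℝ) : ℂ), 0,
         exp (-I * (Real.pi / (2 * k))) * (J k : ℂ) / (I * ((√2 : ℝ) : ℂ) * (R (2 * k) : ℂ)),
         -((√(R k) : ℝ) : ℂ);
       0, ((√(R k + 1) : ℝ) : ℂ), 0, 0]

theorem exp_eq (x : ℂ) (θ : ℝ) (h : x = I * θ) :
    exp x = (Real.cos θ : ℂ) + (Real.sin θ : ℂ) * I := by
  rw [h, mul_comm, exp_mul_I, ofReal_cos, ofReal_sin]

theorem R_eq (k : ℕ) : R k = Real.cos (Real.pi / k) := by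
  rw [R, exp_eq _ (Real.pi / k) (by push_cast; rfl)]; simp [-ofReal_cos, -ofReal_sin]

theorem J_eq (k : ℕ) : J k = Real.sin (Real.pi / k) := by
  rw [J, exp_eq _ (Real.pi / k) (by push_cast; rfl)]; simp [-ofReal_cos, -ofReal_sin]

theorem matH_mem : matH ∈ Matrix.unitaryGroup (Fin 2) ℂ := by
  have hw : (√2 : ℝ) ^ 2 = 2 := Real.sq_sqrt (by norm_num)
  have hi : (1 / √2 : ℝ) ^ 2 = 1 / 2 := by rw [div_pow, hw, one_pow]
  rw [Matrix.mem_unitaryGroup_iff, matH]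
  generalize (1 / √2 : ℝ) = a at *
  ext i j
  fin_cases i <;> fin_cases j <;>
    simp [Matrix.mul_apply, Matrix.star_apply, Complex.ext_iff] <;> grind

theorem matU_mem (k : ℕ) : matU k ∈ Matrix.unitaryGroup (Fin 2) ℂ := by
  have hw : (√2 : ℝ) ^ 2 = 2 := Real.sq_sqrt (by norm_num)
  have hi : (1 / √2 : ℝ) ^ 2 = 1 / 2 := by rw [div_pow, hw, one_pow]
  have hc := Real.sin_sq_add_cos_sq (Real.pi / k)
  rw [Matrix.mem_unitaryGroup_iff, matU,
    exp_eq (I * (Real.pi / k)) (Real.pi / k) (by push_cast; rfl),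
    exp_eq (-I * (Real.pi / k)) (-(Real.pi / k)) (by push_cast; ring), Real.cos_neg, Real.sin_neg]
  generalize (1 / √2 : ℝ) = a at *
  generalize Real.cos (Real.pi / k) = c at *
  generalize Real.sin (Real.pi / k) = s at *
  ext i j
  fin_cases i <;> fin_cases j <;>
    simp [Matrix.mul_apply, Matrix.star_apply, Complex.ext_iff] <;> grind

theorem matV_mem {k : ℕ} (hk : 3 ≤ k) : matV k ∈ Matrix.unitaryGroup (Fin 4) ℂ := by
  have hk' : (3 : ℝ) ≤ k := by exact_mod_cast hk
  have hpi := Real.pi_pos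
  have hk0 : (0 : ℝ) < k := by linarith
  have hθ : Real.pi / k ≤ Real.pi / 3 := by gcongr
  have hθ0 : 0 < Real.pi / k := by positivity
  obtain ⟨θ, hθe⟩ : ∃ θ : ℝ, θ = Real.pi / (2 * k) := ⟨_, rfl⟩
  have h2 : Real.pi / k = 2 * θ := by rw [hθe]; field_simp
  have hc0 : 0 < Real.cos (2 * θ) :=
    Real.cos_pos_of_mem_Ioo ⟨by linarith, by linarith⟩
  have hc2 : 0 < Real.cos θ := Real.cos_pos_of_mem_Ioo ⟨by linarith, by linarith⟩
  have hw : (√2 : ℝ) ^ 2 = 2 := Real.sq_sqrt (by norm_num)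
  have hw0 : (0 : ℝ) < √2 := by positivity
  have hr : √(Real.cos (2 * θ)) ^ 2 = Real.cos (2 * θ) := Real.sq_sqrt hc0.le
  have hq : √(Real.cos (2 * θ) + 1) ^ 2 = Real.cos (2 * θ) + 1 := Real.sq_sqrt (by linarith)
  have hq0 : 0 < √(Real.cos (2 * θ) + 1) := Real.sqrt_pos.2 (by linarith)
  have ha : 1 / √(Real.cos (2 * θ) + 1) * √(Real.cos (2 * θ) + 1) = 1 :=
    one_div_mul_cancel hq0.ne'
  have hb : (1 : ℂ) / ((√2 : ℝ) : ℂ) = ((√2 / 2 : ℝ) : ℂ) := by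
    rw [← ofReal_one, ← ofReal_div]; congr 1; field_simp; linarith
  have hcs := Real.sin_sq_add_cos_sq θ
  have hc := Real.cos_two_mul θ
  have hs := Real.sin_two_mul θ
  have hg : exp (-I * (Real.pi / (2 * k))) * (J k : ℂ) / (I * ((√2 : ℝ) : ℂ) * (R (2 * k) : ℂ)) =
      ((-(√2 * Real.sin θ ^ 2) : ℝ) : ℂ) + ((-(√2 * Real.sin θ * Real.cos θ) : ℝ) : ℂ) * I := by
    have h1 : R (2 * k) = Real.cos θ := by rw [R_eq, hθe]; push_cast; rfl
    rw [exp_eq (-I * (Real.pi / (2 * k))) (-θ) (by rw [hθe]; push_cast; ring), Real.cos_neg,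
      Real.sin_neg, h1, J_eq, h2, hs]
    have hcc : (Real.cos θ : ℂ) ≠ 0 := by exact_mod_cast hc2.ne'
    have hww : ((√2 : ℝ) : ℂ) ≠ 0 := by exact_mod_cast hw0.ne'
    have hw2 : ((√2 : ℝ) : ℂ) ^ 2 = 2 := by exact_mod_cast hw
    rw [div_eq_iff (mul_ne_zero (mul_ne_zero I_ne_zero hww) hcc)]
    push_cast
    have hI := I_sq
    push_cast at hcc
    grind
  have hm : (-I * (Real.pi / k) : ℂ) = I * (((-(2 * θ)) : ℝ) : ℂ) := by
    rw [← h2]; push_cast; ring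
  have hp : (I * (Real.pi / k) : ℂ) = I * ((2 * θ : ℝ) : ℂ) := by
    rw [← h2]; push_cast; ring
  have hd : ∀ x : ℂ, x / ((√2 : ℝ) : ℂ) = x * ((√2 / 2 : ℝ) : ℂ) := fun x => by
    rw [div_eq_mul_one_div, hb]
  rw [Matrix.mem_unitaryGroup_iff, matV, hg, exp_eq _ _ hm, exp_eq _ _ hp, R_eq, h2, hd, hd, hd,
    Real.cos_neg, Real.sin_neg]
  clear hb hd hg hm hp hθe h2 hθ hθ0 hpi hk hk' hk0 hq0 hw0 hc0 hc2
  generalize √(Real.cos (2 * θ) + 1) = q at *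
  generalize √(Real.cos (2 * θ)) = r at *
  generalize Real.cos (2 * θ) = c at *
  generalize Real.sin (2 * θ) = s at *
  generalize Real.cos θ = c2 at *
  generalize Real.sin θ = s2 at *
  generalize √2 = w at *
  generalize 1 / q = a at *
  generalize hv : w / 2 = v
  generalize hp : -(w * s2 ^ 2) = p
  generalize ht : -(w * s2 * c2) = t
  ext i j
  fin_cases i <;> fin_cases j <;>
    simp [Matrix.mul_apply, Matrix.star_apply, Complex.ext_iff, Fin.sum_univ_four,
      -mul_eq_zero, -zero_eq_mul]
  all_goals first | done | grind

/-- Values of the classical variables: the integers `-1, 0, 1, 2, 3`, where `⊥` stands for `-1`. -/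
abbrev Val : Type := WithBot (Fin 4)

def eligible : Val := ((1 : Fin 4) : Val)
def ineligible : Val := ((0 : Fin 4) : Val)

def consistent : Val := ((0 : Fin 4) : Val)
def inconsistent : Val := ((1 : Fin 4) : Val)

/-- Names of the local classical variables: `status`; the result `s` of measuring `S`; the results
`z0`, `z1` of measuring `R_0`, `R_1`; `z`, `z_max`, `y_0`; and a variable for comparisons. The
variable `y_i` (`i ≥ 1`) is the only port variable at the `i`th port. -/
inductive CVar : Type
  | status | s | z0 | z1 | z | zmax | y0 | same
  deriving DecidableEq

/-- Names of the local qubits of a party with `d` ports, where `m = n - 1`: `R_0`, `R_1`, `S`, the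
two qubits of each `X_0^{(t)}` for `t = 1, …, n`, and, for `t = 1, …, n - 1`, the two qubits of each
of the work registers that hold the partial results of `x_0 ∘ x_1 ∘ ⋯ ∘ x_d`. The two qubits of
`X_i^{(t)}` (`i ≥ 1`) are the port qubits at the `i`th port, with the names `Fin m × Fin 2`. -/
inductive QVar (m d : ℕ) : Type
  | R0 | R1 | S
  | X0 (t : Fin (m + 1)) (b : Fin 2)
  | Y (t : Fin m) (i : Fin (d + 1)) (b : Fin 2)
  deriving DecidableEq, Fintype

abbrev C (d : ℕ) : Type := Reg (fun _ => CVar) Unit d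
abbrev Q (m d : ℕ) : Type := Reg (QVar m) (Fin m × Fin 2) d
abbrev Ins (m d : ℕ) : Type := Instr Val (C d) (Q m d)
abbrev Prog (m : ℕ) : Type := Program Val (fun _ => CVar) Unit (QVar m) (Fin m × Fin 2)

section Abbreviations

variable {m d : ℕ}

abbrev var (x : CVar) : C d := .inl x
abbrev yPort (i : Fin d) : C d := .inr (i, ())
abbrev R0 : Q m d := .inl .R0
abbrev R1 : Q m d := .inl .R1
abbrev S : Q m d := .inl .S
abbrev X0 (t : Fin (m + 1)) (b : Fin 2) : Q m d := .inl (.X0 t b)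
abbrev Y (t : Fin m) (i : Fin (d + 1)) (b : Fin 2) : Q m d := .inl (.Y t i b)
abbrev X (t : Fin m) (i : Fin d) (b : Fin 2) : Q m d := .inr (i, (t, b))

/-- Copy the content of a qubit to another one (which is in state `|0⟩`). -/
def copy (q t : Q m d) (h : q ≠ t) : Ins m d := .toggle (fun a _ => a) q q t h h

def ifStatus (a : Val) (body : Ins m d) : Ins m d := .guard (var .status) a body

/-- Undo a part of the computation that consists of toggle gates, possibly under tests, and
exchanges of qubits; all of these are involutions. -/
def invert (P : Prog m) : Prog m :=
  P.reverse.map fun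
    | .compute prog => .compute fun d => (prog d).reverse
    | .exchange S T => .exchange S T

/-! ### Subroutine A

The two qubits of a register `X` say whether the value `0` (qubit `0`) and whether the value `1`
(qubit `1`) is known to be held by some eligible party. Thus `0`, `1`, `∗`, `×` are encoded as `10`,
`01`, `00`, `11`, and the operation `∘` is the bitwise "or". -/

/-- Prepare the registers `X` (and the work registers) in the state `|00⟩`. -/
def prepareX (m d : ℕ) : List (Ins m d) :=
  ((List.finRange (m + 1)).flatMap fun t => (List.finRange 2).map fun b => .prepare (X0 t b)) ++
  (List.finRange m).flatMap fun t =>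
    ((List.finRange (d + 1)).flatMap fun i => (List.finRange 2).map fun b => .prepare (Y t i b)) ++
    (List.finRange d).flatMap fun i => (List.finRange 2).map fun b => .prepare (X t i b)

/-- Eligible parties copy the content of `R_0` to `X_0^{(1)}`; for the other parties the content of
`X_0^{(1)}` is `∗`, encoded as `00`. -/
def loadX (m d : ℕ) : List (Ins m d) :=
  [ifStatus eligible (.toggle (fun a _ => a + 1) R0 R0 (X0 0 0) (by simp) (by simp)),
   ifStatus eligible (copy R0 (X0 0 1) (by simp))]

/-- Copy the content of `X_0^{(t)}` to each of `X_1^{(t)}, …, X_d^{(t)}`. -/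
def spreadX (t : Fin m) (d : ℕ) : List (Ins m d) :=
  (List.finRange d).flatMap fun i =>
    (List.finRange 2).map fun b => copy (X0 t.castSucc b) (X t i b) (by simp)

/-- Set the content of `X_0^{(t+1)}` to `x_0 ∘ x_1 ∘ ⋯ ∘ x_d`, from left to right. -/
def combineX (t : Fin m) (d : ℕ) : List (Ins m d) :=
  ((List.finRange 2).map fun b => copy (X0 t.castSucc b) (Y t 0 b) (by simp)) ++
  ((List.finRange d).flatMap fun i => (List.finRange 2).map fun b =>
    .toggle (fun a a' => max a a') (Y t i.castSucc b) (X t i b) (Y t i.succ b)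
      (by simp [Fin.ext_iff]) (by simp)) ++
  (List.finRange 2).map fun b => copy (Y t (Fin.last d) b) (X0 t.succ b) (by simp)

/-- The loop of Subroutine A; in each round the two qubits of `X_i^{(t)}` are exchanged via
port `i`. -/
def loopA (m : ℕ) : Prog m :=
  (List.finRange m).flatMap fun t =>
    [.compute (spreadX t), .exchange {(t, 0), (t, 1)} ∅, .compute (combineX t)]

/-- If the content of `X_0^{(n)}` is `×`, turn the content of `S` over. -/
def flipS (m d : ℕ) : List (Ins m d) :=
  [.toggle (fun a a' => min a a') (X0 (Fin.last m) 0) (X0 (Fin.last m) 1) S (by simp) (by simp)]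

def subroutineA (m : ℕ) : Prog m :=
  [.compute (prepareX m), .compute (loadX m)] ++ loopA m ++ [.compute (flipS m)] ++
    invert (loopA m) ++ invert [.compute (loadX m)]

/-! ### Subroutine B -/

/-- Subroutine B for `k = j + 2`. -/
noncomputable def subroutineB (j m d : ℕ) : List (Ins m d) :=
  if h : Even (j + 2) then
    [.gate1 ⟨matU (j + 2), matU_mem (j + 2)⟩ R0]
  else
    [copy R0 R1 (by simp),
     .gate2 ⟨matV (j + 2), matV_mem (by rcases j with _ | j; · exact absurd (by decide) h
                                        · omega)⟩ R0 R1 (by simp)]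

/-! ### Subroutine C -/

def subroutineC (m : ℕ) : Prog m :=
  [.compute fun _ => [.assign (var .zmax) (fun a _ => a) (var .z) (var .z)]] ++
  (List.finRange m).flatMap fun _ =>
    [.compute fun d =>
       .assign (var .y0) (fun a _ => a) (var .zmax) (var .zmax) ::
       (List.finRange d).map fun i => .assign (yPort i) (fun a _ => a) (var .y0) (var .y0),
     .exchange ∅ {()},
     .compute fun d =>
       .assign (var .zmax) (fun a _ => a) (var .y0) (var .y0) ::
       (List.finRange d).map fun i => .assign (var .zmax) max (var .zmax) (yPort i)]

/-! ### The algorithm -/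

/-- One phase, with the parameter `k = j + 2`. The states `|consistent⟩` and `|inconsistent⟩` of `S`
are `|0⟩` and `|1⟩`. -/
noncomputable def phase (m j : ℕ) : Prog m :=
  [.compute fun _ =>
     [.prepare R0, ifStatus eligible (.gate1 ⟨matH, matH_mem⟩ R0), .prepare S]] ++
  subroutineA m ++
  [.compute fun d =>
     [.measure S (var .s) ![consistent, inconsistent],
      .guard (var .s) consistent (ifStatus eligible (.prepare R1))] ++
     (subroutineB j m d).map (fun a => .guard (var .s) consistent (ifStatus eligible a)) ++
     [.guard (var .s) inconsistent (.prepare R1)],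
   .compute fun _ =>
     [ifStatus eligible (.measure R0 (var .z0) ![((0 : Fin 4) : Val), ((2 : Fin 4) : Val)]),
      ifStatus eligible (.measure R1 (var .z1) ![((0 : Fin 4) : Val), ((1 : Fin 4) : Val)]),
      ifStatus eligible (.assign (var .z) (fun a b => a + b) (var .z0) (var .z1)),
      ifStatus ineligible (.assign (var .z) (fun _ _ => ⊥) (var .z) (var .z))]] ++
  subroutineC m ++
  [.compute fun _ =>
     [.assign (var .same) (fun a b => if a = b then ((1 : Fin 4) : Val) else ((0 : Fin 4) : Val))
        (var .z) (var .zmax),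
      .guard (var .same) ((0 : Fin 4) : Val)
        (.assign (var .status) (fun _ _ => ineligible) (var .status) (var .status))]]

/-- The phases with the parameters `k, k - 1, …, 2`. -/
noncomputable def phases (m : ℕ) : ℕ → Prog m
  | 0 => []
  | 1 => []
  | j + 2 => phase m j ++ phases m (j + 1)

end Abbreviations

/-- Algorithm I for `n` parties. -/
noncomputable def program (n : ℕ) : Prog (n - 1) :=
  [.compute fun _ => [.prepare R0, .prepare R1, .prepare S]] ++ phases (n - 1) n

section Execution

variable {V : Type*} [Fintype V] (G : SimpleGraph V) [DecidableRel G.Adj]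

open Classical in
/-- The initial configuration, the same for all parties: every `status` is "eligible", the other
classical variables have a fixed value, and all qubits are in state `|0⟩`. -/
noncomputable def initial (m : ℕ) :
    Config G Val (fun _ => CVar) Unit (QVar m) (Fin m × Fin 2) where
  mem := fun _ r => if r = .inl .status then eligible else ⊥
  amp := fun x => if ∀ v q, x v q = 0 then 1 else 0

variable {G}

/-- Exactly one party is the leader, and all the others know that they are not. -/
def UniqueLeader (mem : (v : V) → C (G.degree v) → Val) : Prop :=
  ∃ v, mem v (var .status) = eligible ∧ ∀ u, u ≠ v → mem u (var .status) = ineligible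

end Execution

end AlgorithmI

end QNet

open QNet

/-! Every local instruction is a quantum instrument, so the squared norms of the branches always add
up to that of the initial state (`Program.sum_weight_branches`). Success with probability 1
therefore means that every branch of nonzero amplitude ends with a unique leader
(`Program.prob_eq_weight`). This is proved with Hoare triples over the nonzero branches. The
invariant is `Remaining k`: when the phase with parameter `k` starts, at least one and at most `k`
parties are eligible. Each phase lowers the bound by one (`triple_phase`), until it is 1.

A phase never eliminates everybody: the parties that hold the maximal `z` survive, and an ineligible
party holds `⊥`. What needs proof is that exactly `k` eligible parties cannot all obtain the same
`z`. After the preparations the state is invariant under the simultaneous negation of `R_0` at all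
eligible parties (`prepared_of_next`). Subroutine A conjugates a toggle of `S` by a reversible
flooding computation. It keeps the symmetry and writes into every `S` whether both values occur
among the eligible parties (`Prepared.checked`), so all parties measure the same result.

If the result is "inconsistent", different contents of `R_0` are simply read out. If it is
"consistent", the contributing basis states come in pairs of equal amplitude: all eligible parties
hold `c`, or all hold `c + 1`. Their contributions to a common final value `(a, b)` contain the
`k`th powers of two matrix entries, and `U_k`, `V_k` are chosen so that these powers are opposite
(`amplitude_pow`). The contributions cancel (`separated_of_next`). The flip symmetry, together with
the correct content of `S`, is all that is used of the quantum state. What earlier phases leave in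
the qubits is harmless, because a preparation puts each discarded content into a branch of its own.

Both Subroutines A and C rest on flooding: a path in a graph with `n` vertices has at most `n - 1`
edges (`informed_iff_exists`). For the resources, `sum_phase_le` bounds every additive cost of one
phase, and there are fewer than `n` phases when `n ≥ 2`, none when `n = 1`. -/

namespace QNet

open scoped ComplexConjugate

/-! ## Conservation of the total probability -/

/-- A sum whose terms vanish outside the range of the injection `e`. -/
theorem sum_kernel_eq {B α : Type*} [Fintype B] [DecidableEq B] [Fintype α] [DecidableEq α]
    (e : α → B) (he : Function.Injective e) (f : B → ℂ) (h : ∀ x, f x ≠ 0 → x ∈ Set.range e) :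
    ∑ x, f x = ∑ a, f (e a) :=
  (Fintype.sum_of_injective e he _ _ (fun x hx => by by_contra h0; exact hx (h x h0))
    fun _ => rfl).symm

theorem unitary_column {ι : Type*} [Fintype ι] [DecidableEq ι] (U : Matrix.unitaryGroup ι ℂ)
    (a b : ι) :
    ∑ i, conj ((U : Matrix ι ι ℂ) i a) * (U : Matrix ι ι ℂ) i b = if a = b then 1 else 0 := by
  have := congrFun (congrFun (Matrix.mem_unitaryGroup_iff'.1 U.2) a) b
  simpa [Matrix.mul_apply, Matrix.star_apply, Matrix.one_apply] using this

section Local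

variable {A C Q : Type} [DecidableEq A] [DecidableEq C] [DecidableEq Q] [Fintype Q]

/-- A family of operators whose outcomes exhaust all possibilities. -/
def Complete {ι B : Type*} [Fintype ι] [Fintype B] [DecidableEq B] (K : ι → Matrix B B ℂ) : Prop :=
  ∀ y y', ∑ o, ∑ x, conj (K o x y) * K o x y' = if y = y' then 1 else 0

theorem complete_of_zero {B : Type*} [Fintype B] [DecidableEq B] {K : Fin 2 → Matrix B B ℂ}
    (h1 : K 1 = 0) (h0 : ∀ y y', ∑ x, conj (K 0 x y) * K 0 x y' = if y = y' then 1 else 0) :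
    Complete K := by
  intro y y'
  simp [Fin.sum_univ_two, h1, h0]

theorem complete_one {B : Type*} [Fintype B] [DecidableEq B] :
    Complete fun o : Fin 2 => if o = 0 then (1 : Matrix B B ℂ) else 0 := by
  apply complete_of_zero
  · simp
  · intro y y'
    simp [Matrix.one_apply, apply_ite conj, Finset.sum_ite_eq, eq_comm]

/-- The column of `y` is supported on the two states that agree with `y` away from `q`. Columns of
states that differ elsewhere have disjoint supports; otherwise the sum is an inner product of two
columns of `U`. -/
theorem complete_gate1 (U : Matrix.unitaryGroup (Fin 2) ℂ) (q : Q) (y y' : Q → Fin 2) :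
    ∑ x : Q → Fin 2,
      conj (if ∀ p, p ≠ q → x p = y p then (U : Matrix (Fin 2) (Fin 2) ℂ) (x q) (y q) else 0) *
        (if ∀ p, p ≠ q → x p = y' p then (U : Matrix (Fin 2) (Fin 2) ℂ) (x q) (y' q) else 0) =
      if y = y' then 1 else 0 := by
  rw [sum_kernel_eq (fun a => Function.update y q a) (Function.update_injective y q)]
  · by_cases h : ∀ p, p ≠ q → y p = y' p
    · have e : ∀ a, ∀ p, p ≠ q → Function.update y q a p = y p := fun a p hp => by simp [hp]
      have e' : ∀ a, ∀ p, p ≠ q → Function.update y q a p = y' p := fun a p hp => by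
        rw [e a p hp, h p hp]
      simp only [if_pos (e _), if_pos (e' _), Function.update_self, unitary_column]
      refine if_congr ⟨fun hq => ?_, fun hq => by rw [hq]⟩ rfl rfl
      funext p
      by_cases hp : p = q
      · rw [hp, hq]
      · exact h p hp
    · rw [if_neg (fun hy => h fun p _ => by rw [hy])]
      refine Finset.sum_eq_zero fun a _ => ?_
      rw [if_neg (c := ∀ p, p ≠ q → Function.update y q a p = y' p), mul_zero]
      intro h'
      exact h fun p hp => by rw [← h' p hp]; simp [hp]
  · intro x hx
    have hx' : ∀ p, p ≠ q → x p = y p := by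
      by_contra hc
      rw [if_neg hc] at hx
      simp at hx
    refine ⟨x q, ?_⟩
    funext p
    by_cases hp : p = q
    · subst hp; simp
    · simp [hp, hx' p hp]

theorem complete_gate2 (U : Matrix.unitaryGroup (Fin 4) ℂ) (q r : Q) (hqr : q ≠ r)
    (y y' : Q → Fin 2) :
    ∑ x : Q → Fin 2,
      conj (if ∀ p, p ≠ q → p ≠ r → x p = y p then
          (U : Matrix (Fin 4) (Fin 4) ℂ)
            (finProdFinEquiv (x q, x r)) (finProdFinEquiv (y q, y r)) else 0) *
        (if ∀ p, p ≠ q → p ≠ r → x p = y' p then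
          (U : Matrix (Fin 4) (Fin 4) ℂ)
            (finProdFinEquiv (x q, x r)) (finProdFinEquiv (y' q, y' r)) else 0) =
      if y = y' then 1 else 0 := by
  let e : Fin 2 × Fin 2 → Q → Fin 2 := fun a => Function.update (Function.update y q a.1) r a.2
  have eq : ∀ a, e a q = a.1 := fun a => by simp [e, hqr]
  have er : ∀ a, e a r = a.2 := fun a => by simp [e]
  have ep : ∀ a, ∀ p, p ≠ q → p ≠ r → e a p = y p := fun a p hq hr => by simp [e, hq, hr]
  rw [sum_kernel_eq e (fun a b hab => Prod.ext (by rw [← eq, hab, eq]) (by rw [← er, hab, er]))]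
  · by_cases h : ∀ p, p ≠ q → p ≠ r → y p = y' p
    · have ep' : ∀ a, ∀ p, p ≠ q → p ≠ r → e a p = y' p := fun a p hp hr => by
        rw [ep a p hp hr, h p hp hr]
      simp only [if_pos (ep _), if_pos (ep' _), eq, er]
      have := unitary_column U (finProdFinEquiv (y q, y r)) (finProdFinEquiv (y' q, y' r))
      rw [← (finProdFinEquiv (m := 2) (n := 2)).sum_comp] at this
      refine this.trans (if_congr ⟨fun hq => ?_, fun hq => by rw [hq]⟩ rfl rfl)
      have hq := Prod.ext_iff.1 (finProdFinEquiv.injective hq)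
      funext p
      by_cases hp : p = q
      · rw [hp]; exact hq.1
      by_cases hr : p = r
      · rw [hr]; exact hq.2
      exact h p hp hr
    · rw [if_neg (fun hy => h fun p _ _ => by rw [hy])]
      refine Finset.sum_eq_zero fun a _ => ?_
      rw [if_neg (c := ∀ p, p ≠ q → p ≠ r → e a p = y' p), mul_zero]
      intro h'
      exact h fun p hp hr => by rw [← h' p hp hr, ep a p hp hr]
  · intro x hx
    have hx' : ∀ p, p ≠ q → p ≠ r → x p = y p := by
      by_contra hc
      rw [if_neg hc] at hx
      simp at hx
    refine ⟨(x q, x r), ?_⟩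
    funext p
    by_cases hp : p = q
    · subst hp; simp [eq]
    by_cases hr : p = r
    · subst hr; simp [er]
    rw [ep _ p hp hr, hx' p hp hr]

theorem complete_graph {B : Type*} [Fintype B] [DecidableEq B] (g : B → B)
    (hg : Function.Injective g) (y y' : B) :
    ∑ x, conj (if x = g y then (1 : ℂ) else 0) * (if x = g y' then 1 else 0) =
      if y = y' then 1 else 0 := by
  simp only [apply_ite conj, map_one, map_zero, ite_mul, one_mul, zero_mul, Finset.sum_ite_eq',
    Finset.mem_univ, if_true, hg.eq_iff]

/-- Covers `prepare`, which is not injective on basis states. Taking the discarded content as the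
outcome `l` restores injectivity of `g` on each fibre, and this suffices because different outcomes
are never multiplied together. -/
theorem complete_labelled_graph {B : Type*} [Fintype B] [DecidableEq B] (l : B → Fin 2)
    (g : B → B) (hg : ∀ y y', l y = l y' → g y = g y' → y = y') :
    Complete fun o : Fin 2 => (Matrix.of fun x y => if l y = o ∧ x = g y then 1 else 0) := by
  intro y y'
  simp only [Matrix.of_apply]
  have : ∀ o, ∑ x, conj (if l y = o ∧ x = g y then (1 : ℂ) else 0) *
      (if l y' = o ∧ x = g y' then 1 else 0) =
      if l y = o then (if y = y' then 1 else 0) else 0 := by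
    intro o
    by_cases h : l y = o
    · rw [if_pos h]
      simp only [h, true_and, apply_ite conj, map_one, map_zero, ite_mul, one_mul, zero_mul,
        Finset.sum_ite_eq', Finset.mem_univ, if_true]
      exact if_congr ⟨fun ⟨h1, h2⟩ => hg _ _ (h.trans h1.symm) h2,
        fun hy => ⟨hy ▸ h, by rw [hy]⟩⟩ rfl rfl
    · simp [h]
  simp only [this, Finset.sum_ite_eq, Finset.mem_univ, if_true]

omit [Fintype Q] in
theorem toggle_injective {f : Fin 2 → Fin 2 → Fin 2} {q r t : Q} (hq : q ≠ t) (hr : r ≠ t) :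
    Function.Injective fun y : Q → Fin 2 => Function.update y t (y t + f (y q) (y r)) := by
  intro y y' h
  have e : ∀ p, p ≠ t → y p = y' p := fun p hp => by
    have := congrFun h p
    simpa only [Function.update_of_ne hp] using this
  have et := congrFun h t
  simp only [Function.update_self, e q hq, e r hr] at et
  funext p
  by_cases hp : p = t
  · rw [hp]; exact add_right_cancel et
  · exact e p hp

theorem Instr.complete_act (a : Instr A C Q) (m : C → A) :
    Complete fun o => (a.act o m).2 := by
  induction a with
  | assign x f y z => exact complete_one
  | gate1 U q =>
    apply complete_of_zero
    · simp [Instr.act]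
    · exact complete_gate1 U q
  | gate2 U q r h =>
    apply complete_of_zero
    · simp [Instr.act]
    · exact complete_gate2 U q r h
  | toggle f q r t hq hr =>
    apply complete_of_zero
    · simp [Instr.act]
    · simp only [Instr.act, if_true, Matrix.of_apply]
      have := complete_graph (fun y : Q → Fin 2 => Function.update y t (y t + f (y q) (y r)))
        (toggle_injective hq hr)
      exact this
  | prepare q =>
    simp only [Instr.act]
    refine complete_labelled_graph (fun y : Q → Fin 2 => y q) (fun y => Function.update y q 0) ?_
    intro y y' h1 h2
    funext p
    by_cases hp : p = q
    · rw [hp]; exact h1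
    · have := congrFun h2 p
      simpa only [Function.update_of_ne hp] using this
  | measure q x g =>
    simp only [Instr.act]
    exact complete_labelled_graph (fun y : Q → Fin 2 => y q) id fun y y' _ h => h
  | guard x a body ih =>
    by_cases h : m x = a
    · simpa [Instr.act, h] using ih
    · simpa [Instr.act, h] using complete_one

theorem sum_conj_mul_mul {ι B : Type*} [Fintype ι] [Fintype B] (K : ι → Matrix B B ℂ)
    (φ ψ : B → ℂ) :
    ∑ o, ∑ x, conj (∑ y, K o x y * φ y) * (∑ y, K o x y * ψ y) =
      ∑ y, ∑ y', conj (φ y) * ψ y' * ∑ o, ∑ x, conj (K o x y) * K o x y' := by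
  simp only [map_sum, Finset.sum_mul_sum, map_mul]
  simp only [Finset.mul_sum]
  have h : ∀ o, (∑ x, ∑ y, ∑ y', conj (K o x y) * conj (φ y) * (K o x y' * ψ y')) =
      ∑ y, ∑ y', ∑ x, conj (φ y) * ψ y' * (conj (K o x y) * K o x y') := fun o => by
    rw [Finset.sum_comm]
    refine Finset.sum_congr rfl fun y _ => ?_
    rw [Finset.sum_comm]
    refine Finset.sum_congr rfl fun y' _ => Finset.sum_congr rfl fun x _ => by ring
  simp only [h]
  rw [Finset.sum_comm]
  refine Finset.sum_congr rfl fun y _ => ?_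
  rw [Finset.sum_comm]

/-- The polarized form is needed because `Instr.complete_run` applies it to two columns of an
operator; `φ = ψ` gives conservation of the norm. -/
theorem Complete.sum_conj_mul {ι B : Type*} [Fintype ι] [Fintype B] [DecidableEq B]
    {K : ι → Matrix B B ℂ} (h : Complete K) (φ ψ : B → ℂ) :
    ∑ o, ∑ x, conj (∑ y, K o x y * φ y) * (∑ y, K o x y * ψ y) = ∑ y, conj (φ y) * ψ y := by
  rw [sum_conj_mul_mul]
  have e : ∀ y y', ∑ o, ∑ x, conj (K o x y) * K o x y' = if y = y' then 1 else 0 := h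
  simp [e]

/-- The later operators may depend on the memory left by the first outcome. For each fixed first
outcome the sum over the later outcomes preserves inner products, so only the completeness of the
first instruction remains. -/
theorem Instr.complete_run (L : List (Instr A C Q)) (m : C → A) :
    Complete fun o => (Instr.run L o m).2 := by
  induction L generalizing m with
  | nil =>
    intro y y'
    simp [Instr.run, Matrix.one_apply, apply_ite conj, Finset.sum_ite_eq, eq_comm]
  | cons a L ih =>
    intro y y'
    have e := (Fin.consEquiv fun _ : Fin (L.length + 1) => Fin 2).sum_comp
      fun o => ∑ x, conj ((Instr.run (a :: L) o m).2 x y) * (Instr.run (a :: L) o m).2 x y'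
    refine e.symm.trans ?_
    rw [Fintype.sum_prod_type, ← a.complete_act m y y']
    refine Finset.sum_congr rfl fun o _ => ?_
    rw [← (ih (a.act o m).1).sum_conj_mul]
    simp [Instr.run, Fin.consEquiv, Matrix.mul_apply]

end Local

/-! ### Joint evolution of all parties -/

section Global

variable {V : Type*} [Fintype V] [DecidableEq V]

/-- The sums over families of outcomes and over joint basis states factor into one completeness
relation per party. -/
theorem Complete.pi {ι B : V → Type*} [∀ v, Fintype (ι v)] [∀ v, Fintype (B v)]
    [∀ v, DecidableEq (B v)] {K : (v : V) → ι v → Matrix (B v) (B v) ℂ}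
    (h : ∀ v, Complete (K v)) :
    Complete fun (o : (v : V) → ι v) =>
      (Matrix.of fun x y => ∏ v, K v (o v) (x v) (y v) : Matrix ((v : V) → B v) _ ℂ) := by
  intro y y'
  simp only [Matrix.of_apply, map_prod, ← Finset.prod_mul_distrib]
  have e : ∀ o : (v : V) → ι v,
      ∑ x : (v : V) → B v, ∏ v, (conj (K v (o v) (x v) (y v)) * K v (o v) (x v) (y' v)) =
      ∏ v, ∑ x, conj (K v (o v) x (y v)) * K v (o v) x (y' v) := fun o => by
    rw [Fintype.prod_sum]
  simp only [e]
  rw [← Fintype.prod_sum fun v (o : ι v) => ∑ x, conj (K v o x (y v)) * K v o x (y' v)]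
  have hv : ∀ v, ∑ o, ∑ x, conj (K v o x (y v)) * K v o x (y' v) =
    if y v = y' v then 1 else 0 := fun v => h v _ _
  simp only [hv, Finset.prod_ite_zero, Finset.prod_const_one, Finset.mem_univ, true_imp_iff,
    funext_iff]

variable {G : SimpleGraph V} [DecidableRel G.Adj]
  {A : Type} {CL : ℕ → Type} {CP : Type} {QL : ℕ → Type} {QP : Type}
  [DecidableEq A] [∀ d, DecidableEq (CL d)] [DecidableEq CP]
  [∀ d, DecidableEq (QL d)] [DecidableEq QP] [∀ d, Fintype (QL d)] [Fintype QP]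

/-- The probability of a branch. -/
noncomputable def Config.weight (c : Config G A CL CP QL QP) : ℝ := ∑ x, ‖c.amp x‖ ^ 2

omit [DecidableEq V] in
theorem PortNumbering.far_far (σ : PortNumbering G) (v : V) (i : Fin (G.degree v)) :
    σ.far (σ.far v i).1 (σ.far v i).2 = ⟨v, i⟩ := by
  have h : (σ (σ.far v i).1).symm (σ.far v i).2 = ⟨v, G.adj_symm ((σ v).symm i).2⟩ := by
    change (σ _).symm (σ _ _) = _
    exact Equiv.symm_apply_apply _ _
  -- The port number has a type that depends on the party; generalizing to any neighbour `w` allows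
  -- substitution in the dependent pair.
  have e : ∀ w : G.neighborSet (σ.far v i).1, w = ⟨v, G.adj_symm ((σ v).symm i).2⟩ →
      (⟨w.1, σ w.1 ⟨(σ.far v i).1, G.adj_symm w.2⟩⟩ : (u : V) × Fin (G.degree u)) = ⟨v, i⟩ := by
    rintro w rfl
    simp [PortNumbering.far]
  exact e _ h

omit [DecidableEq V] in
theorem PortNumbering.swap_swap {α : Type} {L : ℕ → Type} {P : Type} [DecidableEq P]
    (σ : PortNumbering G) (S : Finset P) (x : (v : V) → Reg L P (G.degree v) → α) :
    σ.swap S (σ.swap S x) = x := by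
  funext v r
  rcases r with l | ⟨i, p⟩
  · rfl
  · by_cases h : p ∈ S
    · have e : ∀ w : (u : V) × Fin (G.degree u), w = ⟨v, i⟩ →
        x w.1 (.inr (w.2, p)) = x v (.inr (i, p)) := by rintro w rfl; rfl
      simp only [PortNumbering.swap, h, if_true]
      exact e _ (σ.far_far v i)
    · simp [PortNumbering.swap, h]

/-- An exchange permutes the basis states, and a local computation is a complete family of product
operators. -/
theorem Step.sum_weight_next (σ : PortNumbering G) (c : Config G A CL CP QL QP)
    (s : Step A CL CP QL QP) : ((s.next σ c).map Config.weight).sum = c.weight := by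
  have conv : ∀ z : ℂ, ((‖z‖ ^ 2 : ℝ) : ℂ) = conj z * z := fun z => by
    rw [Complex.conj_mul']; push_cast; rfl
  cases s with
  | exchange S T =>
    simp only [Step.next, Multiset.map_singleton, Multiset.sum_singleton, Config.weight]
    exact Equiv.sum_comp (⟨σ.swap S, σ.swap S, σ.swap_swap S, σ.swap_swap S⟩ :
      Equiv.Perm ((v : V) → Reg QL QP (G.degree v) → Fin 2)) fun x => ‖c.amp x‖ ^ 2
  | compute prog =>
    have h := (Complete.pi fun v =>
      Instr.complete_run (prog (G.degree v)) (c.mem v)).sum_conj_mul c.amp c.amp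
    simp only [Step.next, Multiset.map_map, Config.weight, Function.comp_def]
    apply Complex.ofReal_injective
    change ((∑ o : (v : V) → Fin (prog (G.degree v)).length → Fin 2, _ : ℝ) : ℂ) = _
    push_cast
    simp only [← Complex.ofReal_pow, conv]
    exact h

theorem Program.sum_weight_branches (σ : PortNumbering G) (P : Program A CL CP QL QP)
    (c : Config G A CL CP QL QP) :
    ((Program.branches σ P c).map Config.weight).sum = c.weight := by
  induction P generalizing c with
  | nil => simp [Program.branches]
  | cons s P ih =>
    rw [Program.branches, Multiset.map_bind, Multiset.sum_bind]
    simp only [ih]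
    exact s.sum_weight_next σ c

/-- If every branch of nonzero weight ends well, then the program succeeds with certainty. -/
theorem Program.prob_eq_weight (σ : PortNumbering G) (P : Program A CL CP QL QP)
    (c : Config G A CL CP QL QP) (event : ((v : V) → Reg CL CP (G.degree v) → A) → Prop)
    (h : ∀ c' ∈ Program.branches σ P c, c'.amp ≠ 0 → event c'.mem) :
    P.prob σ c event = c.weight := by
  rw [← P.sum_weight_branches σ c, Program.prob]
  congr 1
  refine Multiset.map_congr rfl fun c' hc' => ?_
  split_ifs with he
  · rfl
  · have h0 : c'.amp = 0 := by
      by_contra hne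
      exact he (h c' hc' hne)
    simp [Config.weight, h0]

end Global

end QNet

namespace QNet

/-! ## Reasoning about the branches of an execution -/

section Local

variable {A C Q : Type} [DecidableEq A] [DecidableEq C] [DecidableEq Q] [Fintype Q]

/-- `r` is a possible result of running `L` with the classical memory `m`. -/
def Instr.Outcome (L : List (Instr A C Q)) (m : C → A)
    (r : (C → A) × Matrix (Q → Fin 2) (Q → Fin 2) ℂ) : Prop :=
  ∃ o, Instr.run L o m = r

theorem Instr.outcome_nil {m : C → A} {r} :
    Instr.Outcome ([] : List (Instr A C Q)) m r ↔ r = (m, 1) :=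
  ⟨fun ⟨_, h⟩ => h.symm, fun h => ⟨Fin.elim0, h.symm⟩⟩

theorem Instr.outcome_cons {a : Instr A C Q} {L : List (Instr A C Q)} {m : C → A} {r} :
    Instr.Outcome (a :: L) m r ↔
      ∃ o r', Instr.Outcome L (a.act o m).1 r' ∧ r = (r'.1, r'.2 * (a.act o m).2) := by
  constructor
  · rintro ⟨o, rfl⟩
    exact ⟨_, _, ⟨_, rfl⟩, rfl⟩
  · rintro ⟨o, r', ⟨o', rfl⟩, rfl⟩
    exact ⟨Fin.cons (α := fun _ : Fin (L.length + 1) => Fin 2) o o', by simp [Instr.run]⟩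

theorem Instr.outcome_append {L L' : List (Instr A C Q)} {m : C → A} {r} :
    Instr.Outcome (L ++ L') m r ↔
      ∃ r₁ r₂, Instr.Outcome L m r₁ ∧ Instr.Outcome L' r₁.1 r₂ ∧ r = (r₂.1, r₂.2 * r₁.2) := by
  induction L generalizing m r with
  | nil =>
    constructor
    · intro h
      exact ⟨(m, 1), r, Instr.outcome_nil.2 rfl, h, by simp⟩
    · rintro ⟨r₁, r₂, h₁, h₂, rfl⟩
      obtain rfl := Instr.outcome_nil.1 h₁
      simpa using h₂
  | cons a L ih =>
    rw [List.cons_append, Instr.outcome_cons]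
    constructor
    · rintro ⟨o, r', h, rfl⟩
      obtain ⟨r₁, r₂, h₁, h₂, rfl⟩ := ih.1 h
      exact ⟨_, r₂, Instr.outcome_cons.2 ⟨o, r₁, h₁, rfl⟩, h₂, by simp [Matrix.mul_assoc]⟩
    · rintro ⟨r₁, r₂, h₁, h₂, rfl⟩
      obtain ⟨o, r', h, rfl⟩ := Instr.outcome_cons.1 h₁
      exact ⟨o, _, ih.2 ⟨r', r₂, h, h₂, rfl⟩, by simp [Matrix.mul_assoc]⟩

end Local

variable {V : Type*} [Fintype V] [DecidableEq V] {G : SimpleGraph V} [DecidableRel G.Adj]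
  {A : Type} {CL : ℕ → Type} {CP : Type} {QL : ℕ → Type} {QP : Type}
  [DecidableEq A] [∀ d, DecidableEq (CL d)] [DecidableEq CP]
  [∀ d, DecidableEq (QL d)] [DecidableEq QP] [∀ d, Fintype (QL d)] [Fintype QP]

theorem Step.mem_next_compute {σ : PortNumbering G} {c c' : Config G A CL CP QL QP}
    {prog : (d : ℕ) → List (Instr A (Reg CL CP d) (Reg QL QP d))}
    (h : c' ∈ (Step.compute prog).next σ c) :
    ∃ r : (v : V) → (Reg CL CP (G.degree v) → A) ×
        Matrix (Reg QL QP (G.degree v) → Fin 2) (Reg QL QP (G.degree v) → Fin 2) ℂ,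
      (∀ v, Instr.Outcome (prog (G.degree v)) (c.mem v) (r v)) ∧
      (∀ v, c'.mem v = (r v).1) ∧
      ∀ x, c'.amp x = ∑ y, (∏ v, (r v).2 (x v) (y v)) * c.amp y := by
  simp only [Step.next, Multiset.mem_map] at h
  obtain ⟨o, _, rfl⟩ := h
  exact ⟨fun v => Instr.run (prog (G.degree v)) (o v) (c.mem v), fun v => ⟨o v, rfl⟩,
    fun _ => rfl, fun _ => rfl⟩

theorem Step.amp_eq_zero {σ : PortNumbering G} {c c' : Config G A CL CP QL QP}
    {s : Step A CL CP QL QP} (h : c' ∈ s.next σ c) (h0 : c.amp = 0) : c'.amp = 0 := by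
  cases s with
  | compute prog =>
    obtain ⟨r, -, -, h⟩ := Step.mem_next_compute h
    funext x
    simp [h, h0]
  | exchange S T =>
    obtain rfl := Multiset.mem_singleton.1 h
    funext x
    simp [h0]

/-- A branch that has vanished never recovers. Hence a nonzero final amplitude lets every
intermediate configuration be assumed nonzero. -/
theorem Program.amp_eq_zero {σ : PortNumbering G} {c c' : Config G A CL CP QL QP}
    {P : Program A CL CP QL QP} (h : c' ∈ Program.branches σ P c) (h0 : c.amp = 0) :
    c'.amp = 0 := by
  induction P generalizing c with
  | nil =>
    obtain rfl := Multiset.mem_singleton.1 h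
    exact h0
  | cons s P ih =>
    obtain ⟨c₁, h₁, h₂⟩ := Multiset.mem_bind.1 h
    exact ih h₂ (Step.amp_eq_zero h₁ h0)

/-- Started in a configuration that satisfies `pre`, the program leads with certainty to
configurations that satisfy `post`. -/
def Triple (σ : PortNumbering G) (pre : Config G A CL CP QL QP → Prop)
    (P : Program A CL CP QL QP) (post : Config G A CL CP QL QP → Prop) : Prop :=
  ∀ c, pre c → ∀ c' ∈ Program.branches σ P c, c'.amp ≠ 0 → post c'

theorem Triple.nil {σ : PortNumbering G} {p : Config G A CL CP QL QP → Prop} :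
    Triple σ p [] p := fun c hc c' h _ => by
  obtain rfl := Multiset.mem_singleton.1 h
  exact hc

theorem Triple.cons {σ : PortNumbering G} {p q r : Config G A CL CP QL QP → Prop}
    {s : Step A CL CP QL QP} {P : Program A CL CP QL QP}
    (h₁ : ∀ c, p c → ∀ c' ∈ s.next σ c, c'.amp ≠ 0 → q c') (h₂ : Triple σ q P r) :
    Triple σ p (s :: P) r := fun c hc c' h h0 => by
  obtain ⟨c₁, hc₁, hc'⟩ := Multiset.mem_bind.1 h
  exact h₂ c₁ (h₁ c hc c₁ hc₁ fun h => h0 (Program.amp_eq_zero hc' h)) c' hc' h0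

theorem Program.branches_append (σ : PortNumbering G) (P P' : Program A CL CP QL QP)
    (c : Config G A CL CP QL QP) :
    Program.branches σ (P ++ P') c =
      (Program.branches σ P c).bind (Program.branches σ P') := by
  induction P generalizing c with
  | nil => simp [Program.branches]
  | cons s P ih =>
    simp only [List.cons_append, Program.branches, Multiset.bind_assoc, ih]

theorem Triple.append {σ : PortNumbering G} {p q r : Config G A CL CP QL QP → Prop}
    {P P' : Program A CL CP QL QP} (h₁ : Triple σ p P q) (h₂ : Triple σ q P' r) :
    Triple σ p (P ++ P') r := fun c hc c' h h0 => by
  rw [Program.branches_append] at h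
  obtain ⟨c₁, hc₁, hc'⟩ := Multiset.mem_bind.1 h
  exact h₂ c₁ (h₁ c hc c₁ hc₁ fun h => h0 (Program.amp_eq_zero hc' h)) c' hc' h0

theorem Triple.single {σ : PortNumbering G} {p q : Config G A CL CP QL QP → Prop}
    {s : Step A CL CP QL QP} (h : ∀ c, p c → ∀ c' ∈ s.next σ c, c'.amp ≠ 0 → q c') :
    Triple σ p [s] q := Triple.cons h Triple.nil

/-- Invariants of a loop. -/
theorem Triple.loop {σ : PortNumbering G} {n : ℕ} {f : Fin n → Program A CL CP QL QP}
    (p : ℕ → Config G A CL CP QL QP → Prop)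
    (h : ∀ t : Fin n, Triple σ (p t) (f t) (p (t + 1))) :
    Triple σ (p 0) ((List.finRange n).flatMap f) (p n) := by
  induction n with
  | zero => exact Triple.nil
  | succ n ih =>
    -- Splitting off the last iteration, rather than the first, keeps the numbers `t` of the others
    -- unchanged.
    rw [List.finRange_succ_last, List.flatMap_append, List.flatMap_map]
    refine Triple.append (ih fun t => h t.castSucc) ?_
    simpa using h (Fin.last n)

end QNet

namespace QNet

/-! ## Reversible classical computation -/

theorem two_add_self (a b : Fin 2) : a + b + b = a := by
  revert a b; decide

section Local

variable {A C Q : Type} [DecidableEq A] [DecidableEq Q]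

/-- The permutation of the basis states that a reversible classical instruction carries out. -/
def Instr.perm (m : C → A) : Instr A C Q → (Q → Fin 2) → Q → Fin 2
  | .toggle f q r t _ _, y => Function.update y t (y t + f (y q) (y r))
  | .guard x a body, y => if m x = a then body.perm m y else y
  | _, y => y

/-- Instructions composed of toggle gates and tests. -/
def Instr.Reversible : Instr A C Q → Prop
  | .toggle _ _ _ _ _ _ => True
  | .guard _ _ body => body.Reversible
  | _ => False

/-- The qubits that a reversible instruction may change. -/
def Instr.writes : Instr A C Q → Set Q
  | .toggle _ _ _ t _ _ => {t}
  | .guard _ _ body => body.writes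
  | _ => ∅

/-- The control qubits of a reversible instruction. -/
def Instr.reads : Instr A C Q → Set Q
  | .toggle _ q r _ _ _ => {q, r}
  | .guard _ _ body => body.reads
  | _ => ∅

/-- The target differs from the controls, so the same bit is added twice. -/
theorem Instr.perm_perm (m : C → A) (a : Instr A C Q) (y : Q → Fin 2) :
    a.perm m (a.perm m y) = y := by
  induction a with
  | toggle f q r t hq hr =>
    simp only [Instr.perm]
    funext p
    by_cases hp : p = t
    · subst hp
      simp [Function.update_of_ne hq, Function.update_of_ne hr, two_add_self]
    · simp [hp]
  | guard x a body ih =>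
    by_cases h : m x = a
    · simpa [Instr.perm, h] using ih
    · simp [Instr.perm, h]
  | _ => rfl

theorem Instr.perm_of_notMem (m : C → A) (a : Instr A C Q) (y : Q → Fin 2) {p : Q}
    (hp : p ∉ a.writes) : a.perm m y p = y p := by
  induction a with
  | toggle f q r t hq hr => exact Function.update_of_ne hp _ _
  | guard x a body ih =>
    by_cases h : m x = a
    · simpa [Instr.perm, h] using ih hp
    · simp [Instr.perm, h]
  | _ => rfl

theorem Instr.perm_update (m : C → A) (a : Instr A C Q) (y : Q → Fin 2) {p : Q} (b : Fin 2)
    (hp : p ∉ a.writes) (hp' : p ∉ a.reads) :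
    a.perm m (Function.update y p b) = Function.update (a.perm m y) p b := by
  induction a with
  | toggle f q r t hq hr =>
    have h1 : t ≠ p := fun h => hp (by simp [Instr.writes, h])
    have h2 : q ≠ p := fun h => hp' (by simp [Instr.reads, h])
    have h3 : r ≠ p := fun h => hp' (by simp [Instr.reads, h])
    simp only [Instr.perm, Function.update_of_ne h1, Function.update_of_ne h2,
      Function.update_of_ne h3]
    exact Function.update_comm h1.symm _ _ _
  | guard x a body ih =>
    by_cases h : m x = a
    · simpa [Instr.perm, h] using ih hp hp'
    · simp [Instr.perm, h]
  | _ => rfl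

def Instr.permList (m : C → A) (L : List (Instr A C Q)) (y : Q → Fin 2) : Q → Fin 2 :=
  L.foldl (fun y a => a.perm m y) y

theorem Instr.permList_reverse (m : C → A) (L : List (Instr A C Q)) (y : Q → Fin 2) :
    Instr.permList m L.reverse (Instr.permList m L y) = y := by
  induction L generalizing y with
  | nil => rfl
  | cons a L ih =>
    have := ih (a.perm m y)
    simp only [Instr.permList] at this
    simp [Instr.permList, this, Instr.perm_perm]

theorem Instr.permList_of_notMem (m : C → A) (L : List (Instr A C Q)) (y : Q → Fin 2) {p : Q}
    (hp : ∀ a ∈ L, p ∉ a.writes) : Instr.permList m L y p = y p := by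
  induction L generalizing y with
  | nil => rfl
  | cons a L ih =>
    refine (ih (a.perm m y) fun b hb => hp b (List.mem_cons_of_mem _ hb)).trans ?_
    exact a.perm_of_notMem m y (hp a List.mem_cons_self)

theorem Instr.permList_update (m : C → A) (L : List (Instr A C Q)) (y : Q → Fin 2) {p : Q}
    (b : Fin 2) (hp : ∀ a ∈ L, p ∉ a.writes ∧ p ∉ a.reads) :
    Instr.permList m L (Function.update y p b) = Function.update (Instr.permList m L y) p b := by
  induction L generalizing y with
  | nil => rfl
  | cons a L ih =>
    refine Eq.trans ?_ (ih (a.perm m y) fun b hb => hp b (List.mem_cons_of_mem _ hb))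
    have := hp a List.mem_cons_self
    rw [← a.perm_update m y b this.1 this.2]
    rfl

/-- Evaluation of a straight-line program, in which no qubit is changed after it has been used. -/
theorem Instr.permList_straightLine (m : C → A) (L : List (Instr A C Q)) (y : Q → Fin 2)
    (hL : L.Pairwise fun a b => ∀ p ∈ b.writes, p ∉ a.writes ∧ p ∉ a.reads)
    {f : Fin 2 → Fin 2 → Fin 2} {q r t : Q} {hq : q ≠ t} {hr : r ≠ t}
    (h : Instr.toggle f q r t hq hr ∈ L) :
    Instr.permList m L y t = y t + f (Instr.permList m L y q) (Instr.permList m L y r) := by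
  induction L generalizing y with
  | nil => simp at h
  | cons a L ih =>
    obtain ⟨h₁, h₂⟩ := List.pairwise_cons.1 hL
    rcases List.mem_cons.1 h with rfl | h'
    -- Nothing writes `q`, `r` or `t` after this gate, so their final values are those directly
    -- after it.
    · have e : ∀ p, p = q ∨ p = r ∨ p = t → Instr.permList m L
          ((Instr.toggle f q r t hq hr).perm m y) p = (Instr.toggle f q r t hq hr).perm m y p := by
        intro p hp
        refine Instr.permList_of_notMem m L _ fun b hb hpb => ?_
        have := h₁ b hb p hpb
        simp only [Instr.writes, Instr.reads, Set.mem_singleton_iff, Set.mem_insert_iff,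
          not_or] at this
        tauto
      change Instr.permList m L ((Instr.toggle f q r t hq hr).perm m y) t = _ + f
        (Instr.permList m L ((Instr.toggle f q r t hq hr).perm m y) q)
        (Instr.permList m L ((Instr.toggle f q r t hq hr).perm m y) r)
      rw [e t (by simp), e q (by simp), e r (by simp)]
      simp [Instr.perm, Function.update_of_ne hq, Function.update_of_ne hr]
    · refine (ih (a.perm m y) h₂ h').trans ?_
      -- No earlier gate has written the target, so its value there is still the initial one.
      rw [a.perm_of_notMem m y (p := t) (h₁ _ h' t (by simp [Instr.writes])).1]
      rfl

variable [DecidableEq C] [Fintype Q]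

theorem Instr.act_of_reversible {a : Instr A C Q} (ha : a.Reversible) (o : Fin 2) (m : C → A) :
    (a.act o m).1 = m ∧
      (a.act o m).2 =
        if o = 0 then Matrix.of fun x y => if x = a.perm m y then 1 else 0 else 0 := by
  induction a with
  | toggle f q r t hq hr => exact ⟨rfl, rfl⟩
  | guard x a body ih =>
    by_cases h : m x = a
    · simpa [Instr.act, Instr.perm, h] using ih ha
    · simp only [Instr.act, h, if_false, Instr.perm, true_and]
      rfl
  | _ => exact ha.elim

/-- The zero operator appears as soon as some instruction is given the formal outcome `1`, which has
probability zero. -/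
theorem Instr.outcome_of_reversible {L : List (Instr A C Q)} (hL : ∀ a ∈ L, a.Reversible)
    {m : C → A} {r} (h : Instr.Outcome L m r) :
    r.1 = m ∧ (r.2 = 0 ∨ ∀ x y, r.2 x y = if x = Instr.permList m L y then 1 else 0) := by
  induction L generalizing r with
  | nil =>
    obtain rfl := Instr.outcome_nil.1 h
    exact ⟨rfl, .inr fun x y => rfl⟩
  | cons a L ih =>
    obtain ⟨o, r', h', rfl⟩ := Instr.outcome_cons.1 h
    obtain ⟨e₁, e₂⟩ := Instr.act_of_reversible (hL a List.mem_cons_self) o m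
    rw [e₁] at h'
    obtain ⟨i₁, i₂⟩ := ih (fun b hb => hL b (List.mem_cons_of_mem _ hb)) h'
    refine ⟨i₁, ?_⟩
    rcases i₂ with i₂ | i₂
    · left; simp [i₂]
    · by_cases ho : o = 0
      · right
        intro x y
        simp only [e₂, if_pos ho, Matrix.mul_apply, i₂, Matrix.of_apply, mul_ite, mul_one,
          mul_zero, Finset.sum_ite_eq', Finset.mem_univ]
        rfl
      · left; simp [e₂, ho]

end Local

variable {V : Type*} [Fintype V] {G : SimpleGraph V} [DecidableRel G.Adj]
  {A : Type} {CL : ℕ → Type} {CP : Type} {QL : ℕ → Type} {QP : Type}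
  [DecidableEq A] [∀ d, DecidableEq (QL d)] [DecidableEq QP]

/-- The permutation of the basis states of the network that a reversible step carries out. -/
def Step.perm (σ : PortNumbering G) (m : (v : V) → Reg CL CP (G.degree v) → A) :
    Step A CL CP QL QP → ((v : V) → Reg QL QP (G.degree v) → Fin 2) →
      (v : V) → Reg QL QP (G.degree v) → Fin 2
  | .compute prog, x => fun v => Instr.permList (m v) (prog (G.degree v)) (x v)
  | .exchange S _, x => σ.swap S x

/-- Steps that consist of reversible instructions and exchanges of qubits. -/
def Step.Reversible : Step A CL CP QL QP → Prop
  | .compute prog => ∀ d, ∀ a ∈ prog d, a.Reversible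
  | .exchange _ T => T = ∅

/-- The inverse of a reversible step. -/
def Step.inv : Step A CL CP QL QP → Step A CL CP QL QP
  | .compute prog => .compute fun d => (prog d).reverse
  | .exchange S T => .exchange S T

def Program.perm (σ : PortNumbering G) (m : (v : V) → Reg CL CP (G.degree v) → A)
    (P : Program A CL CP QL QP) (x : (v : V) → Reg QL QP (G.degree v) → Fin 2) :
    (v : V) → Reg QL QP (G.degree v) → Fin 2 :=
  P.foldl (fun x s => s.perm σ m x) x

theorem Step.perm_inv (σ : PortNumbering G) (m : (v : V) → Reg CL CP (G.degree v) → A)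
    (s : Step A CL CP QL QP) (x : (v : V) → Reg QL QP (G.degree v) → Fin 2) :
    s.inv.perm σ m (s.perm σ m x) = x := by
  cases s with
  | compute prog => funext v; exact Instr.permList_reverse _ _ _
  | exchange S T => exact σ.swap_swap S x

omit [DecidableEq A] [∀ d, DecidableEq (QL d)] [DecidableEq QP] in
theorem Step.inv_inv (s : Step A CL CP QL QP) : s.inv.inv = s := by
  cases s <;> simp [Step.inv]

theorem Step.perm_injective (σ : PortNumbering G) (m : (v : V) → Reg CL CP (G.degree v) → A)
    (s : Step A CL CP QL QP) : Function.Injective (s.perm σ m) :=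
  Function.LeftInverse.injective (s.perm_inv σ m)

theorem Program.perm_append (σ : PortNumbering G) (m : (v : V) → Reg CL CP (G.degree v) → A)
    (P P' : Program A CL CP QL QP) (x : (v : V) → Reg QL QP (G.degree v) → Fin 2) :
    Program.perm σ m (P ++ P') x = Program.perm σ m P' (Program.perm σ m P x) :=
  List.foldl_append

theorem Program.perm_inv (σ : PortNumbering G) (m : (v : V) → Reg CL CP (G.degree v) → A)
    (P : Program A CL CP QL QP) (x : (v : V) → Reg QL QP (G.degree v) → Fin 2) :
    Program.perm σ m (P.reverse.map Step.inv) (Program.perm σ m P x) = x := by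
  induction P generalizing x with
  | nil => rfl
  | cons s P ih =>
    rw [List.reverse_cons, List.map_append, Program.perm_append]
    refine Eq.trans (congrArg _ (ih (s.perm σ m x))) ?_
    exact s.perm_inv σ m x

theorem Program.perm_inv' (σ : PortNumbering G) (m : (v : V) → Reg CL CP (G.degree v) → A)
    (P : Program A CL CP QL QP) (x : (v : V) → Reg QL QP (G.degree v) → Fin 2) :
    Program.perm σ m P (Program.perm σ m (P.reverse.map Step.inv) x) = x := by
  have h := Program.perm_inv σ m (P.reverse.map Step.inv) x
  have e : (P.reverse.map Step.inv).reverse.map Step.inv = P := by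
    simp [List.map_reverse, Function.comp_def, Step.inv_inv]
  rwa [e] at h

/-- A register that no instruction touches may be changed before or after the computation. -/
theorem Program.perm_comm (σ : PortNumbering G) (m : (v : V) → Reg CL CP (G.degree v) → A)
    (P : Program A CL CP QL QP) (x : (v : V) → Reg QL QP (G.degree v) → Fin 2)
    (g : (v : V) → QL (G.degree v)) (b : V → Fin 2)
    (h : ∀ prog, Step.compute prog ∈ P → ∀ v, ∀ a ∈ prog (G.degree v),
      Sum.inl (g v) ∉ a.writes ∧ Sum.inl (g v) ∉ a.reads) :
    Program.perm σ m P (fun v => Function.update (x v) (.inl (g v)) (b v)) =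
      fun v => Function.update (Program.perm σ m P x v) (.inl (g v)) (b v) := by
  induction P generalizing x with
  | nil => rfl
  | cons s P ih =>
    refine Eq.trans ?_ (ih (s.perm σ m x) fun prog hp => h prog (List.mem_cons_of_mem _ hp))
    change Program.perm σ m P (s.perm σ m _) = Program.perm σ m P _
    congr 1
    cases s with
    | compute prog =>
      funext v
      exact Instr.permList_update _ _ _ _ (h prog List.mem_cons_self v)
    | exchange S T =>
      funext v r
      rcases r with l | ⟨i, p⟩
      · by_cases hl : l = g v
        · subst hl; simp [Step.perm, PortNumbering.swap]
        · simp [Step.perm, PortNumbering.swap, hl]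
      · simp [Step.perm, PortNumbering.swap]

theorem PortNumbering.swap_empty {α : Type} {L : ℕ → Type} {P : Type} [DecidableEq P]
    (σ : PortNumbering G) (x : (v : V) → Reg L P (G.degree v) → α) : σ.swap ∅ x = x := by
  funext v r
  rcases r with l | ⟨i, p⟩
  · rfl
  · simp [PortNumbering.swap]

variable [DecidableEq V] [∀ d, DecidableEq (CL d)] [DecidableEq CP] [∀ d, Fintype (QL d)]
  [Fintype QP]

/-- A nonzero branch contains no zero local operator, so the joint kernel is the graph of a
bijection and one term of the sum survives. -/
theorem Step.next_of_reversible {σ : PortNumbering G} {s : Step A CL CP QL QP}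
    (hs : s.Reversible) {c c' : Config G A CL CP QL QP} (h : c' ∈ s.next σ c)
    (h0 : c'.amp ≠ 0) : c'.mem = c.mem ∧ ∀ x, c'.amp (s.perm σ c.mem x) = c.amp x := by
  cases s with
  | exchange S T =>
    obtain rfl := Multiset.mem_singleton.1 h
    obtain rfl : T = ∅ := hs
    exact ⟨σ.swap_empty _, fun x => by simp [Step.perm, σ.swap_swap]⟩
  | compute prog =>
    obtain ⟨r, hr, hm, ha⟩ := Step.mem_next_compute h
    have hr' := fun v => Instr.outcome_of_reversible (hs (G.degree v)) (hr v)
    refine ⟨funext fun v => (hm v).trans (hr' v).1, ?_⟩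
    by_cases hz : ∃ v, (r v).2 = 0
    · obtain ⟨v, hv⟩ := hz
      refine absurd (funext fun x => ?_) h0
      rw [ha]
      refine Finset.sum_eq_zero fun y _ => ?_
      rw [Finset.prod_eq_zero (Finset.mem_univ v) (by simp [hv]), zero_mul]
    · have hk : ∀ v x y, (r v).2 x y =
          if x = Instr.permList (c.mem v) (prog (G.degree v)) y then 1 else 0 := fun v =>
        (hr' v).2.resolve_left fun h => hz ⟨v, h⟩
      intro x
      rw [ha]
      simp only [hk, Finset.prod_ite_zero, Finset.prod_const_one, Finset.mem_univ, true_imp_iff]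
      rw [Finset.sum_eq_single x]
      · simp [Step.perm]
      · intro y _ hy
        rw [if_neg, zero_mul]
        intro hv
        exact hy (Step.perm_injective σ c.mem (.compute prog) (funext hv)).symm
      · simp

theorem Program.branches_of_reversible {σ : PortNumbering G} {P : Program A CL CP QL QP}
    (hP : ∀ s ∈ P, s.Reversible) {c c' : Config G A CL CP QL QP}
    (h : c' ∈ Program.branches σ P c) (h0 : c'.amp ≠ 0) :
    c'.mem = c.mem ∧ ∀ x, c'.amp (Program.perm σ c.mem P x) = c.amp x := by
  induction P generalizing c with
  | nil =>
    obtain rfl := Multiset.mem_singleton.1 h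
    exact ⟨rfl, fun x => rfl⟩
  | cons s P ih =>
    obtain ⟨c₁, h₁, h₂⟩ := Multiset.mem_bind.1 h
    obtain ⟨e₁, e₂⟩ := Step.next_of_reversible (hP s List.mem_cons_self) h₁
      fun h => h0 (Program.amp_eq_zero h₂ h)
    obtain ⟨i₁, i₂⟩ := ih (fun s hs => hP s (List.mem_cons_of_mem _ hs)) h₂
    refine ⟨i₁.trans e₁, fun x => ?_⟩
    rw [← e₂ x, ← i₂, e₁]
    rfl

end QNet

namespace QNet

/-! ## Flooding a connected network -/

section Flooding

variable {V : Type*} (G : SimpleGraph V)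

/-- The parties that are informed after `t` rounds if those in `p` are at the beginning. -/
def informed (p : V → Prop) : ℕ → V → Prop
  | 0, v => p v
  | t + 1, v => informed p t v ∨ ∃ u, G.Adj v u ∧ informed p t u

variable {G}

theorem informed_of_walk {p : V → Prop} {u v : V} (hu : p u) (w : G.Walk v u) :
    ∀ t, w.length ≤ t → informed G p t v := by
  induction w with
  | nil =>
    intro t _
    induction t with
    | zero => exact hu
    | succ t ih => exact .inl (ih (Nat.zero_le _))
  | cons h w ih =>
    intro t ht
    obtain _ | t := t
    · simp at ht
    · exact .inr ⟨_, h, ih hu t (by simpa using ht)⟩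

theorem exists_of_informed {p : V → Prop} {t : ℕ} {v : V} (h : informed G p t v) : ∃ u, p u := by
  induction t generalizing v with
  | zero => exact ⟨v, h⟩
  | succ t ih =>
    rcases h with h | ⟨u, -, h⟩
    exacts [ih h, ih h]

/-- A walk can be shortened to a path, which repeats no vertex and thus has fewer than `Fintype.card
V` edges; `m` rounds cover it. -/
theorem informed_iff_exists [Fintype V] (hG : G.Connected) {m : ℕ} (hm : Fintype.card V ≤ m + 1)
    (p : V → Prop) (v : V) : informed G p m v ↔ ∃ u, p u := by
  classical
  refine ⟨exists_of_informed, fun ⟨u, hu⟩ => ?_⟩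
  obtain ⟨w⟩ := hG.preconnected v u
  have := w.toPath.2.length_lt
  exact informed_of_walk hu (w.toPath : G.Walk v u) m (by omega)

variable [Fintype V] [DecidableRel G.Adj]

theorem PortNumbering.exists_far (σ : PortNumbering G) (v : V) (p : V → Prop) :
    (∃ i, p (σ.far v i).1) ↔ ∃ u, G.Adj v u ∧ p u := by
  constructor
  · rintro ⟨i, h⟩
    exact ⟨_, ((σ v).symm i).2, h⟩
  · rintro ⟨u, h, hu⟩
    refine ⟨σ v ⟨u, h⟩, ?_⟩
    simpa [PortNumbering.far] using hu

end Flooding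

theorem Program.perm_loop {V : Type*} [Fintype V] {G : SimpleGraph V} [DecidableRel G.Adj]
    {A : Type} {CL : ℕ → Type} {CP : Type} {QL : ℕ → Type} {QP : Type}
    [DecidableEq A] [∀ d, DecidableEq (QL d)] [DecidableEq QP]
    {σ : PortNumbering G} {m : (v : V) → Reg CL CP (G.degree v) → A} {n : ℕ}
    {f : Fin n → Program A CL CP QL QP}
    (I : ℕ → ((v : V) → Reg QL QP (G.degree v) → Fin 2) → Prop)
    (h : ∀ (t : Fin n) x, I t x → I (t + 1) (Program.perm σ m (f t) x))
    {x : (v : V) → Reg QL QP (G.degree v) → Fin 2} (h0 : I 0 x) :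
    I n (Program.perm σ m ((List.finRange n).flatMap f) x) := by
  induction n with
  | zero => exact h0
  | succ n ih =>
    rw [List.finRange_succ_last, List.flatMap_append, List.flatMap_map, Program.perm_append]
    have := h (Fin.last n) _ (ih (f := fun t => f t.castSucc) fun t x => h t.castSucc x)
    simpa using this

namespace AlgorithmI

variable {m d : ℕ}

/-! ## Subroutine A -/

theorem perm_spreadX (mem : C d → Val) (t : Fin m) (y : Q m d → Fin 2) :
    (∀ i b, Instr.permList mem (spreadX t d) y (X t i b) =
      y (X t i b) + y (X0 t.castSucc b)) ∧
    ∀ p, (∀ i b, p ≠ X t i b) → Instr.permList mem (spreadX t d) y p = y p := by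
  have hw : ∀ p, (∀ i b, p ≠ X t i b) → Instr.permList mem (spreadX t d) y p = y p := by
    intro p hp
    apply Instr.permList_of_notMem
    intro a ha
    simp only [spreadX, List.mem_flatMap, List.mem_map] at ha
    obtain ⟨i, -, b, -, rfl⟩ := ha
    exact hp i b
  refine ⟨fun i b => ?_, hw⟩
  rw [← hw (X0 t.castSucc b) (by simp)]
  refine Instr.permList_straightLine mem (spreadX t d) y ?_ (f := fun a _ => a)
    (q := X0 t.castSucc b) (r := X0 t.castSucc b) (hq := by simp) (hr := by simp) ?_
  · simp only [spreadX, List.pairwise_flatMap, List.pairwise_map]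
    refine ⟨fun i _ => (List.pairwise_lt_finRange 2).imp fun h => ?_,
      (List.pairwise_lt_finRange d).imp fun h => ?_⟩
    · simp [copy, Instr.writes, Instr.reads, h.ne']
    · simp only [List.mem_map]
      rintro _ ⟨b, -, rfl⟩ _ ⟨b', -, rfl⟩
      simp [copy, Instr.writes, Instr.reads, h.ne']
  · simp only [spreadX, List.mem_flatMap, List.mem_map]
    exact ⟨i, by simp, b, by simp, rfl⟩

/-- Every partial result has a work register of its own, so each target is written once, before it
is read. The circuit is thus a straight-line program. -/
theorem perm_combineX (mem : C d → Val) (t : Fin m) (y : Q m d → Fin 2) :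
    (∀ b, Instr.permList mem (combineX t d) y (Y t 0 b) = y (Y t 0 b) + y (X0 t.castSucc b)) ∧
    (∀ (i : Fin d) b, Instr.permList mem (combineX t d) y (Y t i.succ b) =
      y (Y t i.succ b) + max (Instr.permList mem (combineX t d) y (Y t i.castSucc b))
        (y (X t i b))) ∧
    (∀ b, Instr.permList mem (combineX t d) y (X0 t.succ b) = y (X0 t.succ b) +
      Instr.permList mem (combineX t d) y (Y t (Fin.last d) b)) ∧
    ∀ p, (∀ i b, p ≠ Y t i b) → (∀ b, p ≠ X0 t.succ b) →
      Instr.permList mem (combineX t d) y p = y p := by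
  have hw : ∀ p, (∀ i b, p ≠ Y t i b) → (∀ b, p ≠ X0 t.succ b) →
      Instr.permList mem (combineX t d) y p = y p := by
    intro p hp hp'
    apply Instr.permList_of_notMem
    intro a ha
    simp only [combineX, List.mem_append, List.mem_flatMap, List.mem_map] at ha
    rcases ha with (⟨b, -, rfl⟩ | ⟨i, -, b, -, rfl⟩) | ⟨b, -, rfl⟩
    exacts [hp _ _, hp _ _, hp' _]
  have hs : (combineX t d).Pairwise fun (a b : Ins m d) =>
      ∀ p ∈ b.writes, p ∉ a.writes ∧ p ∉ a.reads := by
    simp only [combineX, List.pairwise_append, List.pairwise_flatMap, List.pairwise_map,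
      List.mem_append, List.mem_flatMap, List.mem_map]
    refine ⟨⟨?_, ⟨?_, ?_⟩, ?_⟩, ?_, ?_⟩
    · refine (List.pairwise_lt_finRange 2).imp fun h => ?_
      simp [copy, Instr.writes, Instr.reads, h.ne']
    · refine fun i _ => (List.pairwise_lt_finRange 2).imp fun h => ?_
      simp [Instr.writes, Instr.reads, h.ne', Fin.ext_iff]
    · refine (List.pairwise_lt_finRange d).imp fun h => ?_
      rw [Fin.lt_def] at h
      rintro _ ⟨b, -, rfl⟩ _ ⟨b', -, rfl⟩
      simp [Instr.writes, Instr.reads, Fin.ext_iff]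
      omega
    · rintro _ ⟨b, -, rfl⟩ _ ⟨i, -, b', -, rfl⟩
      simp [copy, Instr.writes, Instr.reads, Fin.ext_iff]
    · refine (List.pairwise_lt_finRange 2).imp fun h => ?_
      simp [copy, Instr.writes, Instr.reads, h.ne']
    · rintro _ (⟨b, -, rfl⟩ | ⟨i, -, b, -, rfl⟩) _ ⟨b', -, rfl⟩
      · simp [copy, Instr.writes, Instr.reads, Fin.ext_iff]
      · simp [copy, Instr.writes, Instr.reads]
  refine ⟨fun b => ?_, fun i b => ?_, fun b => ?_, hw⟩
  · rw [← hw (X0 t.castSucc b) (by simp) (by simp [Fin.ext_iff])]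
    refine Instr.permList_straightLine mem _ y hs (f := fun a _ => a)
      (q := X0 t.castSucc b) (r := X0 t.castSucc b) (hq := by simp) (hr := by simp) ?_
    simp only [combineX, List.mem_append, List.mem_flatMap, List.mem_map]
    exact .inl (.inl ⟨b, by simp, rfl⟩)
  · rw [← hw (X t i b) (by simp) (by simp)]
    refine Instr.permList_straightLine mem _ y hs (f := fun a a' => max a a')
      (q := Y t i.castSucc b) (r := X t i b) (hq := by simp [Fin.ext_iff]) (hr := by simp) ?_
    simp only [combineX, List.mem_append, List.mem_flatMap, List.mem_map]
    exact .inl (.inr ⟨i, by simp, b, by simp, rfl⟩)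
  · refine Instr.permList_straightLine mem _ y hs (f := fun a _ => a)
      (q := Y t (Fin.last d) b) (r := Y t (Fin.last d) b) (hq := by simp) (hr := by simp) ?_
    simp only [combineX, List.mem_append, List.mem_flatMap, List.mem_map]
    exact .inr ⟨b, by simp, rfl⟩

theorem max_eq_one_iff (a b : Fin 2) : max a b = 1 ↔ a = 1 ∨ b = 1 := by
  revert a b; decide

/-- If the registers for the result are empty, the result is the bitwise maximum. -/
theorem perm_combineX_eq_one (mem : C d → Val) (t : Fin m) (y : Q m d → Fin 2)
    (hY : ∀ i b, y (Y t i b) = 0) (hX : ∀ b, y (X0 t.succ b) = 0) (b : Fin 2) :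
    Instr.permList mem (combineX t d) y (X0 t.succ b) = 1 ↔
      y (X0 t.castSucc b) = 1 ∨ ∃ i, y (X t i b) = 1 := by
  obtain ⟨h0, hs, hl, -⟩ := perm_combineX mem t y
  -- The `i`th partial result combines the party's own bit with the ports of index less than `i`,
  -- counted from `0`.
  have key : ∀ i : Fin (d + 1), Instr.permList mem (combineX t d) y (Y t i b) = 1 ↔
      y (X0 t.castSucc b) = 1 ∨ ∃ j : Fin d, j.castSucc < i ∧ y (X t j b) = 1 := by
    intro i
    induction i using Fin.induction with
    | zero => simp [h0, hY]
    | succ i ih =>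
      rw [hs, hY, zero_add, max_eq_one_iff, ih, or_assoc]
      refine or_congr_right ⟨?_, ?_⟩
      · rintro (⟨j, hj, h⟩ | h)
        · exact ⟨j, hj.trans i.castSucc_lt_succ, h⟩
        · exact ⟨i, i.castSucc_lt_succ, h⟩
      · rintro ⟨j, hj, h⟩
        rcases (Fin.castSucc_lt_succ_iff.1 hj).lt_or_eq with h' | rfl
        · exact .inl ⟨j, h', h⟩
        · exact .inr h
  rw [hl, hX, zero_add, key]
  simp [Fin.castSucc_lt_last]

variable {V : Type*} [Fintype V] {G : SimpleGraph V} [DecidableRel G.Adj]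

/-- Before round `t` of Subroutine A, the registers of the earlier rounds hold the information that
is available at that time, the registers of the later rounds are empty. -/
structure LoopInvariant (p : Fin 2 → V → Prop) (t : ℕ)
    (x : (v : V) → Q m (G.degree v) → Fin 2) : Prop where
  current : ∀ v b, ∀ s : Fin (m + 1), s = t → (x v (X0 s b) = 1 ↔ informed G (p b) t v)
  later : ∀ v b, ∀ s : Fin (m + 1), t < s → x v (X0 s b) = 0
  work : ∀ v b, ∀ s : Fin m, t ≤ s → ∀ i, x v (Y s i b) = 0
  port : ∀ v b, ∀ s : Fin m, t ≤ s → ∀ i, x v (X s i b) = 0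

/-- The disjunction of the own bit with those received from all neighbours is exactly the recursion
that defines `informed`. A round writes only registers of its own index and the next `X_0`, so the
later ones stay empty. -/
theorem LoopInvariant.step (σ : PortNumbering G) (mem : (v : V) → C (G.degree v) → Val)
    {p : Fin 2 → V → Prop} {t : Fin m} {x : (v : V) → Q m (G.degree v) → Fin 2}
    (h : LoopInvariant p t x) :
    LoopInvariant p (t + 1) (Program.perm σ mem
      ([.compute (spreadX t), .exchange {(t, 0), (t, 1)} ∅,
        .compute (combineX t)] : Prog m) x) := by
  obtain ⟨y, hy⟩ : ∃ y, y = (Step.compute (spreadX t) : Step Val (fun _ => CVar) Unit (QVar m)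
    (Fin m × Fin 2)).perm σ mem x := ⟨_, rfl⟩
  obtain ⟨z, hz⟩ : ∃ z, z = (Step.exchange {(t, 0), (t, 1)} ∅ : Step Val (fun _ => CVar) Unit
    (QVar m) (Fin m × Fin 2)).perm σ mem y := ⟨_, rfl⟩
  change LoopInvariant p (t + 1) ((Step.compute (combineX t) : Step Val (fun _ => CVar) Unit
    (QVar m) (Fin m × Fin 2)).perm σ mem ((Step.exchange {(t, 0), (t, 1)} ∅ : Step Val
    (fun _ => CVar) Unit (QVar m) (Fin m × Fin 2)).perm σ mem ((Step.compute (spreadX t) : Step Val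
    (fun _ => CVar) Unit (QVar m) (Fin m × Fin 2)).perm σ mem x)))
  rw [← hy, ← hz]
  have yX : ∀ v i b, y v (X t i b) = x v (X0 t.castSucc b) := fun v i b => by
    rw [hy]
    refine ((perm_spreadX (mem v) t (x v)).1 i b).trans ?_
    rw [h.port v b t le_rfl i, zero_add]
  have yo : ∀ v q, (∀ i b, q ≠ X t i b) → y v q = x v q := fun v q hq => by
    rw [hy]
    exact (perm_spreadX (mem v) t (x v)).2 q hq
  -- After the exchange, port `i` holds the `X_0` content of the neighbour: the spread made the same
  -- copy at each of that neighbour's ports.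
  have zX : ∀ v i b, z v (X t i b) = x (σ.far v i).1 (X0 t.castSucc b) := fun v i b => by
    rw [hz, ← yX _ (σ.far v i).2]
    have : (t, b) ∈ ({(t, 0), (t, 1)} : Finset (Fin m × Fin 2)) := by
      revert b; simp [Fin.forall_fin_two]
    simp [Step.perm, PortNumbering.swap, this]
  have zXo : ∀ v s i b, s ≠ t → z v (X s i b) = x v (X s i b) := fun v s i b hs => by
    rw [← yo v _ (by simp [hs]), hz]
    simp [Step.perm, PortNumbering.swap, hs]
  have zl : ∀ v l, z v (.inl l) = x v (.inl l) := fun v l => by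
    rw [← yo v _ (by simp), hz]
    rfl
  have wo : ∀ v q, (∀ i b, q ≠ Y t i b) → (∀ b, q ≠ X0 t.succ b) →
      (Step.compute (combineX t) : Step Val (fun _ => CVar) Unit (QVar m) (Fin m × Fin 2)).perm
        σ mem z v q = z v q := fun v q hq hq' => (perm_combineX (mem v) t (z v)).2.2.2 q hq hq'
  refine ⟨fun v b s hs => ?_, fun v b s hs => ?_, fun v b s hs i => ?_, fun v b s hs i => ?_⟩
  · obtain rfl : s = t.succ := Fin.ext (by simpa using hs)
    refine (perm_combineX_eq_one (mem v) t (z v) (fun i b => ?_) (fun b => ?_) b).trans ?_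
    · rw [zl, h.work v b t le_rfl]
    · rw [zl, h.later v b _ (by simp)]
    · rw [zl, h.current v b t.castSucc rfl]
      simp only [zX]
      refine or_congr_right ?_
      rw [σ.exists_far v fun u => x u (X0 t.castSucc b) = 1]
      simp only [h.current _ b t.castSucc rfl]
  · have : s ≠ t.succ := fun e => by simp [e] at hs
    rw [wo v _ (by simp) (by simp [this]), zl, h.later v b s (by omega)]
  · have : s ≠ t := fun e => by simp [e] at hs
    rw [wo v _ (by simp [this]) (by simp), zl, h.work v b s (by omega)]
  · have : s ≠ t := fun e => by simp [e] at hs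
    rw [wo v _ (by simp) (by simp), zXo v s i b this, h.port v b s (by omega)]

end AlgorithmI

end QNet

/-! ### The consistency check as a permutation of basis states -/

namespace QNet

namespace AlgorithmI

variable {m : ℕ} {V : Type*} [Fintype V] {G : SimpleGraph V} [DecidableRel G.Adj]

abbrev NetConfig (G : SimpleGraph V) [DecidableRel G.Adj] (m : ℕ) : Type _ :=
  Config G Val (fun _ => CVar) Unit (QVar m) (Fin m × Fin 2)

abbrev NetBasis (G : SimpleGraph V) [DecidableRel G.Adj] (m : ℕ) : Type _ :=
  (v : V) → Q m (G.degree v) → Fin 2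

abbrev NetMem (G : SimpleGraph V) [DecidableRel G.Adj] : Type _ :=
  (v : V) → C (G.degree v) → Val

def Eligible (mem : NetMem G) (v : V) : Prop := mem v (var .status) = eligible

instance (mem : NetMem G) : DecidablePred (Eligible mem) := fun v =>
  inferInstanceAs (Decidable (mem v (var .status) = eligible))

/-- Two eligible parties hold different values in `R_0`. -/
def Mixed (mem : NetMem G) (x : NetBasis G m) : Prop :=
  ∀ b, ∃ u, Eligible mem u ∧ x u R0 = b

/-- All registers `X` and all work registers are empty. -/
def Clean (x : NetBasis G m) : Prop :=
  ∀ v, (∀ t b, x v (X0 t b) = 0) ∧ (∀ t i b, x v (Y t i b) = 0) ∧ ∀ t i b, x v (X t i b) = 0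

/-- Negate the content of `R_0` of all eligible parties. -/
def flipR0 (mem : NetMem G) (x : NetBasis G m) : NetBasis G m :=
  fun v => if Eligible mem v then Function.update (x v) R0 (x v R0 + 1) else x v

theorem flipR0_of_ne (mem : NetMem G) (x : NetBasis G m) (v : V) {q : Q m (G.degree v)}
    (hq : q ≠ R0) : flipR0 mem x v q = x v q := by
  unfold flipR0
  split_ifs
  · simp [hq]
  · rfl

theorem flipR0_of_eligible {mem : NetMem G} (x : NetBasis G m) {v : V} (h : Eligible mem v) :
    flipR0 mem x v R0 = x v R0 + 1 := by
  simp [flipR0, h]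

theorem flipR0_flipR0 (mem : NetMem G) (x : NetBasis G m) :
    flipR0 mem (flipR0 mem x) = x := by
  funext v
  unfold flipR0
  split_ifs
  · simp [two_add_self]
  · rfl

theorem clean_flipR0 (mem : NetMem G) (x : NetBasis G m) : Clean (flipR0 mem x) ↔ Clean x := by
  simp [Clean, flipR0_of_ne]

/-- The negation interchanges the witnesses for the two values; the converse follows because it is
an involution. -/
theorem mixed_flipR0 (mem : NetMem G) (x : NetBasis G m) :
    Mixed mem (flipR0 mem x) ↔ Mixed mem x := by
  have h : ∀ y : NetBasis G m, Mixed mem y → Mixed mem (flipR0 mem y) := fun y hy b => by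
    obtain ⟨u, hu, h⟩ := hy (b + 1)
    exact ⟨u, hu, by rw [flipR0_of_eligible y hu, h, two_add_self]⟩
  exact ⟨fun hx => by simpa [flipR0_flipR0] using h _ hx, h x⟩

theorem invert_eq (P : Prog m) : invert P = P.reverse.map Step.inv := by
  unfold invert
  congr 1
  funext s
  cases s <;> rfl

/-- The part of Subroutine A that precedes the change of `S`. -/
def gather (m : ℕ) : Prog m := .compute (loadX m) :: loopA m

/-- Subroutine A after the preparation of the registers. -/
def checkConsistency (m : ℕ) : Prog m :=
  gather m ++ [.compute (flipS m)] ++ (gather m).reverse.map Step.inv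

/-- Counting the loading of `X_0` as part of the gathering exhibits Subroutine A, after the
preparations, as a conjugate of the single toggle of `S`. -/
theorem subroutineA_eq (m : ℕ) :
    subroutineA m = .compute (prepareX m) :: checkConsistency m := by
  simp [subroutineA, checkConsistency, gather, invert_eq]

theorem mem_gather {s : Step Val (fun _ => CVar) Unit (QVar m) (Fin m × Fin 2)}
    (hs : s ∈ gather m) : s = .compute (loadX m) ∨ ∃ t : Fin m, s = .compute (spreadX t) ∨
      s = .exchange {(t, 0), (t, 1)} ∅ ∨ s = .compute (combineX t) := by
  simpa [gather, loopA, List.mem_flatMap] using hs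

theorem reversible_gather {s : Step Val (fun _ => CVar) Unit (QVar m) (Fin m × Fin 2)}
    (hs : s ∈ gather m) : s.Reversible := by
  rcases mem_gather hs with rfl | ⟨t, rfl | rfl | rfl⟩
  · intro d a ha
    simp only [loadX, List.mem_cons, List.not_mem_nil, or_false] at ha
    rcases ha with rfl | rfl <;> trivial
  · intro d a ha
    simp only [spreadX, List.mem_flatMap, List.mem_map] at ha
    obtain ⟨i, -, b, -, rfl⟩ := ha
    trivial
  · rfl
  · intro d a ha
    simp only [combineX, List.mem_append, List.mem_flatMap, List.mem_map] at ha
    rcases ha with (⟨b, -, rfl⟩ | ⟨i, -, b, -, rfl⟩) | ⟨b, -, rfl⟩ <;> trivial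

theorem Step.reversible_inv {s : Step Val (fun _ => CVar) Unit (QVar m) (Fin m × Fin 2)}
    (hs : s.Reversible) : s.inv.Reversible := by
  cases s with
  | compute prog => exact fun d a ha => hs d a (List.mem_reverse.1 ha)
  | exchange S T => exact hs

theorem reversible_checkConsistency
    {s : Step Val (fun _ => CVar) Unit (QVar m) (Fin m × Fin 2)}
    (hs : s ∈ checkConsistency m) : s.Reversible := by
  simp only [checkConsistency, List.mem_append, List.mem_map, List.mem_reverse,
    List.mem_singleton] at hs
  rcases hs with (hs | rfl) | ⟨s, hs, rfl⟩
  · exact reversible_gather hs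
  · intro d a ha
    simp only [flipS, List.mem_singleton] at ha
    subst ha
    trivial
  · exact Step.reversible_inv (reversible_gather hs)

/-- The check does not touch the qubit `S` except for the one toggle. -/
theorem untouched_gather {prog : (d : ℕ) → List (Ins m d)}
    (hs : Step.compute prog ∈ (gather m).reverse.map Step.inv) (d : ℕ) {a : Ins m d}
    (ha : a ∈ prog d) : S ∉ a.writes ∧ S ∉ a.reads := by
  simp only [List.mem_map, List.mem_reverse] at hs
  obtain ⟨s, hs, h⟩ := hs
  rcases mem_gather hs with rfl | ⟨t, rfl | rfl | rfl⟩
  · obtain rfl := Step.compute.inj h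
    simp only [loadX, List.mem_cons, List.not_mem_nil, or_false, List.mem_reverse] at ha
    rcases ha with rfl | rfl <;> simp [ifStatus, copy, Instr.writes, Instr.reads]
  · obtain rfl := Step.compute.inj h
    simp only [spreadX, List.mem_flatMap, List.mem_map, List.mem_reverse] at ha
    obtain ⟨i, -, b, -, rfl⟩ := ha
    simp [copy, Instr.writes, Instr.reads]
  · simp [Step.inv] at h
  · obtain rfl := Step.compute.inj h
    simp only [combineX, List.mem_append, List.mem_flatMap, List.mem_map, List.mem_reverse] at ha
    rcases ha with (⟨b, -, rfl⟩ | ⟨i, -, b, -, rfl⟩) | ⟨b, -, rfl⟩ <;>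
      simp [copy, Instr.writes, Instr.reads]

theorem perm_loadX {d : ℕ} (mem : C d → Val) (y : Q m d → Fin 2) (h0 : ∀ b, y (X0 0 b) = 0) :
    (∀ b, Instr.permList mem (loadX m d) y (X0 0 b) = 1 ↔
      mem (var .status) = eligible ∧ y R0 = b) ∧
    ∀ q, (∀ b, q ≠ X0 0 b) → Instr.permList mem (loadX m d) y q = y q := by
  have two : ∀ a : Fin 2, (a + 1 = 1 ↔ a = 0) := by decide
  constructor
  · intro b
    by_cases h : mem (var .status) = eligible
    · revert b
      simp [Fin.forall_fin_two, Instr.permList, loadX, ifStatus, copy, Instr.perm, h, h0, two]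
    · simp [Instr.permList, loadX, ifStatus, copy, Instr.perm, h, h0]
  · intro q hq
    apply Instr.permList_of_notMem
    intro a ha
    simp only [loadX, List.mem_cons, List.not_mem_nil, or_false] at ha
    rcases ha with rfl | rfl
    exacts [hq 0, hq 1]

/-- For each `b` the qubits with index `b` flood the network on their own, starting from the
eligible parties with `b` in `R_0`. -/
theorem gather_result (hG : G.Connected) (hm : Fintype.card V ≤ m + 1) (σ : PortNumbering G)
    (mem : NetMem G) {x : NetBasis G m} (hx : Clean x) (v : V) (b : Fin 2) :
    Program.perm σ mem (gather m) x v (X0 (Fin.last m) b) = 1 ↔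
      ∃ u, Eligible mem u ∧ x u R0 = b := by
  rw [← informed_iff_exists hG hm (fun u => Eligible mem u ∧ x u R0 = b) v]
  have := Program.perm_loop (σ := σ) (m := mem)
    (LoopInvariant fun b u => Eligible mem u ∧ x u R0 = b)
    (f := fun t : Fin m => ([.compute (spreadX t), .exchange {(t, 0), (t, 1)} ∅,
      .compute (combineX t)] : Prog m))
    (fun t y h => h.step σ mem)
    (x := (Step.compute (loadX m) : Step Val (fun _ => CVar) Unit (QVar m)
      (Fin m × Fin 2)).perm σ mem x) ?_
  · exact this.current v b (Fin.last m) rfl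
  · have hl := fun v => perm_loadX (mem v) (x v) ((hx v).1 0)
    refine ⟨fun v b s hs => ?_, fun v b s hs => ?_, fun v b s _ i => ?_, fun v b s _ i => ?_⟩
    · obtain rfl : s = 0 := Fin.ext hs
      exact (hl v).1 b
    · have : s ≠ 0 := fun h => by simp [h] at hs
      exact ((hl v).2 _ (by simp [this])).trans ((hx v).1 s b)
    · exact ((hl v).2 _ (by simp)).trans ((hx v).2.1 s i b)
    · exact ((hl v).2 _ (by simp)).trans ((hx v).2.2 s i b)

theorem perm_flipS (σ : PortNumbering G) (mem : NetMem G) (y : NetBasis G m) :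
    (Step.compute (flipS m) : Step Val (fun _ => CVar) Unit (QVar m) (Fin m × Fin 2)).perm σ mem y =
      fun v => Function.update (y v) S
        (y v S + min (y v (X0 (Fin.last m) 0)) (y v (X0 (Fin.last m) 1))) := rfl

theorem perm_checkConsistency (σ : PortNumbering G) (mem : NetMem G) (x : NetBasis G m) :
    Program.perm σ mem (checkConsistency m) x =
      Program.perm σ mem ((gather m).reverse.map Step.inv)
        ((Step.compute (flipS m) : Step Val (fun _ => CVar) Unit (QVar m) (Fin m × Fin 2)).perm
          σ mem (Program.perm σ mem (gather m) x)) := by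
  rw [checkConsistency, Program.perm_append, Program.perm_append]
  rfl

/-- A conjugate of an involution is an involution. Consequently the new amplitudes are the old ones
composed with the same permutation. -/
theorem perm_checkConsistency_twice (σ : PortNumbering G) (mem : NetMem G) (x : NetBasis G m) :
    Program.perm σ mem (checkConsistency m) (Program.perm σ mem (checkConsistency m) x) = x := by
  rw [perm_checkConsistency, perm_checkConsistency, Program.perm_inv', perm_flipS, perm_flipS]
  have hne : ∀ (v : V) (b : Fin 2), (X0 (Fin.last m) b : Q m (G.degree v)) ≠ S := by simp
  simp only [Function.update_self, Function.update_idem, Function.update_of_ne (hne _ _)]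
  simpa only [Function.update_eq_self, two_add_self] using Program.perm_inv σ mem (gather m) x

open Classical in
/-- The bit that Subroutine A adds to `S`. -/
noncomputable def mixedBit (mem : NetMem G) (x : NetBasis G m) : Fin 2 :=
  if Mixed mem x then 1 else 0

/-- The inverse of the gathering does not involve `S`, so it restores everything else and leaves the
added bit. This bit is the conjunction of the two flooded bits. -/
theorem perm_checkConsistency_of_clean (hG : G.Connected) (hm : Fintype.card V ≤ m + 1)
    (σ : PortNumbering G) (mem : NetMem G) {x : NetBasis G m} (hx : Clean x) :
    Program.perm σ mem (checkConsistency m) x =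
      fun v => Function.update (x v) S (x v S + mixedBit mem x) := by
  -- Overwriting `S` with its own value changes nothing; moving this past the inverse shows that `x`
  -- already has that value in `S`.
  have hS : ∀ v, Program.perm σ mem (gather m) x v S = x v S := fun v => by
    have := Program.perm_comm σ mem ((gather m).reverse.map Step.inv)
      (Program.perm σ mem (gather m) x) (fun _ => QVar.S)
      (fun v => Program.perm σ mem (gather m) x v S) fun prog hp v a ha =>
        untouched_gather hp _ ha
    simp only [Function.update_eq_self, Program.perm_inv] at this
    have := congrFun (congrFun this v) S
    simpa using this.symm
  rw [perm_checkConsistency, perm_flipS]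
  refine (Program.perm_comm σ mem ((gather m).reverse.map Step.inv)
      (Program.perm σ mem (gather m) x) (fun _ => QVar.S) _ fun prog hp v a ha =>
        untouched_gather hp _ ha).trans ?_
  funext v
  rw [Program.perm_inv, hS]
  congr 2
  have h := fun b => gather_result hG hm σ mem hx v b
  have min_eq : ∀ a b : Fin 2, ∀ c : Fin 2, (a = 1 ∧ b = 1 ↔ c = 1) → min a b = c := by decide
  refine min_eq _ _ _ ?_
  rw [h 0, h 1]
  have : Mixed mem x ↔ (∃ u, Eligible mem u ∧ x u R0 = 0) ∧ ∃ u, Eligible mem u ∧ x u R0 = 1 :=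
    Fin.forall_fin_two
  rw [← this, mixedBit]
  split_ifs with hM <;> simp [hM]

/-- The state after Subroutine A: all parties hold in `S` whether the state is mixed. -/
structure Checked (c : NetConfig G m) : Prop where
  flip : ∀ x, c.amp (flipR0 c.mem x) = c.amp x
  check : ∀ x, c.amp x ≠ 0 → ∀ v, x v S = mixedBit c.mem x

/-- The state before Subroutine A. -/
structure Prepared (c : NetConfig G m) : Prop where
  flip : ∀ x, c.amp (flipR0 c.mem x) = c.amp x
  consistent : ∀ x, c.amp x ≠ 0 → ∀ v, x v S = 0
  clean : ∀ x, c.amp x ≠ 0 → Clean x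

theorem mixedBit_congr {mem : NetMem G} {x y : NetBasis G m} (h : Mixed mem x ↔ Mixed mem y) :
    mixedBit mem x = mixedBit mem y := by
  unfold mixedBit
  split_ifs <;> tauto

variable [DecidableEq V]

/-- On clean states the check adds to `S` a bit that is invariant under `flipR0`, so it commutes
with `flipR0` and the symmetry survives. Since `S` was `0` before, it now equals that bit. -/
theorem Prepared.checked (hG : G.Connected) (hm : Fintype.card V ≤ m + 1)
    {σ : PortNumbering G} {c c' : NetConfig G m} (hc : Prepared c)
    (h : c' ∈ Program.branches σ (checkConsistency m) c) (h0 : c'.amp ≠ 0) :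
    c'.mem = c.mem ∧ Checked c' := by
  obtain ⟨hmem, hamp⟩ := Program.branches_of_reversible
    (fun s => reversible_checkConsistency) h h0
  refine ⟨hmem, ?_⟩
  have hamp' : ∀ x, c'.amp x = c.amp (Program.perm σ c.mem (checkConsistency m) x) := fun x => by
    rw [← hamp, perm_checkConsistency_twice]
  have hperm := fun (x : NetBasis G m) (hx : Clean x) =>
    perm_checkConsistency_of_clean hG hm σ c.mem hx
  -- The preimage of `x` is clean, and as the check is an involution `x` is its image, which differs
  -- from it in `S` only.
  have hclean : ∀ x, c'.amp x ≠ 0 → Clean x := fun x hx => by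
    rw [hamp'] at hx
    have h1 := hc.clean _ hx
    have h2 := hperm _ h1
    rw [perm_checkConsistency_twice] at h2
    rw [h2]
    simpa [Clean] using h1
  constructor
  · intro x
    by_cases hx : Clean x
    · rw [hamp', hamp', hmem, hperm x hx, hperm _ ((clean_flipR0 _ _).2 hx),
        mixedBit_congr (mixed_flipR0 _ _),
        ← hc.flip fun v => Function.update (x v) S (x v S + mixedBit c.mem x)]
      congr 1
      funext v
      simp only [flipR0]
      split_ifs
      · rw [Function.update_of_ne (by simp), Function.update_of_ne (by simp),
          Function.update_comm (by simp)]
      · rfl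
    -- If `x` is not clean, neither is its flip, and both amplitudes vanish.
    · rw [not_imp_comm.1 (hclean x) hx,
        not_imp_comm.1 (hclean _) (fun h => hx ((clean_flipR0 _ _).1 h))]
  · intro x hx v
    have h1 := hclean x hx
    rw [hamp', hperm x h1] at hx
    have h2 := hc.consistent _ hx v
    rw [Function.update_self] at h2
    have : ∀ a b : Fin 2, a + b = 0 → a = b := by decide
    rw [hmem]
    exact this _ _ h2

end AlgorithmI

end QNet

namespace QNet

/-! ## Kraus operators of preparations and measurements -/

section Local

variable {A C Q : Type} [DecidableEq A] [DecidableEq C] [DecidableEq Q] [Fintype Q]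

/-- Negate the qubit `p` of a basis state. -/
def negate (p : Q) (x : Q → Fin 2) : Q → Fin 2 := Function.update x p (x p + 1)

omit [Fintype Q] in
theorem negate_negate (p : Q) (x : Q → Fin 2) : negate p (negate p x) = x := by
  simp [negate, two_add_self]

omit [Fintype Q] in
theorem negate_of_ne {p q : Q} (h : q ≠ p) (x : Q → Fin 2) : negate p x q = x q :=
  Function.update_of_ne h _ _

omit [Fintype Q] in
theorem negate_self (p : Q) (x : Q → Fin 2) : negate p x p = x p + 1 :=
  Function.update_self _ _ _

/-- The operator commutes with the negation of the qubit `p`. -/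
def CommutesWithNegate (p : Q) (K : Matrix (Q → Fin 2) (Q → Fin 2) ℂ) : Prop :=
  ∀ x y, K (negate p x) (negate p y) = K x y

theorem sum_negate (p : Q) (f : (Q → Fin 2) → ℂ) : ∑ x, f (negate p x) = ∑ x, f x :=
  Equiv.sum_comp (⟨negate p, negate p, negate_negate p, negate_negate p⟩ :
    Equiv.Perm (Q → Fin 2)) f

theorem CommutesWithNegate.mul {p : Q} {K K' : Matrix (Q → Fin 2) (Q → Fin 2) ℂ}
    (h : CommutesWithNegate p K) (h' : CommutesWithNegate p K') :
    CommutesWithNegate p (K * K') := fun x y => by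
  rw [Matrix.mul_apply, Matrix.mul_apply, ← sum_negate p]
  exact Finset.sum_congr rfl fun z _ => by rw [h, h']

/-- Symmetry of the output only: the first operator creates an invariant superposition from a fixed
column, and the second operator preserves the invariance. -/
theorem CommutesWithNegate.mul_apply {p : Q} {K K' : Matrix (Q → Fin 2) (Q → Fin 2) ℂ}
    (h : CommutesWithNegate p K) {y : Q → Fin 2} (h' : ∀ x, K' (negate p x) y = K' x y)
    (x : Q → Fin 2) : (K * K') (negate p x) y = (K * K') x y := by
  rw [Matrix.mul_apply, Matrix.mul_apply, ← sum_negate p]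
  exact Finset.sum_congr rfl fun z _ => by rw [h, h']

theorem commutesWithNegate_one (p : Q) : CommutesWithNegate p 1 := fun x y => by
  rw [Matrix.one_apply, Matrix.one_apply]
  exact if_congr ⟨fun h => by rw [← negate_negate p x, h, negate_negate],
    fun h => by rw [h]⟩ rfl rfl

theorem commutesWithNegate_prepare {p q : Q} (hpq : p ≠ q) (o : Fin 2) (m : C → A) :
    CommutesWithNegate p ((Instr.prepare q : Instr A C Q).act o m).2 := fun x y => by
  simp only [Instr.act, Matrix.of_apply, negate_of_ne hpq.symm]
  have e : Function.update (negate p y) q 0 = negate p (Function.update y q 0) := by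
    simp only [negate, Function.update_of_ne hpq]
    exact Function.update_comm hpq _ _ _
  rw [e]
  refine if_congr (and_congr_right fun _ => ⟨fun h => ?_, fun h => by rw [h]⟩) rfl rfl
  rw [← negate_negate p x, h, negate_negate]

theorem mul_labelled_graph {B : Type*} [Fintype B] [DecidableEq B] {M N : Matrix B B ℂ}
    {P : B → Prop} [DecidablePred P] {g : B → B}
    (hN : ∀ x y, N x y = if P y ∧ x = g y then 1 else 0) (x y : B) :
    (M * N) x y = if P y then M x (g y) else 0 := by
  simp only [Matrix.mul_apply, hN]
  by_cases h : P y <;> simp [h]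

theorem Instr.act_prepare_fst (q : Q) (o : Fin 2) (m : C → A) :
    ((Instr.prepare q : Instr A C Q).act o m).1 = m := rfl

theorem mul_prepare (M : Matrix (Q → Fin 2) (Q → Fin 2) ℂ) (q : Q) (o : Fin 2) (m : C → A)
    (x y : Q → Fin 2) :
    (M * ((Instr.prepare q : Instr A C Q).act o m).2) x y =
      if y q = o then M x (Function.update y q 0) else 0 :=
  mul_labelled_graph (P := fun y => y q = o) (g := fun y => Function.update y q 0)
    (fun _ _ => rfl) x y

theorem mul_measure (M : Matrix (Q → Fin 2) (Q → Fin 2) ℂ) (q : Q) (v : C) (g : Fin 2 → A)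
    (o : Fin 2) (m : C → A) (x y : Q → Fin 2) :
    (M * ((Instr.measure q v g : Instr A C Q).act o m).2) x y =
      if y q = o then M x y else 0 :=
  mul_labelled_graph (P := fun y => y q = o) (g := fun y => y) (fun _ _ => rfl) x y

theorem Instr.act_guard_of_ne {v : C} {a : A} {m : C → A} (h : m v ≠ a) (body : Instr A C Q)
    (o : Fin 2) : (Instr.guard v a body).act o m = (m, if o = 0 then 1 else 0) := by
  simp [Instr.act, h]

theorem Instr.act_guard_of_eq {v : C} {a : A} {m : C → A} (h : m v = a) (body : Instr A C Q)
    (o : Fin 2) : (Instr.guard v a body).act o m = body.act o m := by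
  simp [Instr.act, h]

theorem Instr.outcome_of_idle {L : List (Instr A C Q)} {m : C → A}
    (hL : ∀ a ∈ L, ∀ o, a.act o m = (m, if o = 0 then 1 else 0)) {r}
    (h : Instr.Outcome L m r) : r.1 = m ∧ (r.2 = 0 ∨ r.2 = 1) := by
  induction L generalizing r with
  | nil =>
    obtain rfl := Instr.outcome_nil.1 h
    exact ⟨rfl, .inr rfl⟩
  | cons a L ih =>
    obtain ⟨o, r', h', rfl⟩ := Instr.outcome_cons.1 h
    rw [hL a List.mem_cons_self o] at h' ⊢
    obtain ⟨h₁, h₂⟩ := ih (fun a ha => hL a (List.mem_cons_of_mem _ ha)) h'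
    refine ⟨h₁, ?_⟩
    rcases h₂ with h₂ | h₂ <;> by_cases ho : o = 0 <;> simp [h₂, ho]

theorem Instr.outcome_of_prepare {L : List (Instr A C Q)}
    (hL : ∀ a ∈ L, ∃ q, a = .prepare q) {m : C → A} {r} (h : Instr.Outcome L m r) :
    r.1 = m ∧ (∀ p, .prepare p ∉ L → CommutesWithNegate p r.2) ∧
      ∀ x y, r.2 x y ≠ 0 → ∀ p, (.prepare p ∈ L → x p = 0) ∧ (.prepare p ∉ L → x p = y p) := by
  induction L generalizing r with
  | nil =>
    obtain rfl := Instr.outcome_nil.1 h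
    refine ⟨rfl, fun p _ => commutesWithNegate_one p, fun x y hxy p => ?_⟩
    have : x = y := by
      by_contra hne
      exact hxy (Matrix.one_apply_ne hne)
    exact ⟨by simp, fun _ => by rw [this]⟩
  | cons a L ih =>
    obtain ⟨q, rfl⟩ := hL a List.mem_cons_self
    obtain ⟨o, r', h', rfl⟩ := Instr.outcome_cons.1 h
    obtain ⟨h₁, h₂, h₃⟩ := ih (fun a ha => hL a (List.mem_cons_of_mem _ ha)) h'
    refine ⟨h₁, fun p hp => ?_, fun x y hxy p => ?_⟩
    · simp only [List.mem_cons, not_or, Instr.prepare.injEq] at hp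
      exact (h₂ p hp.2).mul (commutesWithNegate_prepare hp.1 o m)
    · simp only [mul_prepare] at hxy
      have hxy' : r'.2 x (Function.update y q 0) ≠ 0 := fun h => hxy (by simp [h])
      obtain ⟨h₄, h₅⟩ := h₃ x _ hxy' p
      simp only [List.mem_cons, not_or, Instr.prepare.injEq]
      constructor
      · intro hp
        by_cases hin : Instr.prepare p ∈ L
        · exact h₄ hin
        · obtain rfl := hp.resolve_right hin
          rw [h₅ hin, Function.update_self]
      · rintro ⟨hp, hin⟩
        rw [h₅ hin, Function.update_of_ne hp]

end Local

namespace AlgorithmI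

variable {m d : ℕ}

/-! ## The local computations of a phase -/

/-- Besides unitarity, this is all that is used of the Hadamard gate: it turns `|0⟩` into a state
invariant under negation. -/
theorem matH_column (a : Fin 2) : matH (a + 1) 0 = matH a 0 := by
  fin_cases a <;> simp [matH]

theorem outcome_init {mem : C d → Val} {r}
    (h : Instr.Outcome ([.prepare R0, ifStatus eligible (.gate1 ⟨matH, matH_mem⟩ R0),
      .prepare S] : List (Ins m d)) mem r) :
    r.1 = mem ∧ (∀ x y, r.2 x y ≠ 0 → x S = 0) ∧
      (mem (var .status) = eligible → ∀ x y, r.2 (negate R0 x) y = r.2 x y) := by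
  obtain ⟨o₁, r₁, h', rfl⟩ := Instr.outcome_cons.1 h
  obtain ⟨o₂, r₂, h'', rfl⟩ := Instr.outcome_cons.1 h'
  obtain ⟨h₁, h₂, h₃⟩ := Instr.outcome_of_prepare (by simp) h''
  have hm : ((ifStatus eligible (.gate1 ⟨matH, matH_mem⟩ R0) : Ins m d).act o₂
      ((Instr.prepare R0 : Ins m d).act o₁ mem).1).1 = mem := by
    by_cases hs : mem (var .status) = eligible
    · rw [ifStatus, Instr.act_prepare_fst, Instr.act_guard_of_eq hs]; rfl
    · rw [ifStatus, Instr.act_prepare_fst, Instr.act_guard_of_ne hs]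
  refine ⟨h₁.trans hm, fun x y hxy => ?_, fun hs x y => ?_⟩
  · by_contra hx
    refine hxy ?_
    have h0 : ∀ z, r₂.2 x z = 0 := fun z => by
      by_contra hz
      exact hx ((h₃ x z hz S).1 (by simp))
    simp only [Matrix.mul_apply]
    exact Finset.sum_eq_zero fun z _ => by
      rw [Finset.sum_eq_zero fun w _ => by rw [h0, zero_mul], zero_mul]
  -- The preparation leaves `0` in `R_0`, so only the first column of the gate matters; the later
  -- preparation of `S` commutes with the negation of `R_0`.
  · simp only [mul_prepare]
    split_ifs with hy
    · refine (h₂ R0 (by simp)).mul_apply (fun x => ?_) x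
      rw [ifStatus, Instr.act_prepare_fst, Instr.act_guard_of_eq hs]
      by_cases ho : o₂ = 0
      · simp only [Instr.act, ho, if_true, Matrix.of_apply, Function.update_self, negate_self,
          matH_column]
        refine if_congr (forall₂_congr fun p hp => ?_) rfl rfl
        rw [negate_of_ne hp]
      · simp [Instr.act, ho]
    · rfl

theorem mem_prepareX {a : Ins m d} (ha : a ∈ prepareX m d) :
    ∃ q, a = .prepare q ∧ q ≠ R0 ∧ q ≠ S := by
  simp only [prepareX, List.mem_append, List.mem_flatMap, List.mem_map] at ha
  rcases ha with ⟨t, -, b, -, rfl⟩ | ⟨t, -, ⟨i, -, b, -, rfl⟩ | ⟨i, -, b, -, rfl⟩⟩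
  all_goals exact ⟨_, rfl, by simp, by simp⟩

theorem outcome_prepareX {mem : C d → Val} {r} (h : Instr.Outcome (prepareX m d) mem r) :
    r.1 = mem ∧ CommutesWithNegate R0 r.2 ∧ ∀ x y, r.2 x y ≠ 0 → x S = y S ∧
      (∀ t b, x (X0 t b) = 0) ∧ (∀ t i b, x (Y t i b) = 0) ∧ ∀ t i b, x (X t i b) = 0 := by
  obtain ⟨h₁, h₂, h₃⟩ := Instr.outcome_of_prepare
    (fun a ha => (mem_prepareX ha).imp fun q hq => hq.1) h
  have hR : (.prepare R0 : Ins m d) ∉ prepareX m d := fun hR => by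
    obtain ⟨q, e, hq, -⟩ := mem_prepareX hR
    exact hq (Instr.prepare.inj e).symm
  have hS : (.prepare S : Ins m d) ∉ prepareX m d := fun hS => by
    obtain ⟨q, e, -, hq⟩ := mem_prepareX hS
    exact hq (Instr.prepare.inj e).symm
  refine ⟨h₁, h₂ R0 hR, fun x y hxy => ⟨(h₃ x y hxy S).2 hS, fun t b => (h₃ x y hxy _).1 ?_,
    fun t i b => (h₃ x y hxy _).1 ?_, fun t i b => (h₃ x y hxy _).1 ?_⟩⟩
  · simp only [prepareX, List.mem_append, List.mem_flatMap, List.mem_map]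
    exact .inl ⟨t, by simp, b, by simp, rfl⟩
  · simp only [prepareX, List.mem_append, List.mem_flatMap, List.mem_map]
    exact .inr ⟨t, by simp, .inl ⟨i, by simp, b, by simp, rfl⟩⟩
  · simp only [prepareX, List.mem_append, List.mem_flatMap, List.mem_map]
    exact .inr ⟨t, by simp, .inr ⟨i, by simp, b, by simp, rfl⟩⟩

/-- The amplitude with which Subroutine B takes a party of an unmixed state from the value `c` in
`R_0` to the values `a`, `b` in `R_0`, `R_1`, where `k = j + 2`. -/
noncomputable def amplitude (j : ℕ) (a b c : Fin 2) : ℂ :=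
  if Even (j + 2) then matU (j + 2) a c
  else matV (j + 2) (finProdFinEquiv (a, b)) (finProdFinEquiv (c, c))

/-- The origin of the cancellation: `k` parties, each with the phase `π / k`, produce a factor `-1`
together. -/
theorem exp_pow_half_turn {k : ℕ} (hk : k ≠ 0) :
    Complex.exp (Complex.I * (Real.pi / k)) ^ k = -1 := by
  rw [← Complex.exp_nat_mul, mul_left_comm, mul_div_cancel₀ _ (by exact_mod_cast hk), mul_comm,
    Complex.exp_pi_mul_I]

theorem exp_neg_pow_half_turn {k : ℕ} (hk : k ≠ 0) :
    Complex.exp (-Complex.I * (Real.pi / k)) ^ k = -1 := by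
  rw [neg_mul, Complex.exp_neg, inv_pow, exp_pow_half_turn hk]
  norm_num

/-- If all of `j + 2` parties hold the same values, the two amplitudes cancel. -/
theorem amplitude_pow (j : ℕ) (a b c : Fin 2) :
    amplitude j a b (c + 1) ^ (j + 2) = -amplitude j a b c ^ (j + 2) := by
  suffices h : amplitude j a b 1 ^ (j + 2) = -amplitude j a b 0 ^ (j + 2) by
    fin_cases c
    · exact h
    · have := congrArg Neg.neg h
      rw [neg_neg] at this
      exact this.symm
  have e₁ := exp_pow_half_turn (show j + 2 ≠ 0 by omega)
  have e₂ := exp_neg_pow_half_turn (show j + 2 ≠ 0 by omega)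
  by_cases hj : Even (j + 2)
  · simp only [amplitude, if_pos hj]
    fin_cases a
    · simp [matU, mul_pow] at e₂ ⊢
      rw [e₂]; ring
    -- In the second row of `U_k` the sign of the entry disappears because `k` is even; the phase
    -- alone yields `-1`.
    · simp [matU, mul_pow, hj.neg_pow] at e₁ ⊢
      rw [e₁]; ring
  · have hj' := Nat.not_even_iff_odd.1 hj
    -- After the copy to `R_1` only the columns `00` and `11` of `V_k` occur, that is, the first and
    -- the last.
    have hf : ∀ a b : Fin 2, (finProdFinEquiv (a, b) : Fin 4) =
      ![![0, 1], ![2, 3]] a b := by decide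
    simp only [amplitude, if_neg hj, hf]
    fin_cases a <;> fin_cases b
    · simp [matV, mul_pow, div_pow] at e₁ ⊢
      rw [e₁]; ring
    · simp [matV, mul_pow, div_pow] at e₂ ⊢
      rw [e₂]; ring
    -- In the row `10` the two entries are opposite, so the odd exponent supplies the sign; in the
    -- row `11` both entries vanish.
    · simp [matV, mul_pow, hj'.neg_pow]
    · simp [matV]

end AlgorithmI

end QNet

/-! ### Kraus operators of Subroutine B and of the measurements -/

namespace QNet

namespace AlgorithmI

section Kraus

variable {m d : ℕ}

theorem act_gate2_apply {A C Q : Type} [DecidableEq A] [DecidableEq C] [DecidableEq Q] [Fintype Q]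
    (U : Matrix.unitaryGroup (Fin 4) ℂ) (q r : Q) (h : q ≠ r) (o : Fin 2) (m : C → A)
    (x y : Q → Fin 2) :
    ((Instr.gate2 U q r h : Instr A C Q).act o m).2 x y =
      (U : Matrix (Fin 4) (Fin 4) ℂ) (finProdFinEquiv (x q, x r)) (finProdFinEquiv (y q, y r)) *
        if o = 0 ∧ ∀ p, p ≠ q → p ≠ r → x p = y p then 1 else 0 := by
  by_cases ho : o = 0
  · simp [Instr.act, ho]
  · simp [Instr.act, ho]

theorem act_gate1_apply {A C Q : Type} [DecidableEq A] [DecidableEq C] [DecidableEq Q] [Fintype Q]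
    (U : Matrix.unitaryGroup (Fin 2) ℂ) (q : Q) (o : Fin 2) (m : C → A) (x y : Q → Fin 2) :
    ((Instr.gate1 U q : Instr A C Q).act o m).2 x y =
      (U : Matrix (Fin 2) (Fin 2) ℂ) (x q) (y q) *
        if o = 0 ∧ ∀ p, p ≠ q → x p = y p then 1 else 0 := by
  by_cases ho : o = 0
  · simp [Instr.act, ho]
  · simp [Instr.act, ho]

theorem mul_copy {A C Q : Type} [DecidableEq A] [DecidableEq C] [DecidableEq Q] [Fintype Q]
    (M : Matrix (Q → Fin 2) (Q → Fin 2) ℂ) (q t : Q) (h : q ≠ t) (o : Fin 2) (m : C → A)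
    (x y : Q → Fin 2) :
    (M * ((Instr.toggle (fun a _ => a) q q t h h : Instr A C Q).act o m).2) x y =
      if o = 0 then M x (Function.update y t (y t + y q)) else 0 :=
  mul_labelled_graph (P := fun _ => o = 0) (g := fun y => Function.update y t (y t + y q))
    (fun x y => by by_cases ho : o = 0 <;> simp [Instr.act, ho]) x y

/-- The operators of Subroutine B for an eligible party when `R_1` is prepared. -/
theorem outcome_subroutineB {j : ℕ} {mem : C d → Val} (hs : mem (var .s) = consistent)
    (he : mem (var .status) = eligible) {r}
    (h : Instr.Outcome ((subroutineB j m d).map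
      fun a => .guard (var .s) consistent (ifStatus eligible a)) mem r) :
    r.1 = mem ∧ ∃ κ : (Q m d → Fin 2) → (Q m d → Fin 2) → ℂ,
      (∀ x y, y R1 = 0 → r.2 x y = amplitude j (x R0) (x R1) (y R0) * κ x y) ∧
      ∀ x y, κ x (negate R0 y) = κ x y := by
  have hg : ∀ (a : Ins m d) o, (Instr.guard (var .s) consistent (ifStatus eligible a)).act o mem =
      a.act o mem := fun a o => by
    rw [Instr.act_guard_of_eq hs, ifStatus, Instr.act_guard_of_eq he]
  by_cases hj : Even (j + 2)
  · simp only [subroutineB, dif_pos hj, List.map_cons, List.map_nil, Instr.outcome_cons,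
      Instr.outcome_nil, hg] at h
    obtain ⟨o, _, rfl, rfl⟩ := h
    refine ⟨rfl, fun x y => if o = 0 ∧ ∀ p, p ≠ R0 → x p = y p then 1 else 0, fun x y _ => ?_,
      fun x y => ?_⟩
    · simp only [one_mul, act_gate1_apply, amplitude, if_pos hj]
    · refine if_congr (and_congr_right fun _ => forall₂_congr fun p hp => ?_) rfl rfl
      rw [negate_of_ne hp]
  · simp only [subroutineB, dif_neg hj, List.map_cons, List.map_nil, Instr.outcome_cons,
      hg, copy] at h
    obtain ⟨o, r', ⟨o', r'', h, rfl⟩, rfl⟩ := h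
    rw [show ((Instr.toggle (fun a _ => a) R0 R0 R1 (by simp) (by simp) : Ins m d).act o mem).1 =
      mem from rfl, hg] at h
    rw [show ((Instr.toggle (fun a _ => a) R0 R0 R1 (by simp) (by simp) : Ins m d).act o mem).1 =
      mem from rfl, hg]
    obtain rfl := Instr.outcome_nil.1 h
    refine ⟨rfl, fun x y => if o = 0 then
      if o' = 0 ∧ ∀ p, p ≠ R0 → p ≠ R1 → x p = y p then 1 else 0 else 0, fun x y hy => ?_,
      fun x y => ?_⟩
    · dsimp only
      rw [mul_copy, one_mul, act_gate2_apply, hy, zero_add, Function.update_self,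
        Function.update_of_ne (by simp), amplitude, if_neg hj, mul_ite (o = 0), mul_zero]
      refine if_congr Iff.rfl (congrArg _ ?_) rfl
      refine if_congr (and_congr_right fun _ => forall₃_congr fun p hp hp' => ?_) rfl rfl
      rw [Function.update_of_ne hp']
    · refine if_congr Iff.rfl ?_ rfl
      refine if_congr (and_congr_right fun _ => forall₃_congr fun p hp hp' => ?_) rfl rfl
      rw [negate_of_ne hp]

/-- The instructions of a phase that follow Subroutine A. -/
noncomputable def measureConsistency (j m d : ℕ) : List (Ins m d) :=
  [.measure S (var .s) ![consistent, inconsistent],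
    .guard (var .s) consistent (ifStatus eligible (.prepare R1))] ++
  (subroutineB j m d).map (fun a => .guard (var .s) consistent (ifStatus eligible a)) ++
  [.guard (var .s) inconsistent (.prepare R1)]

theorem consistent_ne_inconsistent : consistent ≠ inconsistent := by decide

/-- The outcome `o` is the content of `S`. For "consistent", an eligible party's operator factors so
that the old content of `R_0` enters only through `amplitude`; the cofactor `κ` is blind to its
negation, which is what the cancellation requires. For "inconsistent", `R_0` is not altered. -/
theorem outcome_measureConsistency {j : ℕ} {mem : C d → Val} {r}
    (h : Instr.Outcome (measureConsistency j m d) mem r) :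
    ∃ o : Fin 2, r.1 = Function.update mem (var .s) (![consistent, inconsistent] o) ∧
      (∀ x y, r.2 x y ≠ 0 → y S = o) ∧
      (o = 1 → ∀ x y, r.2 x y ≠ 0 → x R0 = y R0 ∧ x R1 = 0) ∧
      (o = 0 → mem (var .status) = eligible → ∃ κ : (Q m d → Fin 2) → (Q m d → Fin 2) → ℂ,
        (∀ x y, r.2 x y = amplitude j (x R0) (x R1) (y R0) * κ x y) ∧
        ∀ x y, κ x (negate R0 y) = κ x y) := by
  rw [measureConsistency, List.append_assoc, List.cons_append, Instr.outcome_cons] at h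
  obtain ⟨o, r₁, h₁, rfl⟩ := h
  obtain ⟨mem', hmem'⟩ : ∃ mem' : C d → Val,
    mem' = Function.update mem (var .s) (![consistent, inconsistent] o) := ⟨_, rfl⟩
  rw [show ((Instr.measure S (var .s) ![consistent, inconsistent] : Ins m d).act o mem).1 = mem'
    from hmem'.symm] at h₁
  have hs : mem' (var .s) = ![consistent, inconsistent] o := by simp [hmem']
  have hst : mem' (var .status) = mem (var .status) := by simp [hmem']
  refine ⟨o, ?_⟩
  rw [← hmem']
  simp only [mul_measure]
  have hS : ∀ x y : Q m d → Fin 2, (if y S = o then r₁.2 x y else 0) ≠ 0 → y S = o :=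
    fun x y hxy => by
      by_contra h
      exact hxy (if_neg h)
  have hor : o = 0 ∨ o = 1 := by revert o; simp [Fin.forall_fin_two]
  rw [List.cons_append, List.nil_append, Instr.outcome_cons] at h₁
  obtain ⟨o₁, r₂, h₂, rfl⟩ := h₁
  rcases hor with rfl | rfl
  · replace hs : mem' (var .s) = consistent := hs
    -- The memory is left variable because it arises as the memory produced by the preceding
    -- instructions, equal to `mem'` only by a proof.
    have hidle : ∀ mem'' , mem'' = mem' →
        ∀ a ∈ [(.guard (var .s) inconsistent (.prepare R1) : Ins m d)],
        ∀ o, a.act o mem'' = (mem'', if o = 0 then 1 else 0) := by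
      rintro _ rfl a ha o
      obtain rfl := List.mem_singleton.1 ha
      exact Instr.act_guard_of_ne (by rw [hs]; exact consistent_ne_inconsistent) _ _
    by_cases he : mem (var .status) = eligible
    · have he' := hst.trans he
      rw [Instr.act_guard_of_eq hs, ifStatus, Instr.act_guard_of_eq he', Instr.act_prepare_fst,
        Instr.outcome_append] at h₂
      obtain ⟨r₃, r₄, h₃, h₄, rfl⟩ := h₂
      obtain ⟨h₅, κ, hκ, hκ'⟩ := outcome_subroutineB hs he' h₃
      obtain ⟨h₆, h₇⟩ := Instr.outcome_of_idle (hidle _ h₅) h₄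
      refine ⟨h₆.trans h₅, hS, fun h => absurd h (by simp), fun _ _ => ?_⟩
      rw [Instr.act_guard_of_eq hs, ifStatus, Instr.act_guard_of_eq he']
      simp only [mul_prepare]
      rcases h₇ with h₇ | h₇
      · exact ⟨fun _ _ => 0, fun x y => by simp [h₇], fun _ _ => rfl⟩
      -- The cofactor of Subroutine B, restricted to the measured content of `S` and the discarded
      -- content `o₁` of `R_1`.
      · refine ⟨fun x y => if y S = 0 then if y R1 = o₁ then κ x (Function.update y R1 0) else 0
          else 0, fun x y => ?_, fun x y => ?_⟩
        · rw [h₇, one_mul, hκ x _ (by simp), Function.update_of_ne (by simp)]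
          by_cases h1 : y S = 0 <;> by_cases h2 : y R1 = o₁ <;> simp [h1, h2]
        · dsimp only
          rw [negate_of_ne (p := R0) (q := S) (by simp),
            negate_of_ne (p := R0) (q := R1) (by simp), ← hκ' x (Function.update y R1 0)]
          have : Function.update (negate R0 y) R1 0 =
              (negate R0 (Function.update y R1 0) : Q m d → Fin 2) := by
            unfold negate
            rw [Function.update_comm (by simp), Function.update_of_ne (by simp)]
          rw [this]
    · have hidle' : ∀ a ∈ (subroutineB j m d).map
          (fun a => Instr.guard (var .s) consistent (ifStatus eligible a)),
          ∀ o, a.act o mem' = (mem', if o = 0 then 1 else 0) := by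
        intro a ha o
        obtain ⟨a, -, rfl⟩ := List.mem_map.1 ha
        rw [Instr.act_guard_of_eq hs, ifStatus, Instr.act_guard_of_ne (by rwa [hst])]
      rw [Instr.act_guard_of_eq hs, ifStatus, Instr.act_guard_of_ne (by rwa [hst]),
        Instr.outcome_append] at h₂
      obtain ⟨r₃, r₄, h₃, h₄, rfl⟩ := h₂
      obtain ⟨h₅, -⟩ := Instr.outcome_of_idle hidle' h₃
      obtain ⟨h₆, -⟩ := Instr.outcome_of_idle (hidle _ h₅) h₄
      exact ⟨h₆.trans h₅, hS, fun h => absurd h (by simp), fun _ h => absurd h he⟩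
  · replace hs : mem' (var .s) = inconsistent := hs
    have hne : mem' (var .s) ≠ consistent := by
      rw [hs]; exact consistent_ne_inconsistent.symm
    have hidle : ∀ a ∈ (subroutineB j m d).map
        (fun a => Instr.guard (var .s) consistent (ifStatus eligible a)),
        ∀ o, a.act o mem' = (mem', if o = 0 then 1 else 0) := by
      intro a ha o
      obtain ⟨a, -, rfl⟩ := List.mem_map.1 ha
      exact Instr.act_guard_of_ne hne _ _
    rw [Instr.act_guard_of_ne hne, Instr.outcome_append] at h₂
    obtain ⟨r₃, r₄, h₃, h₄, rfl⟩ := h₂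
    obtain ⟨h₅, h₆⟩ := Instr.outcome_of_idle hidle h₃
    obtain ⟨o₂, r₅, h₇, rfl⟩ := Instr.outcome_cons.1 h₄
    obtain rfl := Instr.outcome_nil.1 h₇
    rw [h₅, Instr.act_guard_of_eq hs]
    refine ⟨rfl, fun x y hxy => by_contra fun h => hxy (if_neg h), fun _ x y hxy => ?_,
      fun h => absurd h (by simp)⟩
    rw [Instr.act_guard_of_ne hne] at hxy
    have hxu : x = Function.update y R1 0 := by
      by_contra hc
      refine hxy ?_
      rcases h₆ with h₆ | h₆ <;> by_cases ho : o₁ = 0 <;> simp [h₆, ho, Instr.act, hc]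
    simp [hxu]

/-- The value of `z` for the results `a`, `b` of the measurement of `R_0`, `R_1`. -/
def vote (a b : Fin 2) : Val :=
  (![((0 : Fin 4) : Val), ((2 : Fin 4) : Val)] a) + ![((0 : Fin 4) : Val), ((1 : Fin 4) : Val)] b

theorem vote_ne_bot (a b : Fin 2) : vote a b ≠ ⊥ := by
  revert a b; decide

theorem vote_injective {a b a' b' : Fin 2} (h : vote a b = vote a' b') : a = a' ∧ b = b' := by
  revert a b a' b'; decide

theorem eligible_ne_ineligible : eligible ≠ ineligible := by decide

/-- The instructions that determine `z`. -/
def measureVote (m d : ℕ) : List (Ins m d) :=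
  [ifStatus eligible (.measure R0 (var .z0) ![((0 : Fin 4) : Val), ((2 : Fin 4) : Val)]),
    ifStatus eligible (.measure R1 (var .z1) ![((0 : Fin 4) : Val), ((1 : Fin 4) : Val)]),
    ifStatus eligible (.assign (var .z) (fun a b => a + b) (var .z0) (var .z1)),
    ifStatus ineligible (.assign (var .z) (fun _ _ => ⊥) (var .z) (var .z))]

/-- Measurements in the computational basis are diagonal, so a surviving basis state is unchanged
and its contents are the recorded results. -/
theorem outcome_measureVote {mem : C d → Val} {r} (h : Instr.Outcome (measureVote m d) mem r) :
    r.1 (var .status) = mem (var .status) ∧ (∀ x y, r.2 x y ≠ 0 → x = y) ∧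
      (mem (var .status) = eligible → ∀ x y, r.2 x y ≠ 0 →
        r.1 (var .z) = vote (x R0) (x R1)) ∧
      (mem (var .status) = ineligible → r.1 (var .z) = ⊥) := by
  have hM : ∀ v g (q : Q m d) o mem',
      ((Instr.measure q (var v) g : Ins m d).act o mem').1 = Function.update mem' (var v) (g o) :=
    fun _ _ _ _ _ => rfl
  have hA : ∀ v f w w' o mem', (Instr.assign (var v) f (var w) (var w') : Ins m d).act o mem' =
      (Function.update mem' (var v) (f (mem' (var w)) (mem' (var w'))), if o = 0 then 1 else 0) :=
    fun _ _ _ _ _ _ => rfl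
  have hne := eligible_ne_ineligible
  obtain ⟨o₁, r₁, h₁, rfl⟩ := Instr.outcome_cons.1 h
  obtain ⟨o₂, r₂, h₂, rfl⟩ := Instr.outcome_cons.1 h₁
  obtain ⟨o₃, r₃, h₃, rfl⟩ := Instr.outcome_cons.1 h₂
  obtain ⟨o₄, r₄, h₄, rfl⟩ := Instr.outcome_cons.1 h₃
  obtain rfl := Instr.outcome_nil.1 h₄
  clear h h₁ h₂ h₃ h₄
  by_cases he : mem (var .status) = eligible
  · have hi : mem (var .status) ≠ ineligible := by rw [he]; exact hne
    dsimp only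
    simp only [ifStatus]
    obtain ⟨m₁, hm₁⟩ : ∃ m₁, m₁ = Function.update mem (var .z0)
      (![((0 : Fin 4) : Val), ((2 : Fin 4) : Val)] o₁) := ⟨_, rfl⟩
    obtain ⟨m₂, hm₂⟩ : ∃ m₂, m₂ = Function.update m₁ (var .z1)
      (![((0 : Fin 4) : Val), ((1 : Fin 4) : Val)] o₂) := ⟨_, rfl⟩
    obtain ⟨m₃, hm₃⟩ : ∃ m₃, m₃ = Function.update m₂ (var .z)
      (m₂ (var .z0) + m₂ (var .z1)) := ⟨_, rfl⟩
    rw [Instr.act_guard_of_eq he, hM, ← hm₁,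
      Instr.act_guard_of_eq (m := m₁) (by simpa [hm₁] using he), hM, ← hm₂,
      Instr.act_guard_of_eq (m := m₂) (by simpa [hm₁, hm₂] using he), hA, ← hm₃]
    dsimp only
    rw [Instr.act_guard_of_ne (m := m₃) (by simpa [hm₁, hm₂, hm₃] using hi)]
    refine ⟨by simp [hm₁, hm₂, hm₃], fun x y hxy => ?_, fun _ x y hxy => ?_,
      fun h => absurd h hi⟩
    · rw [mul_measure, mul_measure] at hxy
      by_contra hc
      refine hxy ?_
      by_cases h3 : o₃ = 0 <;> by_cases h4 : o₄ = 0 <;> simp [h3, h4, hc]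
    · rw [mul_measure, mul_measure] at hxy
      have h1 := (ite_ne_right_iff.1 hxy)
      have h2 := (ite_ne_right_iff.1 h1.2)
      have h5 : x = y := by
        by_contra hc
        refine h2.2 ?_
        by_cases h3 : o₃ = 0 <;> by_cases h4 : o₄ = 0 <;> simp [h3, h4, hc]
      rw [h5, h1.1, h2.1]
      simp [vote, hm₁, hm₂, hm₃]
  · simp only [ifStatus]
    rw [Instr.act_guard_of_ne he, Instr.act_guard_of_ne he, Instr.act_guard_of_ne he]
    have hdiag : ∀ x y (M : Matrix (Q m d → Fin 2) (Q m d → Fin 2) ℂ), (M = 0 ∨ M = 1) →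
        (((1 * M * if o₃ = 0 then 1 else 0) * if o₂ = 0 then 1 else 0) *
          if o₁ = 0 then 1 else 0 : Matrix (Q m d → Fin 2) (Q m d → Fin 2) ℂ) x y ≠ 0 → x = y := by
      intro x y M hM hxy
      by_contra hc
      refine hxy ?_
      rcases hM with rfl | rfl <;>
      by_cases h1 : o₁ = 0 <;> by_cases h2 : o₂ = 0 <;> by_cases h3 : o₃ = 0 <;>
        simp [h1, h2, h3, hc]
    by_cases hi : mem (var .status) = ineligible
    · rw [Instr.act_guard_of_eq hi, hA]
      exact ⟨by simp, fun x y => hdiag x y _ (by split_ifs <;> simp), fun h => absurd h he,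
        fun _ => by simp⟩
    · rw [Instr.act_guard_of_ne hi]
      exact ⟨by simp, fun x y => hdiag x y _ (by split_ifs <;> simp), fun h => absurd h he,
        fun h => absurd h hi⟩

end Kraus

end AlgorithmI

end QNet

namespace QNet

/-- Traces a basis state of nonzero amplitude back to one before the step, from which every party's
operator leads to it. -/
theorem exists_of_amp_ne_zero {V : Type*} [Fintype V] {B : V → Type*}
    [Fintype ((v : V) → B v)] {K : (v : V) → Matrix (B v) (B v) ℂ}
    {φ φ' : ((v : V) → B v) → ℂ} (h : ∀ x, φ' x = ∑ y, (∏ v, K v (x v) (y v)) * φ y)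
    {x : (v : V) → B v} (hx : φ' x ≠ 0) : ∃ y, φ y ≠ 0 ∧ ∀ v, K v (x v) (y v) ≠ 0 := by
  rw [h] at hx
  obtain ⟨y, -, hy⟩ := Finset.exists_ne_zero_of_sum_ne_zero hx
  exact ⟨y, right_ne_zero_of_mul hy, fun v =>
    Finset.prod_ne_zero_iff.1 (left_ne_zero_of_mul hy) v (Finset.mem_univ v)⟩

namespace AlgorithmI

variable {m : ℕ} {V : Type*} [Fintype V] {G : SimpleGraph V} [DecidableRel G.Adj] [DecidableEq V]

/-! ## The state of the network during a phase -/

theorem sum_flipR0 (mem : NetMem G) (f : NetBasis G m → ℂ) :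
    ∑ x, f (flipR0 mem x) = ∑ x, f x :=
  Equiv.sum_comp (⟨flipR0 mem, flipR0 mem, flipR0_flipR0 mem, flipR0_flipR0 mem⟩ :
    Equiv.Perm (NetBasis G m)) f

omit [DecidableEq V] in
theorem flipR0_eq (mem : NetMem G) (x : NetBasis G m) (v : V) :
    flipR0 mem x v = if Eligible mem v then negate R0 (x v) else x v := rfl

/-- The operation that starts a phase. -/
noncomputable def initPhase (m d : ℕ) : List (Ins m d) :=
  [.prepare R0, ifStatus eligible (.gate1 ⟨matH, matH_mem⟩ R0), .prepare S]

/-- The first step makes the joint operator invariant under flipping the output, whatever the input.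
The preparation of the `X` registers commutes with the flip, so reindexing its sum carries the
symmetry over. -/
theorem prepared_of_next {σ : PortNumbering G} {c c₁ c₂ : NetConfig G m}
    (h₁ : c₁ ∈ (Step.compute (initPhase m)).next σ c)
    (h₂ : c₂ ∈ (Step.compute (prepareX m)).next σ c₁) :
    c₂.mem = c.mem ∧ Prepared c₂ := by
  obtain ⟨r, hr, hm, ha⟩ := Step.mem_next_compute h₁
  obtain ⟨s, hs, hm', ha'⟩ := Step.mem_next_compute h₂
  have hr' := fun v => outcome_init (hr v)
  have hs' := fun v => outcome_prepareX (hs v)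
  have e₁ : c₁.mem = c.mem := funext fun v => (hm v).trans (hr' v).1
  have e₂ : c₂.mem = c.mem := (funext fun v => (hm' v).trans (hs' v).1 : c₂.mem = c₁.mem).trans e₁
  have f₁ : ∀ x, c₁.amp (flipR0 c.mem x) = c₁.amp x := fun x => by
    rw [ha, ha]
    refine Finset.sum_congr rfl fun y _ => ?_
    congr 1
    refine Finset.prod_congr rfl fun v _ => ?_
    rw [flipR0_eq]
    split_ifs with h
    · exact (hr' v).2.2 h _ _
    · rfl
  refine ⟨e₂, fun x => ?_, fun x hx v => ?_, fun x hx v => ?_⟩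
  · rw [e₂, ha', ha', ← sum_flipR0 c.mem]
    refine Finset.sum_congr rfl fun y _ => ?_
    rw [f₁]
    congr 1
    refine Finset.prod_congr rfl fun v _ => ?_
    rw [flipR0_eq, flipR0_eq]
    split_ifs with h
    · exact (hs' v).2.1 _ _
    · rfl
  · obtain ⟨y, hy, hK⟩ := exists_of_amp_ne_zero ha' hx
    obtain ⟨z, -, hK'⟩ := exists_of_amp_ne_zero ha hy
    rw [((hs' v).2.2 _ _ (hK v)).1]
    exact (hr' v).2.1 _ _ (hK' v)
  · obtain ⟨y, -, hK⟩ := exists_of_amp_ne_zero ha' hx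
    exact ((hs' v).2.2 _ _ (hK v)).2

/-- Not all eligible parties are going to obtain the same result. -/
def Separated (mem : NetMem G) (x : NetBasis G m) : Prop :=
  ¬∃ a b, ∀ v, Eligible mem v → x v R0 = a ∧ x v R1 = b

/-- The number of eligible parties. -/
def numEligible (mem : NetMem G) : ℕ := (Finset.univ.filter (Eligible mem)).card

omit [DecidableEq V] in
theorem prod_kernel_eq {mem : NetMem G} {f : V → ℂ} {w : ℂ} {κ : V → ℂ}
    (h : ∀ v, f v = (if Eligible mem v then w else 1) * κ v) :
    ∏ v, f v = w ^ numEligible mem * ∏ v, κ v := by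
  simp only [h, Finset.prod_mul_distrib, Finset.prod_ite, Finset.prod_const, one_pow, mul_one,
    numEligible]

/-- Suppose a surviving basis state gives all eligible parties the same pair `(a, b)`. A mixed
origin is impossible, since then `R_0` keeps its different contents. Otherwise `flipR0` pairs the
terms of the amplitude so that each term is the negative of its partner, and the amplitude is zero.
-/
theorem separated_of_next {σ : PortNumbering G} {j : ℕ} {c c' : NetConfig G m} (hc : Checked c)
    (h : c' ∈ (Step.compute (measureConsistency j m)).next σ c) :
    (∀ v, c'.mem v (var .status) = c.mem v (var .status)) ∧
      (numEligible c.mem = j + 2 → ∀ x, c'.amp x ≠ 0 → Separated c.mem x) := by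
  obtain ⟨r, hr, hm, ha⟩ := Step.mem_next_compute h
  choose o ho hS h1 h0 using fun v => outcome_measureConsistency (hr v)
  refine ⟨fun v => by rw [hm, ho]; simp, ?_⟩
  rintro hcard x hx ⟨a, b, hab⟩
  obtain ⟨v₀, hv₀⟩ : ∃ v, Eligible c.mem v := by
    by_contra hne
    push Not at hne
    simp [numEligible, hne] at hcard
  obtain ⟨y, hy, hK⟩ := exists_of_amp_ne_zero ha hx
  -- A single predecessor `y` fixes the results of all parties, so they agree.
  have hoy : ∀ v, o v = mixedBit c.mem y := fun v => by
    rw [← hc.check y hy v, hS v _ _ (hK v)]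
  by_cases hmix : Mixed c.mem y
  · have ho1 : ∀ v, o v = 1 := fun v => by rw [hoy, mixedBit, if_pos hmix]
    -- Some eligible `u` held the value other than `a`, and in this case `R_0` is not changed.
    obtain ⟨u, hu, hu0⟩ := hmix (a + 1)
    have := (h1 u (ho1 u) _ _ (hK u)).1
    rw [(hab u hu).1, hu0] at this
    revert this
    generalize a = a'
    revert a'
    decide
  · have ho0 : ∀ v, o v = 0 := fun v => by rw [hoy, mixedBit, if_neg hmix]
    -- The predecessor was needed only to determine the results; from now on all `y` in the sum
    -- matter.
    clear! y
    have hκ : ∀ v, ∃ κ : (Q m (G.degree v) → Fin 2) → ℂ,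
        (∀ y, (r v).2 (x v) y =
          (if Eligible c.mem v then amplitude j a b (y R0) else 1) * κ y) ∧
        (Eligible c.mem v → ∀ y, κ (negate R0 y) = κ y) := fun v => by
      by_cases hv : Eligible c.mem v
      · obtain ⟨κ, hκ, hκ'⟩ := h0 v (ho0 v) hv
        refine ⟨κ (x v), fun y => ?_, fun _ => hκ' (x v)⟩
        rw [hκ, if_pos hv, (hab v hv).1, (hab v hv).2]
      · exact ⟨(r v).2 (x v), fun y => by rw [if_neg hv, one_mul], fun h => absurd h hv⟩
    choose κ hκ hκ' using hκ
    have hprod : ∀ y : NetBasis G m, ∀ e, (∀ v, Eligible c.mem v → y v R0 = e) →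
        ∏ v, (r v).2 (x v) (y v) = amplitude j a b e ^ (j + 2) * ∏ v, κ v (y v) := by
      intro y e he
      rw [← hcard]
      refine prod_kernel_eq fun v => ?_
      rw [hκ]
      split_ifs with hv
      · rw [he v hv]
      · rfl
    have hterm : ∀ y, (∏ v, (r v).2 (x v) (flipR0 c.mem y v)) * c.amp (flipR0 c.mem y) =
        -((∏ v, (r v).2 (x v) (y v)) * c.amp y) := by
      intro y
      rw [hc.flip]
      by_cases hy : c.amp y = 0
      · simp [hy]
      by_cases hys : y v₀ S = 0
      · have hmix : ¬Mixed c.mem y := fun hM => by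
          have := hc.check y hy v₀
          rw [hys, mixedBit, if_pos hM] at this
          exact absurd this (by simp)
        simp only [Mixed, not_forall, not_exists, not_and] at hmix
        -- No eligible party holds `e`, so all of them hold `e + 1`, and `e` after the flip.
        obtain ⟨e, he⟩ := hmix
        have two : ∀ a e : Fin 2, a ≠ e → a = e + 1 := by decide
        have he' : ∀ v, Eligible c.mem v → y v R0 = e + 1 := fun v hv => two _ _ (he v hv)
        have hf : ∀ v, Eligible c.mem v → flipR0 c.mem y v R0 = e := fun v hv => by
          rw [flipR0_of_eligible y hv, he' v hv, two_add_self]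
        have hκf : ∏ v, κ v (flipR0 c.mem y v) = ∏ v, κ v (y v) :=
          Finset.prod_congr rfl fun v _ => by
            rw [flipR0_eq]
            split_ifs with hv
            · exact hκ' v hv _
            · rfl
        rw [hprod y _ he', hprod _ _ hf, hκf, amplitude_pow]
        ring
      -- If `S` at `v₀` contradicts the measured `0`, the projection at `v₀` kills both terms of the
      -- pair.
      · have hz : ∀ z : NetBasis G m, z v₀ S = y v₀ S → ∏ v, (r v).2 (x v) (z v) = 0 := by
          intro z hz
          refine Finset.prod_eq_zero (Finset.mem_univ v₀) ?_
          by_contra hne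
          exact hys (by rw [← hz, hS v₀ _ _ hne, ho0])
        rw [hz y rfl, hz _ (flipR0_of_ne _ _ _ (by simp))]
        simp
    refine hx ?_
    rw [ha]
    -- Reindexing by `flipR0` shows that the amplitude equals its own negative.
    refine self_eq_neg.1 ?_
    rw [← Finset.sum_neg_distrib, ← sum_flipR0 c.mem]
    exact Finset.sum_congr rfl fun y _ => hterm y

/-- The classical memories when all parties know their `z`. -/
structure Voted (k : ℕ) (mem : NetMem G) : Prop where
  status : ∀ v, Eligible mem v ∨ mem v (var .status) = ineligible
  pos : 0 < numEligible mem
  le : numEligible mem ≤ k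
  eligible : ∀ v, Eligible mem v → mem v (var .z) ≠ ⊥
  ineligible : ∀ v, ¬Eligible mem v → mem v (var .z) = ⊥
  separated : numEligible mem = k →
    ∃ u v, Eligible mem u ∧ Eligible mem v ∧ mem u (var .z) ≠ mem v (var .z)

/-- At most `k` parties are eligible, and at least one. -/
structure Remaining (k : ℕ) (mem : NetMem G) : Prop where
  status : ∀ v, Eligible mem v ∨ mem v (var .status) = ineligible
  pos : 0 < numEligible mem
  le : numEligible mem ≤ k

omit [DecidableEq V] in
theorem eligible_congr {mem mem' : NetMem G}
    (h : ∀ v, mem' v (var .status) = mem v (var .status)) (v : V) :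
    Eligible mem' v ↔ Eligible mem v := by
  unfold Eligible
  rw [h]

omit [DecidableEq V] in
theorem numEligible_congr {mem mem' : NetMem G}
    (h : ∀ v, mem' v (var .status) = mem v (var .status)) :
    numEligible mem' = numEligible mem := by
  simp only [numEligible, eligible_congr h]

omit [DecidableEq V] in
theorem Remaining.congr {k : ℕ} {mem mem' : NetMem G} (hm : Remaining k mem)
    (h : ∀ v, mem' v (var .status) = mem v (var .status)) : Remaining k mem' := by
  refine ⟨fun v => ?_, ?_, ?_⟩
  · rw [eligible_congr h, h]; exact hm.status v
  · rw [numEligible_congr h]; exact hm.pos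
  · rw [numEligible_congr h]; exact hm.le

/-- Equal votes of all eligible parties would, since `vote` is injective, mean equal contents of
`R_0` and `R_1`, which `Separated` forbids. -/
theorem voted_of_next {σ : PortNumbering G} {k : ℕ} {c c' : NetConfig G m}
    (hc : Remaining k c.mem)
    (hsep : numEligible c.mem = k → ∀ x, c.amp x ≠ 0 → Separated c.mem x)
    (h : c' ∈ (Step.compute (measureVote m)).next σ c) (h0 : c'.amp ≠ 0) :
    Voted k c'.mem := by
  obtain ⟨r, hr, hm, ha⟩ := Step.mem_next_compute h
  have hr' := fun v => outcome_measureVote (hr v)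
  have hst : ∀ v, c'.mem v (var .status) = c.mem v (var .status) := fun v => by
    rw [hm]; exact (hr' v).1
  obtain ⟨x, hx⟩ := Function.ne_iff.1 h0
  obtain ⟨y, hy, hK⟩ := exists_of_amp_ne_zero ha hx
  have hxy : x = y := funext fun v => (hr' v).2.1 _ _ (hK v)
  have hz : ∀ v, Eligible c.mem v → c'.mem v (var .z) = vote (x v R0) (x v R1) := fun v hv => by
    rw [hm]
    exact (hr' v).2.2.1 hv _ _ (hK v)
  have hc' := hc.congr hst
  refine ⟨hc'.status, hc'.pos, hc'.le, fun v hv => ?_, fun v hv => ?_, fun hk => ?_⟩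
  · rw [hz v ((eligible_congr hst v).1 hv)]
    exact vote_ne_bot _ _
  · rw [eligible_congr hst] at hv
    rw [hm]
    exact (hr' v).2.2.2 ((hc.status v).resolve_left hv)
  · rw [numEligible_congr hst] at hk
    by_contra hne
    push Not at hne
    obtain ⟨v₀, hv₀⟩ := Finset.card_pos.1 hc.pos
    rw [Finset.mem_filter] at hv₀
    refine hsep hk y hy ⟨y v₀ R0, y v₀ R1, fun v hv => vote_injective ?_⟩
    rw [← hxy, ← hz v hv, ← hz v₀ hv₀.2]
    exact hne v v₀ ((eligible_congr hst v).2 hv) ((eligible_congr hst v₀).2 hv₀.2)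

end AlgorithmI

end QNet

namespace QNet

section Local

variable {A C Q : Type} [DecidableEq A] [DecidableEq C] [DecidableEq Q] [Fintype Q]

/-- Both formal outcomes of an assignment change the memory in the same way, so it may be computed
with outcome `0` throughout. -/
theorem Instr.outcome_fst {L : List (Instr A C Q)} {m : C → A}
    (hL : ∀ a ∈ L, ∃ x f y z, a = .assign x f y z) {r} (h : Instr.Outcome L m r) :
    r.1 = L.foldl (fun m a => (a.act 0 m).1) m := by
  induction L generalizing m r with
  | nil => rw [Instr.outcome_nil.1 h]; rfl
  | cons a L ih =>
    obtain ⟨o, r', h', rfl⟩ := Instr.outcome_cons.1 h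
    obtain ⟨x, f, y, z, rfl⟩ := hL a List.mem_cons_self
    exact ih (r := r') (fun a ha => hL a (List.mem_cons_of_mem _ ha)) h'

end Local

namespace AlgorithmI

/-! ## Subroutine C -/

section Local

variable {m d : ℕ}

/-- Copy `z_max` to all ports. -/
def sendMax (m d : ℕ) : List (Ins m d) :=
  .assign (var .y0) (fun a _ => a) (var .zmax) (var .zmax) ::
    (List.finRange d).map fun i => .assign (yPort i) (fun a _ => a) (var .y0) (var .y0)

/-- Replace `z_max` by the maximum of itself and the values received. -/
def receiveMax (m d : ℕ) : List (Ins m d) :=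
  .assign (var .zmax) (fun a _ => a) (var .y0) (var .y0) ::
    (List.finRange d).map fun i => .assign (var .zmax) max (var .zmax) (yPort i)

theorem foldl_sendMax (l : List (Fin d)) (mem : C d → Val) (q : C d) :
    (l.map fun i => (.assign (yPort i) (fun a _ => a) (var .y0) (var .y0) : Ins m d)).foldl
      (fun mem a => (a.act 0 mem).1) mem q =
      if ∃ i ∈ l, q = yPort i then mem (var .y0) else mem q := by
  induction l generalizing mem with
  | nil => simp
  | cons i l ih =>
    rw [List.map_cons, List.foldl_cons, ih]
    simp only [Instr.act, List.mem_cons, exists_eq_or_imp]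
    by_cases h : ∃ i ∈ l, q = yPort i
    · simp [h]
    · by_cases h' : q = yPort i
      · subst h'; simp
      · rw [if_neg h, if_neg (by simp only [h, h', or_self, not_false_iff]),
          Function.update_of_ne h']

theorem outcome_sendMax {mem : C d → Val} {r} (h : Instr.Outcome (sendMax m d) mem r) :
    r.1 (var .status) = mem (var .status) ∧ r.1 (var .z) = mem (var .z) ∧
      r.1 (var .y0) = mem (var .zmax) ∧ ∀ i, r.1 (yPort i) = mem (var .zmax) := by
  have := Instr.outcome_fst (by simp [sendMax]) h
  rw [this, sendMax, List.foldl_cons]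
  simp only [foldl_sendMax]
  simp [Instr.act]

/-- The maximum is described by the thresholds `w` below it, since `w ≤ max a b` is a disjunction.
Each threshold thus floods the network as a set, and `informed` serves for Subroutine C too. -/
theorem foldl_receiveMax (l : List (Fin d)) (mem : C d → Val) :
    (∀ q, q ≠ var .zmax →
      (l.map fun i => (.assign (var .zmax) max (var .zmax) (yPort i) : Ins m d)).foldl
        (fun mem a => (a.act 0 mem).1) mem q = mem q) ∧
    ∀ w, w ≤ (l.map fun i => (.assign (var .zmax) max (var .zmax) (yPort i) : Ins m d)).foldl
        (fun mem a => (a.act 0 mem).1) mem (var .zmax) ↔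
      w ≤ mem (var .zmax) ∨ ∃ i ∈ l, w ≤ mem (yPort i) := by
  induction l generalizing mem with
  | nil => simp
  | cons i l ih =>
    rw [List.map_cons, List.foldl_cons]
    obtain ⟨h₁, h₂⟩ := ih
      ((Instr.assign (var .zmax) max (var .zmax) (yPort i) : Ins m d).act 0 mem).1
    refine ⟨fun q hq => ?_, fun w => ?_⟩
    · rw [h₁ q hq]
      exact Function.update_of_ne hq _ _
    · rw [h₂]
      simp [Instr.act, or_assoc]

theorem outcome_receiveMax {mem : C d → Val} {r} (h : Instr.Outcome (receiveMax m d) mem r) :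
    r.1 (var .status) = mem (var .status) ∧ r.1 (var .z) = mem (var .z) ∧
      ∀ w, w ≤ r.1 (var .zmax) ↔ w ≤ mem (var .y0) ∨ ∃ i, w ≤ mem (yPort i) := by
  have := Instr.outcome_fst (by simp [receiveMax]) h
  rw [this, receiveMax, List.foldl_cons]
  obtain ⟨h₁, h₂⟩ := foldl_receiveMax (m := m) (List.finRange d)
    ((Instr.assign (var .zmax) (fun a _ => a) (var .y0) (var .y0) : Ins m d).act 0 mem).1
  refine ⟨(h₁ _ (by simp)).trans ?_, (h₁ _ (by simp)).trans ?_, fun w => (h₂ w).trans ?_⟩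
  all_goals simp [Instr.act]

/-- The last instructions of a phase. -/
def updateStatus (m d : ℕ) : List (Ins m d) :=
  [.assign (var .same) (fun a b => if a = b then ((1 : Fin 4) : Val) else ((0 : Fin 4) : Val))
      (var .z) (var .zmax),
    .guard (var .same) ((0 : Fin 4) : Val)
      (.assign (var .status) (fun _ _ => ineligible) (var .status) (var .status))]

theorem outcome_updateStatus {mem : C d → Val} {r} (h : Instr.Outcome (updateStatus m d) mem r) :
    r.1 (var .status) =
      if mem (var .z) = mem (var .zmax) then mem (var .status) else ineligible := by
  obtain ⟨o₁, r₁, h₁, rfl⟩ := Instr.outcome_cons.1 h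
  obtain ⟨o₂, r₂, h₂, rfl⟩ := Instr.outcome_cons.1 h₁
  obtain rfl := Instr.outcome_nil.1 h₂
  have h10 : ((1 : Fin 4) : Val) ≠ ((0 : Fin 4) : Val) := by decide
  by_cases hz : mem (var .z) = mem (var .zmax)
  · simp only [Instr.act, if_pos hz]
    rw [if_neg (by rw [Function.update_self]; exact h10)]
    simp
  · simp only [Instr.act, if_neg hz]
    rw [if_pos (by rw [Function.update_self])]
    simp

end Local

variable {m : ℕ} {V : Type*} [Fintype V] {G : SimpleGraph V} [DecidableRel G.Adj] [DecidableEq V]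

theorem subroutineC_eq (m : ℕ) : subroutineC m =
    [.compute fun _ => [.assign (var .zmax) (fun a _ => a) (var .z) (var .z)]] ++
      (List.finRange m).flatMap fun _ =>
        [.compute (sendMax m), .exchange ∅ {()}, .compute (receiveMax m)] := rfl

/-- The classical memories in Subroutine C after `t` rounds. -/
structure Flooded (M : NetMem G) (t : ℕ) (c : NetConfig G m) : Prop where
  status : ∀ v, c.mem v (var .status) = M v (var .status)
  z : ∀ v, c.mem v (var .z) = M v (var .z)
  zmax : ∀ v w, w ≤ c.mem v (var .zmax) ↔ informed G (fun u => w ≤ M u (var .z)) t v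

theorem Flooded.next {σ : PortNumbering G} {M : NetMem G} {t : ℕ} {c c₁ c₂ c₃ : NetConfig G m}
    (hc : Flooded M t c) (h₁ : c₁ ∈ (Step.compute (sendMax m)).next σ c)
    (h₂ : c₂ ∈ (Step.exchange ∅ {()}).next σ c₁)
    (h₃ : c₃ ∈ (Step.compute (receiveMax m)).next σ c₂) : Flooded M (t + 1) c₃ := by
  obtain ⟨r, hr, hm, -⟩ := Step.mem_next_compute h₁
  obtain ⟨s, hs, hm', -⟩ := Step.mem_next_compute h₃
  obtain rfl := Multiset.mem_singleton.1 h₂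
  have hr' := fun v => outcome_sendMax (hr v)
  have hs' := fun v => outcome_receiveMax (hs v)
  simp only [← hm] at hr'
  simp only [← hm'] at hs'
  have hl : ∀ v l, σ.swap {()} c₁.mem v (.inl l) = c₁.mem v (.inl l) := fun _ _ => rfl
  have hp : ∀ v i, σ.swap {()} c₁.mem v (yPort i) = c.mem (σ.far v i).1 (var .zmax) := fun v i => by
    rw [← (hr' _).2.2.2 (σ.far v i).2]
    simp [PortNumbering.swap]
  refine ⟨fun v => ?_, fun v => ?_, fun v w => ?_⟩
  · rw [(hs' v).1, hl, (hr' v).1, hc.status]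
  · rw [(hs' v).2.1, hl, (hr' v).2.1, hc.z]
  · rw [(hs' v).2.2, hl, (hr' v).2.2.1, hc.zmax]
    simp only [hp]
    refine or_congr_right ?_
    rw [σ.exists_far v fun u => w ≤ c.mem u (var .zmax)]
    simp only [hc.zmax]

theorem triple_subroutineC (σ : PortNumbering G) (M : NetMem G) :
    Triple σ (fun c => c.mem = M) (subroutineC m) (Flooded M m) := by
  rw [subroutineC_eq]
  refine Triple.append (q := Flooded M 0) ?_ (Triple.loop (Flooded M) fun t => ?_)
  · refine Triple.single fun c hc c' h _ => ?_
    obtain ⟨r, hr, hm, -⟩ := Step.mem_next_compute h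
    have hr' := fun v => Instr.outcome_fst (by simp) (hr v)
    have e : ∀ v, c'.mem v = Function.update (M v) (var .zmax) (M v (var .z)) := fun v => by
      rw [hm, hr', hc]; rfl
    exact ⟨fun v => by rw [e]; simp, fun v => by rw [e]; simp,
      fun v w => by rw [e]; simp [informed]⟩
  · intro c hc c' h _
    obtain ⟨c₁, h₁, h⟩ := Multiset.mem_bind.1 h
    obtain ⟨c₂, h₂, h⟩ := Multiset.mem_bind.1 h
    obtain ⟨c₃, h₃, h⟩ := Multiset.mem_bind.1 h
    obtain rfl := Multiset.mem_singleton.1 h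
    exact hc.next h₁ h₂ h₃

/-- All parties know the same maximum and some party attains it. The survivors are the eligible
parties that attain it; two different votes cannot both be maximal, so `k + 1` candidates do not all
survive. -/
theorem remaining_of_next (hG : G.Connected) (hm : Fintype.card V ≤ m + 1) {σ : PortNumbering G}
    {k : ℕ} {M : NetMem G} (hM : Voted (k + 1) M) {c c' : NetConfig G m} (hc : Flooded M m c)
    (h : c' ∈ (Step.compute (updateStatus m)).next σ c) : Remaining k c'.mem := by
  obtain ⟨r, hr, hm', -⟩ := Step.mem_next_compute h
  have hst : ∀ v, c'.mem v (var .status) =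
      if M v (var .z) = c.mem v (var .zmax) then M v (var .status) else ineligible := fun v => by
    rw [hm', outcome_updateStatus (hr v), hc.z, hc.status]
  have hmax : ∀ v w, w ≤ c.mem v (var .zmax) ↔ ∃ u, w ≤ M u (var .z) := fun v w => by
    rw [hc.zmax, informed_iff_exists hG hm]
  have heq : ∀ u v, c.mem u (var .zmax) = c.mem v (var .zmax) := fun u v =>
    eq_of_forall_le_iff fun w => by rw [hmax, hmax]
  have hle : ∀ u v, M u (var .z) ≤ c.mem v (var .zmax) := fun u v => (hmax v _).2 ⟨u, le_rfl⟩
  have hel : ∀ v, Eligible c'.mem v ↔ Eligible M v ∧ M v (var .z) = c.mem v (var .zmax) := by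
    intro v
    unfold Eligible
    rw [hst]
    split_ifs with h
    · simp [h]
    · simp [h, eligible_ne_ineligible.symm]
  obtain ⟨v₀, hv₀⟩ := Finset.card_pos.1 hM.pos
  rw [Finset.mem_filter] at hv₀
  obtain ⟨u, hu⟩ := (hmax v₀ _).1 le_rfl
  have hu' : M u (var .z) = c.mem u (var .zmax) :=
    (hle u u).antisymm ((heq u v₀).trans_le hu)
  -- An ineligible party holds `⊥`, but the maximum is at least the vote of `v₀`, which is not `⊥`.
  have hue : Eligible M u := by
    by_contra hne
    have h0 := hM.ineligible u hne
    refine hM.eligible v₀ hv₀.2 (le_bot_iff.1 ?_)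
    rw [← h0]
    exact (hle v₀ v₀).trans hu
  have hsub : Finset.univ.filter (Eligible c'.mem) ⊆ Finset.univ.filter (Eligible M) :=
    fun v hv => by
      rw [Finset.mem_filter] at hv ⊢
      exact ⟨hv.1, ((hel v).1 hv.2).1⟩
  refine ⟨fun v => ?_, Finset.card_pos.2 ⟨u, by simp [hel, hue, hu']⟩, ?_⟩
  · rw [hel, hst]
    rcases hM.status v with h | h
    · by_cases hz : M v (var .z) = c.mem v (var .zmax)
      · exact .inl ⟨h, hz⟩
      · exact .inr (if_neg hz)
    · right
      split_ifs
      exacts [h, rfl]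
  · by_cases hk : numEligible M = k + 1
    · obtain ⟨u, v, hu, hv, huv⟩ := hM.separated hk
      have : Finset.univ.filter (Eligible c'.mem) ⊂ Finset.univ.filter (Eligible M) := by
        refine hsub.ssubset_of_ne fun h => ?_
        have hmem : ∀ w, Eligible M w → Eligible c'.mem w := fun w hw => by
          have : w ∈ Finset.univ.filter (Eligible M) := by simp [hw]
          rw [← h] at this
          simpa using this
        refine huv ?_
        rw [((hel u).1 (hmem u hu)).2, ((hel v).1 (hmem v hv)).2, heq]
      have := Finset.card_lt_card this
      unfold numEligible at *
      omega
    · have h1 := Finset.card_le_card hsub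
      have h2 := hM.le
      unfold numEligible at *
      omega

/-! ## Correctness of the algorithm -/

theorem phase_eq (m j : ℕ) : phase m j =
    .compute (initPhase m) :: .compute (prepareX m) :: (checkConsistency m ++
      (.compute (measureConsistency j m) :: .compute (measureVote m) :: (subroutineC m ++
        [.compute (updateStatus m)]))) := by
  have h : phase m j = [.compute (initPhase m)] ++ subroutineA m ++
      [.compute (measureConsistency j m), .compute (measureVote m)] ++ subroutineC m ++
        [.compute (updateStatus m)] := rfl
  rw [h, subroutineA_eq]
  simp

theorem triple_phase (hG : G.Connected) (hm : Fintype.card V ≤ m + 1) (σ : PortNumbering G)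
    (j : ℕ) :
    Triple σ (fun c => Remaining (j + 2) c.mem) (phase m j)
      (fun c => Remaining (j + 1) c.mem) := by
  intro c hc c' h h0
  rw [phase_eq] at h
  obtain ⟨c₁, h₁, h⟩ := Multiset.mem_bind.1 h
  obtain ⟨c₂, h₂, h⟩ := Multiset.mem_bind.1 h
  rw [Program.branches_append] at h
  obtain ⟨c₃, h₃, h⟩ := Multiset.mem_bind.1 h
  have hc₃ : c₃.amp ≠ 0 := fun h' => h0 (Program.amp_eq_zero h h')
  obtain ⟨c₄, h₄, h⟩ := Multiset.mem_bind.1 h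
  obtain ⟨c₅, h₅, h⟩ := Multiset.mem_bind.1 h
  have hc₅ : c₅.amp ≠ 0 := fun h' => h0 (Program.amp_eq_zero h h')
  obtain ⟨e₂, p₂⟩ := prepared_of_next h₁ h₂
  obtain ⟨e₃, p₃⟩ := p₂.checked hG hm h₃ hc₃
  have hr₃ : Remaining (j + 2) c₃.mem := by rw [e₃, e₂]; exact hc
  obtain ⟨s₄, hs⟩ := separated_of_next p₃ h₄
  have hv := voted_of_next (hr₃.congr s₄) (fun hk x hx => by
    have := hs (by rwa [numEligible_congr s₄] at hk) x hx
    simpa only [Separated, eligible_congr s₄] using this) h₅ hc₅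
  -- The memory of this one branch is fixed as the reference, because Subroutine C is specified
  -- relative to the votes before it.
  refine (Triple.append (triple_subroutineC σ c₅.mem) (Triple.single ?_) :
    Triple σ (fun c => c.mem = c₅.mem) _ fun c => Remaining (j + 1) c.mem) c₅ rfl c' h h0
  intro d hd d' h' _
  exact remaining_of_next hG hm hv hd h'

theorem triple_phases (hG : G.Connected) (hm : Fintype.card V ≤ m + 1) (σ : PortNumbering G)
    (k : ℕ) :
    Triple σ (fun c => Remaining (k + 1) c.mem) (phases m (k + 1))
      (fun c => Remaining 1 c.mem) := by
  induction k with
  | zero => exact Triple.nil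
  | succ k ih => exact Triple.append (triple_phase hG hm σ k) ih

omit [DecidableEq V] in
theorem Remaining.uniqueLeader {mem : NetMem G} (h : Remaining 1 mem) : UniqueLeader mem := by
  have h1 : numEligible mem = 1 := le_antisymm h.le h.pos
  obtain ⟨v, hv⟩ := Finset.card_eq_one.1 h1
  have hel : ∀ u, Eligible mem u ↔ u = v := fun u => by
    have : u ∈ Finset.univ.filter (Eligible mem) ↔ u ∈ ({v} : Finset V) := by rw [hv]
    simpa using this
  exact ⟨v, (hel v).2 rfl, fun u hu => (h.status u).resolve_left fun he => hu ((hel u).1 he)⟩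

theorem weight_initial (m : ℕ) : (initial G m).weight = 1 := by
  have h : ∀ x : NetBasis G m, (∀ v q, x v q = 0) ↔ x = fun _ _ => 0 := fun x => by
    simp only [funext_iff]
  unfold Config.weight
  rw [Finset.sum_eq_single fun _ _ => 0]
  · simp [initial]
  · intro x _ hx
    simp only [initial]
    rw [if_neg fun h' => hx ((h x).1 h')]
    simp
  · simp

theorem prob_uniqueLeader (hG : G.Connected) (hm : Fintype.card V = m + 1)
    (σ : PortNumbering G) :
    (program (m + 1)).prob σ (initial G m) UniqueLeader = 1 := by
  rw [← weight_initial (G := G) m]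
  refine Program.prob_eq_weight σ _ _ _ fun c' hc' h0 => ?_
  refine Remaining.uniqueLeader ?_
  -- At the start all `m + 1` parties are eligible, so the invariant holds with the full number of
  -- parties.
  refine (Triple.cons (q := fun c => Remaining (m + 1) c.mem) ?_ (triple_phases hG hm.le σ m) :
    Triple σ (fun c => c = initial G m) _ _) _ rfl c' hc' h0
  rintro _ rfl c h _
  obtain ⟨r, hr, hmem, -⟩ := Step.mem_next_compute h
  have he : ∀ v, c.mem v (var .status) = eligible := fun v => by
    rw [hmem, (Instr.outcome_of_prepare (by simp) (hr v)).1]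
    simp [initial]
  have hn : numEligible c.mem = m + 1 := by
    rw [numEligible, Finset.filter_true_of_mem (p := Eligible c.mem) fun v _ => he v,
      Finset.card_univ, hm]
  exact ⟨fun v => .inl (he v), by omega, hn.le⟩

end AlgorithmI

end QNet

namespace QNet

/-! ## Resources -/

theorem sum_map_flatMap_le {α β : Type*} (l : List α) (g : α → List β) (f : β → ℕ) (B : ℕ)
    (h : ∀ a ∈ l, ((g a).map f).sum ≤ B) : ((l.flatMap g).map f).sum ≤ l.length * B := by
  induction l with
  | nil => simp
  | cons a l ih =>
    rw [List.flatMap_cons, List.map_append, List.sum_append, List.length_cons, add_mul, one_mul,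
      add_comm]
    exact add_le_add (ih fun b hb => h b (List.mem_cons_of_mem _ hb)) (h a List.mem_cons_self)

theorem sum_map_le_length {α : Type*} (l : List α) (f : α → ℕ) (B : ℕ)
    (h : ∀ a ∈ l, f a ≤ B) : (l.map f).sum ≤ l.length * B := by
  simpa using List.sum_le_card_nsmul (l.map f) B (by simpa using h)

namespace AlgorithmI

variable {m d : ℕ}

abbrev NetStep (m : ℕ) : Type := Step Val (fun _ => CVar) Unit (QVar m) (Fin m × Fin 2)

/-- One count for every additive cost `f`. A phase has eight steps outside the loops, one
preparation of the `X` registers, and `m` iterations of each loop: three steps of Subroutine A,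
executed forwards and inverted, and three of Subroutine C. -/
theorem sum_phase_le (f : NetStep m → ℕ) (j c cX cA cC : ℕ)
    (hfix : ∀ s ∈ ([.compute (initPhase m), .compute (loadX m), .compute (flipS m),
      (Step.compute (loadX m)).inv, .compute (measureConsistency j m), .compute (measureVote m),
      .compute fun _ => [.assign (var .zmax) (fun a _ => a) (var .z) (var .z)],
      .compute (updateStatus m)] : List (NetStep m)), f s ≤ c)
    (hX : f (.compute (prepareX m)) ≤ cX)
    (hA : ∀ t : Fin m, ∀ s ∈ ([.compute (spreadX t), .exchange {(t, 0), (t, 1)} ∅,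
      .compute (combineX t)] : List (NetStep m)), f s ≤ cA ∧ f s.inv ≤ cA)
    (hC : ∀ s ∈ ([.compute (sendMax m), .exchange ∅ {()}, .compute (receiveMax m)] :
      List (NetStep m)), f s ≤ cC) :
    ((phase m j).map f).sum ≤ 8 * c + cX + m * (6 * cA + 3 * cC) := by
  have h1 : ((loopA m).map f).sum ≤ m * (3 * cA) := by
    have := sum_map_flatMap_le (List.finRange m) (fun t => ([.compute (spreadX t),
      .exchange {(t, 0), (t, 1)} ∅, .compute (combineX t)] : List (NetStep m))) f (3 * cA)
      fun t _ => sum_map_le_length _ _ _ fun s hs => (hA t s hs).1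
    rwa [List.length_finRange] at this
  have h2 : ((loopA m).map fun s => f s.inv).sum ≤ m * (3 * cA) := by
    have := sum_map_flatMap_le (List.finRange m) (fun t => ([.compute (spreadX t),
      .exchange {(t, 0), (t, 1)} ∅, .compute (combineX t)] : List (NetStep m)))
      (fun s => f s.inv) (3 * cA)
      fun t _ => sum_map_le_length _ _ _ fun s hs => (hA t s hs).2
    rwa [List.length_finRange] at this
  have h3 : (((List.finRange m).flatMap fun _ => ([.compute (sendMax m), .exchange ∅ {()},
      .compute (receiveMax m)] : List (NetStep m))).map f).sum ≤ m * (3 * cC) := by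
    have := sum_map_flatMap_le (List.finRange m) (fun _ => ([.compute (sendMax m),
      .exchange ∅ {()}, .compute (receiveMax m)] : List (NetStep m))) f (3 * cC)
      fun t _ => sum_map_le_length _ _ _ hC
    rwa [List.length_finRange] at this
  have e : ((phase m j).map f).sum = f (.compute (initPhase m)) + f (.compute (prepareX m)) +
      f (.compute (loadX m)) + ((loopA m).map f).sum + f (.compute (flipS m)) +
      ((loopA m).map fun s => f s.inv).sum + f (Step.compute (loadX m)).inv +
      f (.compute (measureConsistency j m)) + f (.compute (measureVote m)) +
      f (.compute fun _ => [.assign (var .zmax) (fun a _ => a) (var .z) (var .z)]) +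
      (((List.finRange m).flatMap fun _ => ([.compute (sendMax m), .exchange ∅ {()},
        .compute (receiveMax m)] : List (NetStep m))).map f).sum +
      f (.compute (updateStatus m)) := by
    rw [phase_eq, checkConsistency, gather, subroutineC_eq]
    simp only [List.map_append, List.map_cons, List.map_nil, List.sum_append, List.sum_cons,
      List.sum_nil, List.reverse_cons, List.map_reverse, List.map_map, List.sum_reverse,
      Function.comp_def]
    ring
  simp only [List.forall_mem_cons, List.not_mem_nil, false_imp_iff, implies_true, and_true] at hfix
  rw [e]
  have e2 : m * (6 * cA + 3 * cC) = m * (3 * cA) + m * (3 * cA) + m * (3 * cC) := by ring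
  omega

theorem sum_program_le (f : NetStep m → ℕ) (c B : ℕ)
    (h0 : f (.compute fun _ => [.prepare R0, .prepare R1, .prepare S]) ≤ c)
    (h : ∀ j, ((phase m j).map f).sum ≤ B) :
    ((program (m + 1)).map f).sum ≤ c + (m + 1) * B := by
  have hk : ∀ k, ((phases m k).map f).sum ≤ k * B := by
    intro k
    induction k with
    | zero => simp [phases]
    | succ k ih =>
      rcases k with _ | j
      · simp [phases]
      · rw [phases, List.map_append, List.sum_append, add_mul, one_mul, add_comm]
        exact add_le_add ih (h j)
  have e : ((program (m + 1)).map f).sum =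
      f (.compute fun _ => [.prepare R0, .prepare R1, .prepare S]) +
        ((phases m (m + 1)).map f).sum := by
    simp [program]
  rw [e]
  exact add_le_add h0 (hk _)

theorem rounds_le (m : ℕ) : (program (m + 1)).rounds ≤ 9 * (m + 1) ^ 2 := by
  -- All nine loop steps are charged one round each, although only three of them communicate.
  refine (sum_program_le (m := m) _ 0 (m * (6 * 1 + 3 * 1)) le_rfl fun j =>
    (sum_phase_le (m := m) _ j 0 0 1 1 ?_ le_rfl ?_ ?_).trans (by omega)).trans ?_
  · simp [Step.inv]
  · simp [Step.inv]
  · simp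
  · nlinarith

theorem qubitCommunication_le (m d : ℕ) :
    (program (m + 1)).qubitCommunication d ≤ 24 * (d * (m + 1) ^ 2) := by
  -- Two qubits are sent and two received per port, hence `4 * d`; Subroutine C exchanges no qubits.
  refine (sum_program_le (m := m) _ 0 (m * (6 * (4 * d) + 3 * 0)) le_rfl fun j =>
    (sum_phase_le (m := m) _ j 0 0 (4 * d) 0 ?_ le_rfl ?_ ?_).trans (by omega)).trans ?_
  · simp [Step.inv]
  · intro t
    have : ({(t, 0), (t, 1)} : Finset (Fin m × Fin 2)).card = 2 := by simp
    simp [Step.inv]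
    omega
  · simp
  · have h : m * (d * (m + 1)) ≤ (m + 1) * (d * (m + 1)) := by gcongr; omega
    nlinarith

theorem symbolBits_val : Program.symbolBits Val = 3 := by
  have : Fintype.card Val = 5 := rfl
  rw [Program.symbolBits, this]
  norm_num [Nat.clog]

theorem sent_le (m d : ℕ) : (program (m + 1)).sent d ≤ 21 * (d * (m + 1) ^ 2) := by
  -- Per port, two qubits are sent in Subroutine A, and three bits, enough for the five symbols, in
  -- Subroutine C.
  refine (sum_program_le (m := m) _ 0 (m * (6 * (2 * d) + 3 * (3 * d))) le_rfl fun j =>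
    (sum_phase_le (m := m) _ j 0 0 (2 * d) (3 * d) ?_ le_rfl ?_ ?_).trans (by omega)).trans ?_
  · simp [Step.inv]
  · intro t
    simp [Step.inv]
    omega
  · simp [symbolBits_val]
    omega
  · have h : m * (d * (m + 1)) ≤ (m + 1) * (d * (m + 1)) := by gcongr; omega
    nlinarith

theorem cost_guard_of_mem_subroutineB {j : ℕ} {a : Ins m d} (ha : a ∈ subroutineB j m d) :
    (Instr.guard (var .s) consistent (ifStatus eligible a)).cost = 3 := by
  unfold subroutineB at ha
  split_ifs at ha <;>
    simp only [List.mem_cons, List.not_mem_nil, or_false] at ha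
  · subst ha; rfl
  · rcases ha with rfl | rfl <;> rfl

theorem cost_measureConsistency_le (j m d : ℕ) :
    ((measureConsistency j m d).map Instr.cost).sum ≤ 12 := by
  -- At most two instructions, each with two tests.
  have hB : (((subroutineB j m d).map
      fun a => Instr.guard (var .s) consistent (ifStatus eligible a)).map Instr.cost).sum ≤ 6 := by
    rw [List.map_map]
    refine (sum_map_le_length _ _ 3 fun a ha => (cost_guard_of_mem_subroutineB ha).le).trans ?_
    have : (subroutineB j m d).length ≤ 2 := by
      unfold subroutineB
      split_ifs <;> simp
    omega
  simp only [ifStatus] at hB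
  simp only [measureConsistency, List.map_append, List.sum_append, List.map_cons, List.map_nil,
    List.sum_cons, List.sum_nil, Instr.cost, ifStatus]
  omega

theorem cost_spreadX (t : Fin m) (d : ℕ) : ((spreadX t d).map Instr.cost).sum ≤ d * 2 := by
  have := sum_map_flatMap_le (List.finRange d) (fun i => (List.finRange 2).map fun b =>
    (copy (X0 t.castSucc b) (X t i b) (by simp) : Ins m d)) Instr.cost 2 fun i _ => by
      simp [copy, Instr.cost, Function.comp_def]
  rwa [List.length_finRange] at this

theorem cost_combineX (t : Fin m) (d : ℕ) :
    ((combineX t d).map Instr.cost).sum ≤ 4 + d * 2 := by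
  have := sum_map_flatMap_le (List.finRange d) (fun i => (List.finRange 2).map fun b =>
    (.toggle (fun a a' => max a a') (Y t i.castSucc b) (X t i b) (Y t i.succ b)
      (by simp [Fin.ext_iff]) (by simp) : Ins m d)) Instr.cost 2 fun i _ => by
      simp [Instr.cost, Function.comp_def]
  rw [List.length_finRange] at this
  simp only [combineX, List.map_append, List.sum_append]
  have h2 : ∀ f : Fin 2 → Ins m d, (∀ b, (f b).cost = 1) →
      (((List.finRange 2).map f).map Instr.cost).sum = 2 := fun f hf => by
    simp [hf, Function.comp_def]
  rw [h2 _ fun _ => rfl, h2 _ fun _ => rfl]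
  omega

theorem cost_prepareX (m d : ℕ) :
    ((prepareX m d).map Instr.cost).sum ≤ (m + 1) * 2 + m * ((d + 1) * 2 + d * 2) := by
  have h1 : ∀ (n : ℕ) (g : Fin n → Fin 2 → Q m d), (((List.finRange n).flatMap fun t =>
      (List.finRange 2).map fun b => (.prepare (g t b) : Ins m d)).map Instr.cost).sum ≤ n * 2 := by
    intro n g
    have := sum_map_flatMap_le (List.finRange n) (fun t => (List.finRange 2).map fun b =>
      (.prepare (g t b) : Ins m d)) Instr.cost 2 fun i _ => by
        simp [Instr.cost, Function.comp_def]
    rwa [List.length_finRange] at this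
  rw [prepareX, List.map_append, List.sum_append]
  refine add_le_add (h1 _ _) ?_
  refine (sum_map_flatMap_le _ _ _ _ fun t _ => ?_).trans
    (Nat.mul_le_mul_right _ (List.length_finRange).le)
  rw [List.map_append, List.sum_append]
  exact add_le_add (h1 _ _) (h1 _ _)

theorem time_le (m : ℕ) {d : ℕ} (hd : 1 ≤ d) :
    (program (m + 1)).time d ≤ 250 * (d * (m + 1) ^ 2) := by
  -- The costliest step outside the loops has at most 12 units plus one for control, within 14. The
  -- bound `5 + 4 * d` covers the combination as well as the qubit exchange, and `2 + 6 * d` covers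
  -- the exchange of three bits per port.
  refine (sum_program_le (m := m) _ 4 (8 * 14 + (1 + ((m + 1) * 2 + m * ((d + 1) * 2 + d * 2))) +
    m * (6 * (5 + 4 * d) + 3 * (2 + 6 * d))) ?_ fun j =>
    sum_phase_le (m := m) _ j 14 (1 + ((m + 1) * 2 + m * ((d + 1) * 2 + d * 2))) (5 + 4 * d)
      (2 + 6 * d) ?_ ?_ ?_ ?_).trans ?_
  · simp [Instr.cost]
  · have := cost_measureConsistency_le j m d
    simp [Step.inv, Instr.cost, initPhase, loadX, flipS, measureVote, updateStatus, ifStatus, copy]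
    omega
  · have := cost_prepareX m d
    dsimp only
    omega
  · intro t
    have h1 := cost_spreadX t d
    have h2 := cost_combineX t d
    simp [Step.inv]
    omega
  · simp [symbolBits_val, sendMax, receiveMax, Instr.cost, Function.comp_def]
    omega
  · have h : m ≤ m * d := by nlinarith
    have h' : m * (m + 1) * 1 ≤ m * (m + 1) * d := by gcongr
    nlinarith

end AlgorithmI

end QNet

/-! ### The theorem -/

open QNet
theorem theorem1 :
    ∃ K : ℕ, ∀ (V : Type*) [Fintype V] [DecidableEq V] (G : SimpleGraph V) [DecidableRel G.Adj]
      (σ : PortNumbering G) (n : ℕ), G.Connected → Fintype.card V = n →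
      (AlgorithmI.program n).prob σ (AlgorithmI.initial G (n - 1)) AlgorithmI.UniqueLeader = 1 ∧
      (AlgorithmI.program n).rounds ≤ K * n ^ 2 ∧
      (2 ≤ n → ∀ v, (AlgorithmI.program n).time (G.degree v) ≤ K * (G.maxDegree * n ^ 2)) ∧
      (∀ v, (AlgorithmI.program n).qubitCommunication (G.degree v) ≤ K * (G.degree v * n ^ 2)) ∧
      ∑ v, (AlgorithmI.program n).sent (G.degree v) ≤ K * (G.edgeFinset.card * n ^ 2) := by
  -- The constant is dictated by the time bound; the other bounds need less.
  refine ⟨250, fun V _ _ G _ σ n hG hn => ?_⟩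
  have hpos : 0 < n := hn ▸ Fintype.card_pos_iff.2 hG.nonempty
  obtain ⟨m, rfl⟩ : ∃ m, n = m + 1 := ⟨_, (Nat.succ_pred_eq_of_pos hpos).symm⟩
  refine ⟨AlgorithmI.prob_uniqueLeader hG hn σ,
    (AlgorithmI.rounds_le m).trans (by gcongr; norm_num),
    fun h2 v => ?_, fun v => (AlgorithmI.qubitCommunication_le m _).trans (by gcongr; norm_num), ?_⟩
  -- With at least two parties, connectedness gives every party a port, so that the costs
  -- independent of `d` are absorbed by the factor `d`.
  · have : Nontrivial V := Fintype.one_lt_card_iff_nontrivial.1 (by omega)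
    refine (AlgorithmI.time_le m (hG.preconnected.degree_pos_of_nontrivial v)).trans ?_
    gcongr
    exact G.degree_le_maxDegree v
  · refine (Finset.sum_le_sum fun v _ => AlgorithmI.sent_le m (G.degree v)).trans ?_
    -- The handshake lemma turns the sum of the degrees into `2 * |E|`, giving the factor 42.
    rw [← Finset.mul_sum, ← Finset.sum_mul, G.sum_degrees_eq_twice_card_edges]
    nlinarith [Nat.zero_le (G.edgeFinset.card * (m + 1) ^ 2)]
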